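/- Let $G=(V,E)$ be a finite simple graph with $n=|V|$ and let $w\ge 1$ be an integer. A feasible solution $(x,y,d)$ of the spreading-metric LP for $(G,w)$ consists of real numbers $x_e\ge 0$ ($e\in E$), $y^S_v\ge 0$ ($S\subseteq V$, $v\in V$) and $d^S_{uv}$ ($S\subseteq V$, $u,v\in V$) such that $$\sum_{v\in V}y^S_v\le w\quad\text{for all } S\subseteq V,$$ $$d^S_{uv}\le\sum_{e\in E(P)}x_e+\sum_{t\in V(P)}y^S_t\quad\text{for all } S\subseteq V,\ u,v\in V \text{ and every path } P \text{ from } u \text{ to } v,$$ $$\sum_{v\in U}d^S_{uv}\ge|U|-\frac{|S|}{2}\quad\text{for all } U\subseteq S\subseteq V,\ u\in U,$$ where $V(P)$ includes the endpoints of $P$, and the one-vertex path is the path from $u$ to $u$. **Lemma.** There are an algorithm and an absolute constant $C>0$ such that, for every such $G$ and $w$ and every feasible solution $(x,y,d)$, the algorithm, given $G$, $w$ and oracle access to $(x,y,d)$, finds within $\mathrm{poly}(n)$ steps (a polynomial bound not depending on $w$ or on the solution) an edge set $F\subseteq E$ with $$\operatorname{tw}(G-F)\le C\,w\log(w+1)\qquad\text{and}\qquad|F|\le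 C\,\log(n+2)\,\log\log(n+2)\sum_{uv\in E}x_{uv}.$$ That is, $\operatorname{tw}(G-F)\le O(w\log w)$ and $|F|\le O(\log n\log\log n)\sum_{uv\in E}x_{uv}$; the shifted logarithms only make the bounds meaningful for $w=1$ and $n\le 2$. Here the algorithm is one fixed program of a random access machine whose memory holds natural numbers and real numbers. The machine adds, subtracts and compares such numbers at unit cost, with no unit-cost multiplication and no rounding of reals, and it obtains a value $x_{uv}$, $y^S_v$ or $d^S_{uv}$ by a unit-cost oracle query, the set $S$ being given by an indicator vector in memory. -/

import Mathlib

/-! ### Treewidth -/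

/-- `(T, bag)` is a tree decomposition of `G`: a finite tree `T` with a bag of vertices at each node,
every edge lies in some bag, and the nodes whose bags contain a given vertex form a nonempty
subtree. -/
structure IsTreeDecomposition {V : Type*} (G : SimpleGraph V) {m : ℕ}
    (T : SimpleGraph (Fin m)) (bag : Fin m → Finset V) : Prop where
  isTree : T.IsTree
  edge_covered : ∀ u v : V, G.Adj u v → ∃ t, u ∈ bag t ∧ v ∈ bag t
  subtree : ∀ v : V, (T.induce {t | v ∈ bag t}).Connected

/-- The width of a decomposition: the largest size of a bag, minus one
(with value `0` if all bags are empty). -/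
def decompositionWidth {V : Type*} {m : ℕ} (bag : Fin m → Finset V) : ℕ :=
  Finset.univ.sup (fun t => (bag t).card) - 1

/-- The treewidth of `G`: the least width of a tree decomposition of `G`. -/
noncomputable def treewidth {V : Type*} (G : SimpleGraph V) : ℕ :=
  sInf {k | ∃ (m : ℕ) (T : SimpleGraph (Fin m)) (bag : Fin m → Finset V),
    IsTreeDecomposition G T bag ∧ decompositionWidth bag = k}

/-! ### The linear program -/

/-- An assignment to the variables of the linear program on the vertex set `Fin n`: `x e` for edges
`e` (only the values on edges of the graph matter), `y S v` and `d S u v` for vertex sets `S` and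
vertices `u`, `v`. -/
structure LPSolution (n : ℕ) where
  x : Sym2 (Fin n) → ℝ
  y : Finset (Fin n) → Fin n → ℝ
  d : Finset (Fin n) → Fin n → Fin n → ℝ

/-- Feasibility for the spreading-metric linear program of the graph `G` with parameter `w`.
The one-vertex path from `u` to `u` is among the paths. -/
structure LPSolution.Feasible {n : ℕ} (G : SimpleGraph (Fin n)) (w : ℕ) (s : LPSolution n) :
    Prop where
  x_nonneg : ∀ e ∈ G.edgeSet, 0 ≤ s.x e
  y_nonneg : ∀ S v, 0 ≤ s.y S v
  budget : ∀ S, ∑ v, s.y S v ≤ (w : ℝ)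
  path_bound : ∀ (S : Finset (Fin n)) (u v : Fin n) (P : G.Walk u v), P.IsPath →
    s.d S u v ≤ (P.edges.map s.x).sum + (P.support.map (s.y S)).sum
  spreading : ∀ S U : Finset (Fin n), U ⊆ S → ∀ u ∈ U,
    (U.card : ℝ) - (S.card : ℝ) / 2 ≤ ∑ v ∈ U, s.d S u v

/-! ### The machine model

A random access machine with oracle access to a solution of the linear program. Its memory consists
of two-dimensional arrays of natural numbers and two-dimensional arrays of real numbers; a program
names finitely many of them. The only arithmetic operations are addition and subtraction, and the
only way to use a real number for control is a comparison; in particular there is no unit-cost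
multiplication and no rounding of reals. Every operation, memory access, comparison and oracle
query takes one step. -/

namespace OracleRAM

/-- Natural number expressions: constants, array entries, sums, truncated differences. -/
inductive NatExpr : Type
  | const (k : ℕ) : NatExpr
  | get (a : ℕ) (i j : NatExpr) : NatExpr
  | add (e f : NatExpr) : NatExpr
  | sub (e f : NatExpr) : NatExpr

/-- Real number expressions: natural numbers, array entries, sums, differences, and the oracle
queries for `x_{uv}`, `y^S_v` and `d^S_{uv}`, where the set `S` is described by row `i` of the
array `a` of natural numbers. -/
inductive RealExpr : Type
  | ofNat (e : NatExpr) : RealExpr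
  | get (a : ℕ) (i j : NatExpr) : RealExpr
  | add (e f : RealExpr) : RealExpr
  | sub (e f : RealExpr) : RealExpr
  | queryX (u v : NatExpr) : RealExpr
  | queryY (a : ℕ) (i v : NatExpr) : RealExpr
  | queryD (a : ℕ) (i u v : NatExpr) : RealExpr

/-- Tests. -/
inductive Test : Type
  | natLE (e f : NatExpr) : Test
  | realLE (e f : RealExpr) : Test
  | not (b : Test) : Test
  | and (b c : Test) : Test

/-- Programs. -/
inductive Prog : Type
  | skip : Prog
  | setNat (a : ℕ) (i j e : NatExpr) : Prog
  | setReal (a : ℕ) (i j : NatExpr) (e : RealExpr) : Prog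
  | seq (p q : Prog) : Prog
  | ite (b : Test) (p q : Prog) : Prog
  | loop (b : Test) (p : Prog) : Prog

/-- Memory contents: array name, row, column. -/
structure Memory where
  nat : ℕ → ℕ → ℕ → ℕ
  real : ℕ → ℕ → ℕ → ℝ

/-- The memory after writing `k` into entry `(i, j)` of the array `a` of natural numbers. -/
def Memory.writeNat (M : Memory) (a i j k : ℕ) : Memory where
  nat := fun a' i' j' => if a' = a ∧ i' = i ∧ j' = j then k else M.nat a' i' j'
  real := M.real

/-- The memory after writing `r` into entry `(i, j)` of the array `a` of real numbers. -/
noncomputable def Memory.writeReal (M : Memory) (a i j : ℕ) (r : ℝ) : Memory where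
  nat := M.nat
  real := fun a' i' j' => if a' = a ∧ i' = i ∧ j' = j then r else M.real a' i' j'

/-- The vertex set whose indicator vector is row `i` of the array `a` of natural numbers. -/
def Memory.rowSet (M : Memory) (n a i : ℕ) : Finset (Fin n) :=
  Finset.univ.filter (fun v => M.nat a i v ≠ 0)

/-- Number of steps for evaluating an expression: its number of nodes. -/
def NatExpr.cost : NatExpr → ℕ
  | const _ => 1
  | get _ i j => i.cost + j.cost + 1
  | add e f => e.cost + f.cost + 1
  | sub e f => e.cost + f.cost + 1

/-- Number of steps for evaluating: the number of nodes. -/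
def RealExpr.cost : RealExpr → ℕ
  | ofNat e => e.cost + 1
  | get _ i j => i.cost + j.cost + 1
  | add e f => e.cost + f.cost + 1
  | sub e f => e.cost + f.cost + 1
  | queryX u v => u.cost + v.cost + 1
  | queryY _ i v => i.cost + v.cost + 1
  | queryD _ i u v => i.cost + u.cost + v.cost + 1

/-- Number of steps for evaluating: the number of nodes. -/
def Test.cost : Test → ℕ
  | natLE e f => e.cost + f.cost + 1
  | realLE e f => e.cost + f.cost + 1
  | not b => b.cost + 1
  | and b c => b.cost + c.cost + 1

/-- Value of a natural number expression. -/
def NatExpr.eval (M : Memory) : NatExpr → ℕ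
  | const k => k
  | get a i j => M.nat a (i.eval M) (j.eval M)
  | add e f => e.eval M + f.eval M
  | sub e f => e.eval M - f.eval M

/-- Answer to the query for `x_{uv}`; it is `0` if `uv` is not an edge. -/
noncomputable def answerX {n : ℕ} (G : SimpleGraph (Fin n)) (s : LPSolution n) (u v : ℕ) : ℝ :=
  open Classical in
  if h : u < n ∧ v < n then
    if G.Adj ⟨u, h.1⟩ ⟨v, h.2⟩ then s.x s(⟨u, h.1⟩, ⟨v, h.2⟩) else 0
  else 0

/-- Answer to the query for `y^S_v`; it is `0` if `v` is not a vertex. -/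
noncomputable def answerY {n : ℕ} (s : LPSolution n) (S : Finset (Fin n)) (v : ℕ) : ℝ :=
  if h : v < n then s.y S ⟨v, h⟩ else 0

/-- Answer to the query for `d^S_{uv}`; it is `0` if `u` or `v` is not a vertex. -/
noncomputable def answerD {n : ℕ} (s : LPSolution n) (S : Finset (Fin n)) (u v : ℕ) : ℝ :=
  if h : u < n ∧ v < n then s.d S ⟨u, h.1⟩ ⟨v, h.2⟩ else 0

/-- Value of a real number expression. -/
noncomputable def RealExpr.eval {n : ℕ} (G : SimpleGraph (Fin n)) (s : LPSolution n)
    (M : Memory) : RealExpr → ℝ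
  | ofNat e => (e.eval M : ℝ)
  | get a i j => M.real a (i.eval M) (j.eval M)
  | add e f => e.eval G s M + f.eval G s M
  | sub e f => e.eval G s M - f.eval G s M
  | queryX u v => answerX G s (u.eval M) (v.eval M)
  | queryY a i v => answerY s (M.rowSet n a (i.eval M)) (v.eval M)
  | queryD a i u v => answerD s (M.rowSet n a (i.eval M)) (u.eval M) (v.eval M)

/-- Truth of a test. -/
def Test.Holds {n : ℕ} (G : SimpleGraph (Fin n)) (s : LPSolution n) (M : Memory) : Test → Prop
  | natLE e f => e.eval M ≤ f.eval M
  | realLE e f => e.eval G s M ≤ f.eval G s M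
  | not b => ¬ b.Holds G s M
  | and b c => b.Holds G s M ∧ c.Holds G s M

/-- `Runs G s p M M' t`: started in memory `M`, with the oracle answering according to `s`, the
program `p` halts in memory `M'` after exactly `t` steps. -/
inductive Runs {n : ℕ} (G : SimpleGraph (Fin n)) (s : LPSolution n) :
    Prog → Memory → Memory → ℕ → Prop
  | skip (M : Memory) : Runs G s Prog.skip M M 1
  | setNat (M : Memory) (a : ℕ) (i j e : NatExpr) :
      Runs G s (Prog.setNat a i j e) M (M.writeNat a (i.eval M) (j.eval M) (e.eval M))
        (i.cost + j.cost + e.cost + 1)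
  | setReal (M : Memory) (a : ℕ) (i j : NatExpr) (e : RealExpr) :
      Runs G s (Prog.setReal a i j e) M (M.writeReal a (i.eval M) (j.eval M) (e.eval G s M))
        (i.cost + j.cost + e.cost + 1)
  | seq {p q : Prog} {M M' M'' : Memory} {t t' : ℕ} :
      Runs G s p M M' t → Runs G s q M' M'' t' → Runs G s (Prog.seq p q) M M'' (t + t')
  | ite_true {b : Test} {p q : Prog} {M M' : Memory} {t : ℕ} :
      b.Holds G s M → Runs G s p M M' t → Runs G s (Prog.ite b p q) M M' (b.cost + t)
  | ite_false {b : Test} {p q : Prog} {M M' : Memory} {t : ℕ} :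
      ¬ b.Holds G s M → Runs G s q M M' t → Runs G s (Prog.ite b p q) M M' (b.cost + t)
  | loop_done {b : Test} {p : Prog} {M : Memory} :
      ¬ b.Holds G s M → Runs G s (Prog.loop b p) M M b.cost
  | loop_step {b : Test} {p : Prog} {M M' M'' : Memory} {t t' : ℕ} :
      b.Holds G s M → Runs G s p M M' t → Runs G s (Prog.loop b p) M' M'' t' →
      Runs G s (Prog.loop b p) M M'' (b.cost + t + t')

/-- The initial memory: array `0` of natural numbers holds the adjacency matrix of `G`, array `1`
holds `n` and `w` in its entries `(0, 0)` and `(0, 1)`, and all other entries are `0`. -/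
noncomputable def input {n : ℕ} (G : SimpleGraph (Fin n)) (w : ℕ) : Memory where
  nat := fun a i j =>
    open Classical in
    if a = 0 then
      if ∃ u v : Fin n, (u : ℕ) = i ∧ (v : ℕ) = j ∧ G.Adj u v then 1 else 0
    else if a = 1 ∧ i = 0 ∧ j = 0 then n
    else if a = 1 ∧ i = 0 ∧ j = 1 then w
    else 0
  real := fun _ _ _ => 0

/-- The memory `M` outputs the edge set `F`: array `2` of natural numbers holds (the nonzero
pattern of) the adjacency matrix of `F`. -/
def Outputs {n : ℕ} (M : Memory) (F : Finset (Sym2 (Fin n))) : Prop :=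
  ∀ u v : Fin n, s(u, v) ∈ F ↔ M.nat 2 u v ≠ 0

end OracleRAM

/-! The algorithm removes the vertices one by one and builds a tree decomposition of `G - F` from
the root downwards. Let `b` be the number of binary digits of `w` and `K = 1024 b w`. Vertices not
yet removed form labelled pieces with no surviving edge between different pieces. The boundary of a
piece, meaning the removed vertices with a surviving edge into it, has at most `K` elements and lies
in a single bag. Processing a vertex `v` of a piece with boundary `B` attaches a leaf whose bag
consists of `B`, `v` and possibly some further vertices of the piece. If `|B| < K`, the bag `B ∪
{v}` is enough and nothing is cut.

If `|B| = K`, the piece has to be split so that boundaries do not grow. The LP values for `S = B`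
give edge lengths `x` and vertex lengths `y^B` of total at most `w`. By the spreading constraint a
ball of radius below `1/4` around `u ∈ B` contains at most two thirds of `B`
(`EntryDist.card_ball_le`). Balls around elements of `B` are cut out until none of `B` is left:
edges crossing the sphere go to `F`, vertices crossing it go to a set `Q`. If `|Q| ≤ 2K/9`, every
new boundary has at most `1 + 2K/9 + 2K/3 ≤ K` elements and the new bag at most `2K`
(`PhaseInv.finish`), so the treewidth is `O(w log w)`.

One radius must serve vertices and edges simultaneously (`exists_radius`). For vertices this is
ordinary region growing with the logarithm of the ball's vertex volume: at most `(1024 b / 9)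
(volume + seed)` vertices cross. The balls of a phase are disjoint and the total vertex length is at
most `w`, so the crossings add up to at most `2K/9`. For edges the growth function is an iterated
logarithm: the number crossing is `O(log log n)` times `m log (e W / m)`, where `W` is the volume of
the piece and `m` that of the smaller side together with the crossing edges. If every radius in `[0,
1/4)` failed, a bounded potential would increase there with slope at least one.

The edge cuts are paid for by the potential `∑ v log ((v + σ) / σ)` over the volumes `v` of the
pieces. Splitting a piece lowers it by a constant times `m log (W / m)`, up to a seed term
(`entropyPot_drop`). The potential starts at `O(log n)` times the total volume and there are at most
`n²` balls, which yields `|F| = O(log n log log n) ∑ x`.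

On the machine, distances come from `n` rounds of relaxation, and a good radius is found by
exhaustive search, because goodness changes only at polynomially many critical values. Products are
repeated additions, volumes are multiplied by `n³` instead of dividing the seed, and logarithms are
replaced by numbers of binary digits or of factors `16`. All loops run `n` times, so the time does
not depend on `w`; if `w ≥ n`, the empty set is output. -/

/-! ### Structured programs

Programs whose only loops run a counter through `0, …, n - 1`. They denote total functions on
memories, and their running time is polynomial. -/

namespace OracleRAM

variable {n : ℕ} {G : SimpleGraph (Fin n)} {s : LPSolution n}

/-- Structured programs; `forN i p` runs `p` with entry `(0, 0)` of array `i` equal to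
`0, …, n - 1`. -/
inductive SProg : Type
  | skip : SProg
  | setNat (a : ℕ) (i j e : NatExpr) : SProg
  | setReal (a : ℕ) (i j : NatExpr) (e : RealExpr) : SProg
  | seq (p q : SProg) : SProg
  | ite (b : Test) (p q : SProg) : SProg
  | forN (i : ℕ) (p : SProg) : SProg

/-- The scalar stored in entry `(0, 0)` of an array. -/
abbrev NatExpr.var (a : ℕ) : NatExpr := .get a (.const 0) (.const 0)

/-- The scalar stored in entry `(0, 0)` of an array of reals. -/
abbrev RealExpr.var (a : ℕ) : RealExpr := .get a (.const 0) (.const 0)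

namespace SProg

/-- The program of the machine for a structured program. -/
def compile : SProg → Prog
  | skip => .skip
  | setNat a i j e => .setNat a i j e
  | setReal a i j e => .setReal a i j e
  | seq p q => .seq p.compile q.compile
  | ite b p q => .ite b p.compile q.compile
  | forN i p => .seq (.setNat i (.const 0) (.const 0) (.const 0))
      (.loop (.not (.natLE (.var 1) (.var i)))
        (.seq p.compile (.setNat i (.const 0) (.const 0) (.add (.var i) (.const 1)))))

open Classical in
/-- The memory after running a structured program. -/
noncomputable def den (G : SimpleGraph (Fin n)) (s : LPSolution n) : SProg → Memory → Memory
  | skip, M => M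
  | setNat a i j e, M => M.writeNat a (i.eval M) (j.eval M) (e.eval M)
  | setReal a i j e, M => M.writeReal a (i.eval M) (j.eval M) (e.eval G s M)
  | seq p q, M => den G s q (den G s p M)
  | ite b p q, M => if b.Holds G s M then den G s p M else den G s q M
  | forN i p, M => Nat.rec (M.writeNat i 0 0 0)
      (fun j M' => (den G s p M').writeNat i 0 0 (j + 1)) n

/-- The arrays of natural numbers that a program may write. -/
def natWrites : SProg → List ℕ
  | skip => []
  | setNat a _ _ _ => [a]
  | setReal _ _ _ _ => []
  | seq p q => p.natWrites ++ q.natWrites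
  | ite _ p q => p.natWrites ++ q.natWrites
  | forN i p => i :: p.natWrites

/-- The arrays of reals that a program may write. -/
def realWrites : SProg → List ℕ
  | skip => []
  | setNat _ _ _ _ => []
  | setReal a _ _ _ => [a]
  | seq p q => p.realWrites ++ q.realWrites
  | ite _ p q => p.realWrites ++ q.realWrites
  | forN _ p => p.realWrites

/-- Loop counters and the array holding `n` are not modified by loop bodies. -/
def WF : SProg → Prop
  | skip => True
  | setNat _ _ _ _ => True
  | setReal _ _ _ _ => True
  | seq p q => p.WF ∧ q.WF
  | ite _ p q => p.WF ∧ q.WF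
  | forN i p => i ≠ 1 ∧ i ∉ p.natWrites ∧ 1 ∉ p.natWrites ∧ p.WF

/-- Coefficient of the polynomial running time bound. -/
def coeff : SProg → ℕ
  | skip => 1
  | setNat _ i j e => i.cost + j.cost + e.cost + 1
  | setReal _ i j e => i.cost + j.cost + e.cost + 1
  | seq p q => p.coeff + q.coeff
  | ite b p q => b.cost + p.coeff + q.coeff
  | forN _ p => p.coeff + 40

/-- Nesting depth of loops. -/
def depth : SProg → ℕ
  | skip => 0
  | setNat _ _ _ _ => 0
  | setReal _ _ _ _ => 0
  | seq p q => max p.depth q.depth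
  | ite _ p q => max p.depth q.depth
  | forN _ p => p.depth + 1

instance decidableWF : (p : SProg) → Decidable p.WF
  | skip => inferInstanceAs (Decidable True)
  | setNat _ _ _ _ => inferInstanceAs (Decidable True)
  | setReal _ _ _ _ => inferInstanceAs (Decidable True)
  | seq p q =>
      haveI := decidableWF p; haveI := decidableWF q
      inferInstanceAs (Decidable (p.WF ∧ q.WF))
  | ite _ p q =>
      haveI := decidableWF p; haveI := decidableWF q
      inferInstanceAs (Decidable (p.WF ∧ q.WF))
  | forN i p =>
      haveI := decidableWF p
      inferInstanceAs (Decidable (i ≠ 1 ∧ i ∉ p.natWrites ∧ 1 ∉ p.natWrites ∧ p.WF))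

end SProg

/-! #### Reading after writing -/

@[simp] theorem writeNat_nat (M : Memory) (a i j k a' i' j' : ℕ) :
    (M.writeNat a i j k).nat a' i' j' =
      if a' = a ∧ i' = i ∧ j' = j then k else M.nat a' i' j' := rfl

@[simp] theorem writeNat_real (M : Memory) (a i j k : ℕ) :
    (M.writeNat a i j k).real = M.real := rfl

@[simp] theorem writeReal_nat (M : Memory) (a i j : ℕ) (r : ℝ) :
    (M.writeReal a i j r).nat = M.nat := rfl

@[simp] theorem writeReal_real (M : Memory) (a i j : ℕ) (r : ℝ) (a' i' j' : ℕ) :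
    (M.writeReal a i j r).real a' i' j' =
      if a' = a ∧ i' = i ∧ j' = j then r else M.real a' i' j' := rfl

theorem writeNat_nat_of_ne {a a' : ℕ} (h : a' ≠ a) (M : Memory) (i j k : ℕ) :
    (M.writeNat a i j k).nat a' = M.nat a' := by
  funext i' j'; simp [h]

theorem writeReal_real_of_ne {a a' : ℕ} (h : a' ≠ a) (M : Memory) (i j : ℕ) (r : ℝ) :
    (M.writeReal a i j r).real a' = M.real a' := by
  funext i' j'; simp [h]

attribute [simp] NatExpr.eval RealExpr.eval Test.Holds

/-! ### Frame rules, loop invariants and running time of structured programs. -/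

namespace SProg

open Classical in
@[simp] theorem den_ite (b : Test) (p q : SProg) (M : Memory) :
    (ite b p q).den G s M = if b.Holds G s M then p.den G s M else q.den G s M := by
  simp only [den]

@[simp] theorem den_skip (M : Memory) : skip.den G s M = M := rfl

@[simp] theorem den_seq (p q : SProg) (M : Memory) :
    (seq p q).den G s M = q.den G s (p.den G s M) := rfl

@[simp] theorem den_setNat (a : ℕ) (i j e : NatExpr) (M : Memory) :
    (setNat a i j e).den G s M = M.writeNat a (i.eval M) (j.eval M) (e.eval M) := rfl

@[simp] theorem den_setReal (a : ℕ) (i j : NatExpr) (e : RealExpr) (M : Memory) :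
    (setReal a i j e).den G s M = M.writeReal a (i.eval M) (j.eval M) (e.eval G s M) := rfl

/-- The frame rule. A specification only has to follow the arrays that occur as targets in the
program text, and the side condition is settled by `decide` or `simp`. -/
theorem den_nat {a : ℕ} : (p : SProg) → a ∉ p.natWrites → (M : Memory) →
    (p.den G s M).nat a = M.nat a
  | skip, _, M => rfl
  | setNat b i j e, h, M => writeNat_nat_of_ne (by simpa [natWrites] using h) _ _ _ _
  | setReal b i j e, h, M => rfl
  | seq p q, h, M => by
      simp only [natWrites, List.mem_append, not_or] at h
      rw [den_seq, den_nat q h.2, den_nat p h.1]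
  | ite b p q, h, M => by
      simp only [natWrites, List.mem_append, not_or] at h
      rw [den_ite]; split_ifs
      · exact den_nat p h.1 M
      · exact den_nat q h.2 M
  | forN i p, h, M => by
      simp only [natWrites, List.mem_cons, not_or] at h
      have : ∀ m : ℕ, (Nat.rec (M.writeNat i 0 0 0)
          (fun j M' => (den G s p M').writeNat i 0 0 (j + 1)) m : Memory).nat a = M.nat a := by
        intro m
        induction m with
        | zero => exact writeNat_nat_of_ne h.1 _ _ _ _
        | succ m ih =>
          exact (writeNat_nat_of_ne h.1 _ _ _ _).trans ((den_nat p h.2 _).trans ih)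
      exact this n

theorem den_real {a : ℕ} : (p : SProg) → a ∉ p.realWrites → (M : Memory) →
    (p.den G s M).real a = M.real a
  | skip, _, M => rfl
  | setNat b i j e, h, M => rfl
  | setReal b i j e, h, M => writeReal_real_of_ne (by simpa [realWrites] using h) _ _ _ _
  | seq p q, h, M => by
      simp only [realWrites, List.mem_append, not_or] at h
      rw [den_seq, den_real q h.2, den_real p h.1]
  | ite b p q, h, M => by
      simp only [realWrites, List.mem_append, not_or] at h
      rw [den_ite]; split_ifs
      · exact den_real p h.1 M
      · exact den_real q h.2 M
  | forN i p, h, M => by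
      simp only [realWrites] at h
      have : ∀ m : ℕ, (Nat.rec (M.writeNat i 0 0 0)
          (fun j M' => (den G s p M').writeNat i 0 0 (j + 1)) m : Memory).real a = M.real a := by
        intro m
        induction m with
        | zero => rfl
        | succ m ih => exact (den_real p h _).trans ih
      exact this n

/-- Invariant rule for loops. The invariant may not depend on the loop counter. -/
theorem forN_inv {i : ℕ} {p : SProg} {M : Memory} (I : ℕ → Memory → Prop)
    (hI : ∀ j k M', I j M' → I j (M'.writeNat i 0 0 k)) (h0 : I 0 M)
    (hs : ∀ j M', j < n → M'.nat i 0 0 = j → (∀ a, a ∉ i :: p.natWrites → M'.nat a = M.nat a) →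
      (∀ a, a ∉ p.realWrites → M'.real a = M.real a) → I j M' → I (j + 1) (p.den G s M')) :
    I n ((forN i p).den G s M) := by
  -- The invariant is carried together with the counter's value and the frame rule for the rounds
  -- done so far, since the body may rely on both.
  have : ∀ m : ℕ, m ≤ n → ∀ M', M' = (Nat.rec (M.writeNat i 0 0 0)
      (fun j M' => (den G s p M').writeNat i 0 0 (j + 1)) m : Memory) →
      M'.nat i 0 0 = m ∧ (∀ a, a ∉ i :: p.natWrites → M'.nat a = M.nat a) ∧
      (∀ a, a ∉ p.realWrites → M'.real a = M.real a) ∧ I m M' := by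
    intro m
    induction m with
    | zero =>
      rintro - M' rfl
      exact ⟨by simp, fun a ha => writeNat_nat_of_ne (by simp at ha; exact ha.1) _ _ _ _,
        fun a _ => rfl, hI _ _ _ h0⟩
    | succ m ih =>
      rintro hm M' rfl
      obtain ⟨h1, h2, h3, h4⟩ := ih (by omega) _ rfl
      refine ⟨by simp, fun a ha => ?_, fun a ha => (den_real p ha _).trans (h3 a ha),
        hI _ _ _ (hs _ _ (by omega) h1 h2 h3 h4)⟩
      have ha' : a ≠ i ∧ a ∉ p.natWrites := by simpa using ha
      exact (writeNat_nat_of_ne ha'.1 _ _ _ _).trans ((den_nat p ha'.2 _).trans (h2 a ha))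
  exact (this n le_rfl _ rfl).2.2.2

/-- A structured program halts in polynomial time in the memory that it denotes. -/
theorem runs_compile : (p : SProg) → p.WF → 1 ∉ p.natWrites → (M : Memory) → M.nat 1 0 0 = n →
    ∃ t, Runs G s p.compile M (p.den G s M) t ∧ t ≤ p.coeff * (n + 1) ^ p.depth
  | skip, _, _, M, _ => ⟨1, .skip M, by simp [coeff, depth]⟩
  | setNat a i j e, _, _, M, _ => ⟨_, .setNat M a i j e, by simp [coeff, depth]⟩
  | setReal a i j e, _, _, M, _ => ⟨_, .setReal M a i j e, by simp [coeff, depth]⟩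
  | seq p q, h, h1, M, hM => by
      simp only [natWrites, List.mem_append, not_or] at h1
      obtain ⟨t, ht, htb⟩ := runs_compile p h.1 h1.1 M hM
      obtain ⟨t', ht', htb'⟩ := runs_compile q h.2 h1.2 (p.den G s M)
        (by rw [den_nat p h1.1, hM])
      refine ⟨_, .seq ht ht', ?_⟩
      have e1 : (n + 1) ^ p.depth ≤ (n + 1) ^ (max p.depth q.depth) :=
        Nat.pow_le_pow_right (by omega) (le_max_left _ _)
      have e2 : (n + 1) ^ q.depth ≤ (n + 1) ^ (max p.depth q.depth) :=
        Nat.pow_le_pow_right (by omega) (le_max_right _ _)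
      simp only [coeff, depth, add_mul]
      exact add_le_add (htb.trans (Nat.mul_le_mul_left _ e1))
        (htb'.trans (Nat.mul_le_mul_left _ e2))
  | ite b p q, h, h1, M, hM => by
      simp only [natWrites, List.mem_append, not_or] at h1
      have e0 : 1 ≤ (n + 1) ^ (max p.depth q.depth) := Nat.one_le_pow _ _ (by omega)
      have e1 : (n + 1) ^ p.depth ≤ (n + 1) ^ (max p.depth q.depth) :=
        Nat.pow_le_pow_right (by omega) (le_max_left _ _)
      have e2 : (n + 1) ^ q.depth ≤ (n + 1) ^ (max p.depth q.depth) :=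
        Nat.pow_le_pow_right (by omega) (le_max_right _ _)
      rw [den_ite]
      split_ifs with hb
      · obtain ⟨t, ht, htb⟩ := runs_compile p h.1 h1.1 M hM
        refine ⟨_, .ite_true hb ht, ?_⟩
        simp only [coeff, depth]
        nlinarith [Nat.mul_le_mul_left p.coeff e1, Nat.mul_le_mul_left b.cost e0]
      · obtain ⟨t, ht, htb⟩ := runs_compile q h.2 h1.2 M hM
        refine ⟨_, .ite_false hb ht, ?_⟩
        simp only [coeff, depth]
        nlinarith [Nat.mul_le_mul_left q.coeff e2, Nat.mul_le_mul_left b.cost e0]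
  | forN i p, h, h1, M, hM => by
      simp only [natWrites, List.mem_cons, not_or] at h1
      obtain ⟨hi1, hip, h1p, hwf⟩ := h
      set st : ℕ → Memory := fun m => Nat.rec (M.writeNat i 0 0 0)
        (fun j M' => (den G s p M').writeNat i 0 0 (j + 1)) m with hst
      have st_succ : ∀ m, st (m + 1) = (den G s p (st m)).writeNat i 0 0 (m + 1) := fun m => rfl
      have st1 : ∀ m, (st m).nat 1 0 0 = n := by
        intro m
        induction m with
        | zero => simp [hst, Ne.symm hi1, hM]
        | succ m ih =>
          rw [st_succ, writeNat_nat_of_ne (Ne.symm hi1), den_nat p h1p, ih]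
      have sti : ∀ m, (st m).nat i 0 0 = m := by
        intro m
        cases m with
        | zero => simp [hst]
        | succ m => simp [st_succ]
      set T := p.coeff * (n + 1) ^ p.depth with hT
      -- Induction on the number `k` of rounds left. The loop test and the increment cost 8 steps
      -- each, so 20 per round suffice, and the additive 20 pays for the last, failing test.
      have key : ∀ k m, m + k = n → ∃ t, Runs G s (.loop (.not (.natLE (.var 1) (.var i)))
          (.seq p.compile (.setNat i (.const 0) (.const 0) (.add (.var i) (.const 1)))))
          (st m) (st n) t ∧ t ≤ k * (T + 20) + 20 := by
        intro k
        induction k with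
        | zero =>
          intro m hm
          obtain rfl : m = n := by omega
          refine ⟨_, .loop_done ?_, ?_⟩
          · simp [sti, st1]
          · simp [Test.cost, NatExpr.cost]
        | succ k ih =>
          intro m hm
          obtain ⟨t, ht, htb⟩ := ih (m + 1) (by omega)
          obtain ⟨t', ht', htb'⟩ := runs_compile p hwf h1p (st m) (st1 m)
          have e : st (m + 1) = (den G s p (st m)).writeNat i ((NatExpr.const 0).eval
              (den G s p (st m))) ((NatExpr.const 0).eval (den G s p (st m)))
              ((NatExpr.add (.var i) (.const 1)).eval (den G s p (st m))) := by
            rw [st_succ]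
            simp [den_nat p hip, sti]
          have hset : Runs G s (.setNat i (.const 0) (.const 0) (.add (.var i) (.const 1)))
              (den G s p (st m)) (st (m + 1)) 8 := by
            rw [e]; exact Runs.setNat _ i (.const 0) (.const 0) (.add (.var i) (.const 1))
          have hr := Runs.loop_step (G := G) (s := s)
            (b := .not (.natLE (.var 1) (.var i))) (M := st m)
            (by simp only [Test.Holds, NatExpr.eval, sti, st1]; omega)
            (.seq ht' hset) ht
          refine ⟨_, hr, ?_⟩
          simp only [Test.cost, NatExpr.cost]
          nlinarith
      obtain ⟨t, ht, htb⟩ := key n 0 (by omega)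
      refine ⟨_, .seq (.setNat M i (.const 0) (.const 0) (.const 0)) ht, ?_⟩
      simp only [NatExpr.cost, coeff, depth]
      have e0 : 1 ≤ (n + 1) ^ p.depth := Nat.one_le_pow _ _ (by omega)
      have e3 : (p.coeff + 40) * (n + 1) ^ (p.depth + 1) =
        (T + 40 * (n + 1) ^ p.depth) * (n + 1) := by rw [hT]; ring
      rw [e3]
      nlinarith [Nat.mul_le_mul_left (40 * (n + 1)) e0, Nat.zero_le T]

end SProg
end OracleRAM

/-! ### Choosing the radius of a ball -/

open Set Filter Topology in
/-- The length of the part of `[a, a + x]` to the left of `r` has a right derivative. -/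
theorem hasDerivWithinAt_clip (a x r : ℝ) (hx : 0 ≤ x) :
    HasDerivWithinAt (fun t => max 0 (min x (t - a))) (if a ≤ r ∧ r < a + x then 1 else 0)
      (Ici r) r := by
  rcases lt_or_ge r a with h | h
  · rw [if_neg (by intro h'; linarith [h'.1])]
    refine (hasDerivWithinAt_const r (Ici r) (0 : ℝ)).congr_of_eventuallyEq ?_ ?_
    · filter_upwards [mem_nhdsWithin_of_mem_nhds (Iio_mem_nhds h)] with t ht
      have ht : t < a := ht
      rw [max_eq_left]
      exact (min_le_right _ _).trans (by linarith)
    · rw [max_eq_left]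
      exact (min_le_right _ _).trans (by linarith)
  · rcases lt_or_ge r (a + x) with h' | h'
    · rw [if_pos ⟨h, h'⟩]
      refine ((hasDerivWithinAt_id r (Ici r)).sub_const a).congr_of_eventuallyEq ?_ ?_
      · filter_upwards [mem_nhdsWithin_of_mem_nhds (Iio_mem_nhds h'), self_mem_nhdsWithin]
          with t ht ht'
        have ht : t < a + x := ht
        have ht' : r ≤ t := ht'
        rw [min_eq_right (by linarith), max_eq_right (by linarith)]; rfl
      · rw [min_eq_right (by linarith), max_eq_right (by linarith)]; rfl
    · rw [if_neg (by intro h''; linarith [h''.2])]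
      have e : ∀ t, r ≤ t → max 0 (min x (t - a)) = x := by
        intro t ht
        rw [min_eq_left (by linarith), max_eq_right hx]
      refine (hasDerivWithinAt_const r (Ici r) x).congr_of_eventuallyEq ?_ (e r le_rfl)
      filter_upwards [self_mem_nhdsWithin] with t ht using e t ht

theorem continuous_clip (a x : ℝ) : Continuous (fun t : ℝ => max 0 (min x (t - a))) := by
  fun_prop

/-- The function `t ↦ t log (A / t)` is increasing as long as `log (A / t) ≥ 1`. -/
theorem mul_log_div_mono {A t m : ℝ} (ht : 0 < t) (hA : 0 < A) (htm : t ≤ m)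
    (hm : 1 ≤ Real.log (A / m)) : t * Real.log (A / t) ≤ m * Real.log (A / m) := by
  have hm0 : 0 < m := ht.trans_le htm
  have h1 : Real.log (A / t) = Real.log (A / m) + Real.log (m / t) := by
    rw [← Real.log_mul (by positivity) (by positivity)]
    congr 1; field_simp
  have h2 : Real.log (m / t) ≤ m / t - 1 := Real.log_le_sub_one_of_pos (by positivity)
  have h3 : t * Real.log (m / t) ≤ m - t := by
    have := mul_le_mul_of_nonneg_left h2 ht.le
    rw [mul_sub, mul_one, mul_div_cancel₀ _ ht.ne'] at this
    exact this
  rw [h1]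
  nlinarith

/-- This is the growth function for edges: composed with the volume it has slope at least a given
constant whenever the number of crossing edges is at least that constant times `t log (A / t)`. -/
theorem hasDerivAt_neg_log_log {A t : ℝ} (ht : 0 < t) (hA : 0 < A) (h : 1 ≤ Real.log (A / t)) :
    HasDerivAt (fun t => -Real.log (Real.log (A / t))) (1 / (t * Real.log (A / t))) t := by
  have h1 : HasDerivAt (fun t => A / t) (-A / t ^ 2) t := by
    have := (hasDerivAt_const t A).fun_div (hasDerivAt_id' t) ht.ne'
    simpa using this
  have h2 := (h1.log (by positivity)).log (by linarith)
  have h3 : Real.log (A / t) ≠ 0 := by linarith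
  have h4 : -(-A / t ^ 2 / (A / t) / Real.log (A / t)) = 1 / (t * Real.log (A / t)) := by
    have hA' := hA.ne'
    have ht' := ht.ne'
    generalize Real.log (A / t) = L at h3
    field_simp
  rw [← h4]
  exact h2.fun_neg

open Set in
/-- Region growing with two families of intervals: some radius in `[0, 1/4)` is good for both. -/
theorem exists_radius {ι κ : Type*} (T : Finset ι) (a x : ι → ℝ) (Z : Finset κ) (e y : κ → ℝ)
    (ha : ∀ i ∈ T, 0 ≤ a i) (hx : ∀ i ∈ T, 0 ≤ x i) (hy : ∀ z ∈ Z, 0 ≤ y z) {σ τ α β : ℝ} (hσ : 0 < σ) (hτ : 0 < τ) (hα : 0 < α) (hβ : 0 < β)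
    (hsmall : 2 / α * Real.log (1 + Real.log ((∑ i ∈ T, x i + σ) / σ)) +
      1 / β * Real.log ((∑ z ∈ Z, y z + τ) / τ) < 1 / 4) :
    ∃ r : ℝ, 0 ≤ r ∧ r < 1 / 4 ∧
      (∀ m, m = ∑ i ∈ T, x i - max (∑ i ∈ T with a i + x i ≤ r, x i)
          (∑ i ∈ T with r < a i, x i) + σ →
        ((T.filter fun i => a i ≤ r ∧ r < a i + x i).card : ℝ) ≤
          α * (m * Real.log (Real.exp 1 * (∑ i ∈ T, x i + σ) / m))) ∧
      ((Z.filter fun z => e z ≤ r ∧ r < e z + y z).card : ℝ) ≤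
        β * (∑ z ∈ Z with e z ≤ r, y z + τ) := by
  by_contra hcon
  push Not at hcon
  set W := ∑ i ∈ T, x i with hW
  -- The factor `e` makes `log (A / t) ≥ 1` for all `t ≤ W + σ`. Hence the iterated logarithm is
  -- defined and `t log (A / t)` is monotone there.
  set A := Real.exp 1 * (W + σ) with hAdef
  have hW0 : 0 ≤ W := Finset.sum_nonneg hx
  have hA : 0 < A := by positivity
  have hlogA : ∀ t, 0 < t → t ≤ W + σ → 1 ≤ Real.log (A / t) := by
    intro t ht htW
    rw [Real.le_log_iff_exp_le (by positivity), le_div_iff₀ ht]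
    exact mul_le_mul_of_nonneg_left htW (Real.exp_pos 1).le
  set V : ℝ → ℝ := fun r => ∑ i ∈ T, max 0 (min (x i) (r - a i)) with hV
  set U : ℝ → ℝ := fun r => ∑ z ∈ Z, max 0 (min (y z) (r - e z)) with hU
  have hV0 : ∀ r, 0 ≤ V r := fun r => Finset.sum_nonneg fun i _ => le_max_left _ _
  have hU0 : ∀ r, 0 ≤ U r := fun r => Finset.sum_nonneg fun i _ => le_max_left _ _
  have hVW : ∀ r, V r ≤ W := fun r => Finset.sum_le_sum fun i hi =>
    max_le (hx i hi) (min_le_left _ _)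
  have hUY : ∀ r, U r ≤ ∑ z ∈ Z, y z := fun r => Finset.sum_le_sum fun i hi =>
    max_le (hy i hi) (min_le_left _ _)
  have hVz : V 0 = 0 := Finset.sum_eq_zero fun i hi => by
    rw [max_eq_left]; exact (min_le_right _ _).trans (by linarith [ha i hi])
  have hVc : Continuous V := continuous_finsetSum _ fun i _ => continuous_clip _ _
  have hUc : Continuous U := continuous_finsetSum _ fun i _ => continuous_clip _ _
  -- `V` is piecewise linear. Since the crossing intervals are closed on the left and open on the
  -- right, the crossing number is exactly the right derivative, even at breakpoints.
  have hVd : ∀ r, HasDerivWithinAt V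
      ((T.filter fun i => a i ≤ r ∧ r < a i + x i).card : ℝ) (Ici r) r := by
    intro r
    have := HasDerivWithinAt.fun_sum (u := T) (fun i hi => hasDerivWithinAt_clip (a i) (x i) r (hx i hi))
    simpa [hV] using this
  have hUd : ∀ r, HasDerivWithinAt U
      ((Z.filter fun i => e i ≤ r ∧ r < e i + y i).card : ℝ) (Ici r) r := by
    intro r
    have := HasDerivWithinAt.fun_sum (u := Z) (fun i hi => hasDerivWithinAt_clip (e i) (y i) r (hy i hi))
    simpa [hU] using this
  have hVin : ∀ r, ∑ i ∈ T with a i + x i ≤ r, x i ≤ V r := by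
    intro r
    rw [Finset.sum_filter]
    refine Finset.sum_le_sum fun i hi => ?_
    split_ifs with h
    · exact le_max_of_le_right (le_min le_rfl (by linarith))
    · exact le_max_left _ _
  have hVout : ∀ r, ∑ i ∈ T with r < a i, x i ≤ W - V r := by
    intro r
    rw [Finset.sum_filter, hW, hV, ← Finset.sum_sub_distrib]
    refine Finset.sum_le_sum fun i hi => ?_
    split_ifs with h
    · rw [max_eq_left]
      · linarith
      · exact (min_le_right _ _).trans (by linarith)
    · have := max_le (hx i hi) (min_le_left (x i) (r - a i)); linarith
  have hUle : ∀ r, U r ≤ ∑ z ∈ Z with e z ≤ r, y z := by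
    intro r
    rw [Finset.sum_filter]
    refine Finset.sum_le_sum fun z hz => ?_
    split_ifs with h
    · exact max_le (hy z hz) (min_le_left _ _)
    · rw [max_eq_left]; exact (min_le_right _ _).trans (by linarith)
  set g : ℝ → ℝ := fun t => -Real.log (Real.log (A / t)) with hg
  -- Both `V` and `W - V` enter because the edge bound refers to whichever side is smaller. The last
  -- term is the classical potential for the vertices.
  set Φ : ℝ → ℝ := fun r => 1 / α * (g (V r + σ) - g (W - V r + σ)) + 1 / β * Real.log (U r + τ)
    with hΦ
  set N : ℝ → ℝ := fun r => ((T.filter fun i => a i ≤ r ∧ r < a i + x i).card : ℝ) with hN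
  set N' : ℝ → ℝ := fun r => ((Z.filter fun i => e i ≤ r ∧ r < e i + y i).card : ℝ) with hN'
  have hb1 : ∀ r, 0 < V r + σ ∧ V r + σ ≤ W + σ := fun r =>
    ⟨by linarith [hV0 r], by linarith [hVW r]⟩
  have hb2 : ∀ r, 0 < W - V r + σ ∧ W - V r + σ ≤ W + σ := fun r =>
    ⟨by linarith [hVW r], by linarith [hV0 r]⟩
  have hΦd : ∀ r, HasDerivWithinAt Φ (1 / α * (1 / ((V r + σ) * Real.log (A / (V r + σ))) * N r -
      1 / ((W - V r + σ) * Real.log (A / (W - V r + σ))) * (-N r)) +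
      1 / β * (N' r / (U r + τ))) (Ici r) r := by
    intro r
    have d1 := (hasDerivAt_neg_log_log (hb1 r).1 hA (hlogA _ (hb1 r).1 (hb1 r).2)).comp_hasDerivWithinAt
      r ((hVd r).add_const σ)
    have d2 := (hasDerivAt_neg_log_log (hb2 r).1 hA (hlogA _ (hb2 r).1 (hb2 r).2)).comp_hasDerivWithinAt
      r (((hVd r).const_sub W).add_const σ)
    have d3 := ((hUd r).add_const τ).log (by linarith [hU0 r])
    exact ((d1.sub d2).const_mul (1 / α)).add (d3.const_mul (1 / β))
  have hΦc : Continuous Φ := by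
    have c1 : Continuous fun r => g (V r + σ) := by
      refine (Continuous.log (Continuous.log (continuous_const.div (hVc.add continuous_const) ?_) ?_) ?_).neg
      · intro r; exact (hb1 r).1.ne'
      · intro r; exact (div_pos hA (hb1 r).1).ne'
      · intro r; exact (zero_lt_one.trans_le (hlogA _ (hb1 r).1 (hb1 r).2)).ne'
    have c2 : Continuous fun r => g (W - V r + σ) := by
      refine (Continuous.log (Continuous.log (continuous_const.div
        ((continuous_const.sub hVc).add continuous_const) ?_) ?_) ?_).neg
      · intro r; exact (hb2 r).1.ne'
      · intro r; exact (div_pos hA (hb2 r).1).ne'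
      · intro r; exact (zero_lt_one.trans_le (hlogA _ (hb2 r).1 (hb2 r).2)).ne'
    have c3 : Continuous fun r => Real.log (U r + τ) :=
      Continuous.log (hUc.add continuous_const) (by intro r; linarith [hU0 r])
    exact (continuous_const.mul (c1.sub c2)).add (continuous_const.mul c3)
  have hslope : ∀ r ∈ Ico (0 : ℝ) (1 / 4), 1 ≤ 1 / α *
      (1 / ((V r + σ) * Real.log (A / (V r + σ))) * N r -
      1 / ((W - V r + σ) * Real.log (A / (W - V r + σ))) * (-N r)) +
      1 / β * (N' r / (U r + τ)) := by
    intro r hr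
    have p1 : 0 < (V r + σ) * Real.log (A / (V r + σ)) :=
      mul_pos (hb1 r).1 (by linarith [hlogA _ (hb1 r).1 (hb1 r).2])
    have p2 : 0 < (W - V r + σ) * Real.log (A / (W - V r + σ)) :=
      mul_pos (hb2 r).1 (by linarith [hlogA _ (hb2 r).1 (hb2 r).2])
    have hNn : 0 ≤ N r := Nat.cast_nonneg _
    have hNn' : 0 ≤ N' r := Nat.cast_nonneg _
    have q1 : 0 ≤ 1 / ((V r + σ) * Real.log (A / (V r + σ))) * N r := by positivity
    have q2 : 0 ≤ 1 / ((W - V r + σ) * Real.log (A / (W - V r + σ))) * N r := by positivity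
    have hUp : 0 < U r + τ := by linarith [hU0 r]
    have q3 : 0 ≤ 1 / β * (N' r / (U r + τ)) := by positivity
    -- A bad radius violates one of the two bounds. If the edge bound holds, the vertex term alone
    -- has slope at least one; otherwise one of the two edge terms does.
    by_cases hc : ∀ m, m = W - max (∑ i ∈ T with a i + x i ≤ r, x i)
          (∑ i ∈ T with r < a i, x i) + σ → N r ≤ α * (m * Real.log (A / m))
    · have h1 := hcon r hr.1 hr.2 hc
      have h2 : β * (U r + τ) ≤ N' r := by
        have := mul_le_mul_of_nonneg_left (add_le_add_left (hUle r) τ) hβ.le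
        exact this.trans h1.le
      have h3 : 1 ≤ 1 / β * (N' r / (U r + τ)) := by
        rw [one_div, inv_mul_eq_div, div_div, le_div_iff₀ (by positivity)]
        linarith
      have h4 : 0 ≤ 1 / α * (1 / ((V r + σ) * Real.log (A / (V r + σ))) * N r -
          1 / ((W - V r + σ) * Real.log (A / (W - V r + σ))) * (-N r)) := by
        have : 0 < 1 / α := by positivity
        apply mul_nonneg this.le; linarith
      linarith
    · push Not at hc
      obtain ⟨m, hm, hbad⟩ := hc
      have aux : ∀ t, 0 < t → t ≤ m → t ≤ W + σ → 1 ≤ 1 / α * (1 / (t * Real.log (A / t)) * N r) := by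
        intro t ht htm htW
        have hin : 0 ≤ ∑ i ∈ T with a i + x i ≤ r, x i :=
          Finset.sum_nonneg fun i hi => hx i (Finset.mem_of_mem_filter i hi)
        have hmW : m ≤ W + σ := by
          have := le_max_left (∑ i ∈ T with a i + x i ≤ r, x i) (∑ i ∈ T with r < a i, x i)
          linarith
        have h1 := mul_log_div_mono ht hA htm (hlogA m (ht.trans_le htm) hmW)
        have h2 : 0 < t * Real.log (A / t) := mul_pos ht (by linarith [hlogA t ht htW])
        rw [one_div, one_div, inv_mul_eq_div, inv_mul_eq_div, div_div, le_div_iff₀ (by positivity)]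
        nlinarith
      have h5 : 0 ≤ 1 / α := by positivity
      -- The interpolated volume `V` lies between the volume inside and `W` minus the volume
      -- outside. So `m` is at least `min V (W - V) + σ`, and monotonicity turns the failure at `m`
      -- into one at that smaller value.
      rcases le_total (V r) (W - V r) with h | h
      · have := aux (V r + σ) (hb1 r).1 (by
          rw [hm]
          have : max (∑ i ∈ T with a i + x i ≤ r, x i) (∑ i ∈ T with r < a i, x i) ≤ W - V r :=
            max_le ((hVin r).trans h) (hVout r)
          linarith) (hb1 r).2
        have := mul_nonneg h5 q2
        nlinarith
      · have := aux (W - V r + σ) (hb2 r).1 (by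
          rw [hm]
          have : max (∑ i ∈ T with a i + x i ≤ r, x i) (∑ i ∈ T with r < a i, x i) ≤ V r :=
            max_le (hVin r) ((hVout r).trans h)
          linarith) (hb2 r).2
        have := mul_nonneg h5 q1
        nlinarith
  have hmain : Φ 0 + 1 / 4 ≤ Φ (1 / 4) := by
    have := image_le_of_deriv_right_le_deriv_boundary (f := fun r => r + Φ 0) (f' := fun _ => 1)
      (a := 0) (b := 1 / 4) (B := Φ) (B' := fun r => 1 / α *
      (1 / ((V r + σ) * Real.log (A / (V r + σ))) * N r -
      1 / ((W - V r + σ) * Real.log (A / (W - V r + σ))) * (-N r)) +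
      1 / β * (N' r / (U r + τ))) (by fun_prop)
      (fun r _ => ((hasDerivWithinAt_id r _).add_const _)) (by simp) hΦc.continuousOn
      (fun r _ => hΦd r) hslope (right_mem_Icc.2 (by norm_num))
    linarith
  -- `g` runs from `g σ` up to `g (W + σ) = 0`. Both edge terms together thus contribute at most `-2
  -- g σ / α` to the increase of `Φ`, which is the first term of `hsmall`.
  have hlog1 : g (W + σ) = 0 := by
    have : A / (W + σ) = Real.exp 1 := by rw [hAdef]; field_simp
    simp [hg, this]
  have hgσ : g σ = -Real.log (1 + Real.log ((W + σ) / σ)) := by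
    have : A / σ = Real.exp 1 * ((W + σ) / σ) := by rw [hAdef]; ring
    simp only [hg]
    rw [this, Real.log_mul (Real.exp_pos 1).ne' (by positivity), Real.log_exp]
  have hgle : ∀ t, 0 < t → t ≤ W + σ → g t ≤ 0 := fun t ht htW => by
    have := Real.log_nonneg (hlogA t ht htW)
    simp only [hg]; linarith
  have hgge : ∀ t, σ ≤ t → t ≤ W + σ → g σ ≤ g t := fun t ht htW => by
    have h1 := hlogA t (hσ.trans_le ht) htW
    simp only [hg]
    apply neg_le_neg
    apply Real.log_le_log (by linarith)
    apply Real.log_le_log (div_pos hA (hσ.trans_le ht))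
    exact div_le_div_of_nonneg_left hA.le hσ ht
  have e1 : Φ (1 / 4) ≤ 1 / α * (0 - g σ) + 1 / β * Real.log (∑ z ∈ Z, y z + τ) := by
    simp only [hΦ]
    have h1 := hgle _ (hb1 (1 / 4)).1 (hb1 (1 / 4)).2
    have h2 := hgge (W - V (1 / 4) + σ) (by linarith [hVW (1 / 4)]) (hb2 (1 / 4)).2
    have h3 : Real.log (U (1 / 4) + τ) ≤ Real.log (∑ z ∈ Z, y z + τ) :=
      Real.log_le_log (by linarith [hU0 (1 / 4)]) (by linarith [hUY (1 / 4)])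
    have h4 : 0 ≤ 1 / α := by positivity
    have h5 : 0 ≤ 1 / β := by positivity
    exact add_le_add (mul_le_mul_of_nonneg_left (by linarith) h4)
      (mul_le_mul_of_nonneg_left h3 h5)
  have e2 : 1 / α * g σ + 1 / β * Real.log τ ≤ Φ 0 := by
    simp only [hΦ, hVz, zero_add, sub_zero, hlog1]
    have h3 : Real.log τ ≤ Real.log (U 0 + τ) := Real.log_le_log hτ (by linarith [hU0 0])
    have h5 : 0 ≤ 1 / β := by positivity
    linarith [mul_le_mul_of_nonneg_left h3 h5]
  have hY0 : 0 ≤ ∑ z ∈ Z, y z := Finset.sum_nonneg hy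
  rw [Real.log_div (by linarith) hτ.ne'] at hsmall
  rw [hgσ] at e1 e2
  have : 2 / α = 1 / α + 1 / α := by ring
  rw [this] at hsmall
  linarith

/-! ### The entropy potential of a piece -/

/-- The potential of a piece of volume `v`. -/
noncomputable def entropyPot (σ v : ℝ) : ℝ := v * Real.log ((v + σ) / σ)

theorem entropyPot_nonneg {σ v : ℝ} (hσ : 0 < σ) (hv : 0 ≤ v) : 0 ≤ entropyPot σ v := by
  refine mul_nonneg hv (Real.log_nonneg ?_)
  rw [le_div_iff₀ hσ]; linarith

theorem entropyPot_mono {σ v v' : ℝ} (hσ : 0 < σ) (hv : 0 ≤ v) (h : v ≤ v') :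
    entropyPot σ v ≤ entropyPot σ v' := by
  have h1 : Real.log ((v + σ) / σ) ≤ Real.log ((v' + σ) / σ) :=
    Real.log_le_log (by positivity) (by gcongr)
  have h2 : 0 ≤ Real.log ((v + σ) / σ) := by
    apply Real.log_nonneg
    rw [le_div_iff₀ hσ]; linarith
  exact mul_le_mul h h1 h2 (hv.trans h)

/-- Entropy estimate: all volume outside the larger part `a` had weight `log (W + σ)` and afterwards
has weight at most `log m`. This gains `(m - σ) log ((W + σ) / m)`, and `k` counts the factors `16`
between `m` and `W + σ`. The seed term absorbs the loss of `σ` and the very small pieces. -/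
theorem entropyPot_drop_of_le {W a b σ m : ℝ} (hσ : 0 < σ) (hb : 0 ≤ b) (hba : b ≤ a)
    (hab : a + b ≤ W) (hm : m = W - a + σ) {k : ℕ} (hk : 1 ≤ k) (hkm : 16 ^ (k - 1) * m ≤ W + σ) :
    k * m ≤ 4 * (entropyPot σ W - entropyPot σ a - entropyPot σ b) + 8 * σ * k := by
  have ha : 0 ≤ a := hb.trans hba
  have hW : 0 ≤ W := by linarith
  have hm0 : 0 < m := by linarith
  have hT : 0 < W + σ := by linarith
  have hmT : m ≤ W + σ := by linarith
  set D := entropyPot σ W - entropyPot σ a - entropyPot σ b with hD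
  have hDe : D = W * Real.log (W + σ) - a * Real.log (a + σ) - b * Real.log (b + σ) -
      (W - a - b) * Real.log σ := by
    simp only [hD, entropyPot]
    rw [Real.log_div hT.ne' hσ.ne', Real.log_div (by linarith) hσ.ne',
      Real.log_div (by linarith) hσ.ne']
    ring
  have l1 : Real.log (b + σ) ≤ Real.log m := Real.log_le_log (by linarith) (by linarith)
  have l2 : Real.log σ ≤ Real.log m := Real.log_le_log hσ (by linarith)
  have l3 : Real.log (a + σ) ≤ Real.log (W + σ) := Real.log_le_log (by linarith) (by linarith)
  have l4 : Real.log m ≤ Real.log (W + σ) := Real.log_le_log hm0 hmT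
  have B1 : (m - σ) * (Real.log (W + σ) - Real.log m) ≤ D := by
    rw [hDe, hm]
    rw [hm] at l1 l2
    nlinarith [mul_le_mul_of_nonneg_left l1 hb, mul_le_mul_of_nonneg_left l3 ha,
      mul_le_mul_of_nonneg_left l2 (by linarith : 0 ≤ W - a - b)]
  have l5 : Real.log (b + σ) ≤ Real.log (a + σ) := Real.log_le_log (by linarith) (by linarith)
  have l6 : Real.log σ ≤ Real.log (a + σ) := Real.log_le_log hσ (by linarith)
  have B2 : W * (Real.log (W + σ) - Real.log (a + σ)) ≤ D := by
    rw [hDe]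
    nlinarith [mul_le_mul_of_nonneg_left l5 hb,
      mul_le_mul_of_nonneg_left l6 (by linarith : 0 ≤ W - a - b)]
  have hD0 : 0 ≤ D := le_trans (mul_nonneg (by linarith) (by linarith)) B1
  have hk0 : (1 : ℝ) ≤ k := by exact_mod_cast hk
  -- If `m` is at most half of `W + σ`, then `log ((W + σ) / m)` is at least `log 2` and at least `4
  -- (k - 1) log 2`, so `k` is at most twice this logarithm and `B1` applies.
  rcases le_or_gt m ((W + σ) / 2) with h | h
  · have e1 : Real.log 2 ≤ Real.log (W + σ) - Real.log m := by
      rw [← Real.log_div hT.ne' hm0.ne']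
      apply Real.log_le_log (by norm_num)
      rw [le_div_iff₀ hm0]; linarith
    have e2 : ((k - 1 : ℕ) : ℝ) * (4 * Real.log 2) ≤ Real.log (W + σ) - Real.log m := by
      have h16 : Real.log 16 = 4 * Real.log 2 := by
        rw [show (16 : ℝ) = 2 ^ 4 by norm_num, Real.log_pow]; norm_num
      have := Real.log_le_log (by positivity) hkm
      rw [Real.log_mul (by positivity) hm0.ne', Real.log_pow, h16] at this
      linarith
    rw [Nat.cast_sub hk, Nat.cast_one] at e2
    have e3 := Real.log_two_gt_d9
    have e4 : (k : ℝ) ≤ 2 * (Real.log (W + σ) - Real.log m) := by nlinarith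
    have e5 : (k : ℝ) * (m - σ) ≤ 2 * D := by
      nlinarith [mul_le_mul_of_nonneg_right e4 (by linarith : 0 ≤ m - σ)]
    nlinarith
  -- If `m` exceeds half, only one scale fits. Either everything is at most `8 σ`, or the larger
  -- part has `a + σ ≤ 5/8 (W + σ)` and `B2` gives a constant fraction of `W`.
  · obtain rfl : k = 1 := by
      by_contra hne
      have : (16 : ℝ) ^ 1 ≤ 16 ^ (k - 1) := pow_le_pow_right₀ (by norm_num) (by omega)
      nlinarith
    rcases le_or_gt (W + σ) (8 * σ) with h' | h'
    · push_cast; linarith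
    · have e1 : 3 / 8 ≤ Real.log (W + σ) - Real.log (a + σ) := by
        have h1 := Real.log_le_sub_one_of_pos (x := (a + σ) / (W + σ)) (by positivity)
        rw [Real.log_div (by linarith) hT.ne'] at h1
        have h2 : (a + σ) / (W + σ) ≤ 5 / 8 := by
          rw [div_le_iff₀ hT]; linarith
        linarith
      have e2 : W * (3 / 8) ≤ D := (mul_le_mul_of_nonneg_left e1 hW).trans B2
      push_cast; linarith

/-- Splitting a piece of volume `W` into pieces of volumes `a` and `b` decreases the potential. -/
theorem entropyPot_drop {W a b σ m : ℝ} (hσ : 0 < σ) (ha : 0 ≤ a) (hb : 0 ≤ b)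
    (hab : a + b ≤ W) (hm : m = W - max a b + σ) {k : ℕ} (hk : 1 ≤ k)
    (hkm : 16 ^ (k - 1) * m ≤ W + σ) :
    k * m ≤ 4 * (entropyPot σ W - entropyPot σ a - entropyPot σ b) + 8 * σ * k := by
  rcases le_total b a with h | h
  · rw [max_eq_left h] at hm
    exact entropyPot_drop_of_le hσ hb h hab hm hk hkm
  · rw [max_eq_right h] at hm
    have := entropyPot_drop_of_le hσ ha h (by linarith) hm hk hkm
    linarith

/-! ### Tree decompositions built bag by bag -/

/-- A rooted tree of bags on the nodes `0, …, m - 1`, where `par t < t` is the parent of `t`,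
decomposing the relation `H` on the vertex set `R`. -/
structure BagTree {V : Type*} (H : V → V → Prop) (R : Finset V) (k m : ℕ) (par : ℕ → ℕ)
    (bag : ℕ → Finset V) : Prop where
  pos : 0 < m
  par_lt : ∀ t < m, 0 < t → par t < t
  subset : ∀ t < m, bag t ⊆ R
  covered : ∀ z ∈ R, ∃ t < m, z ∈ bag t
  edge : ∀ u ∈ R, ∀ v ∈ R, H u v → ∃ t < m, u ∈ bag t ∧ v ∈ bag t
  conn : ∀ t < m, 0 < t → ∀ z ∈ bag t, z ∈ bag (par t) ∨ ∀ t' < t, z ∉ bag t'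
  card_le : ∀ t < m, (bag t).card ≤ k

/-- Cutting further edges does not spoil the bags already built. -/
theorem BagTree.mono {V : Type*} {H H' : V → V → Prop} {R : Finset V} {k m : ℕ} {par : ℕ → ℕ}
    {bag : ℕ → Finset V} (h : BagTree H R k m par bag) (hH : ∀ u v, H' u v → H u v) :
    BagTree H' R k m par bag :=
  { h with edge := fun u hu v hv huv => h.edge u hu v hv (hH u v huv) }

/-- Adding a leaf with bag `B ∪ Z`, where `B` is contained in an existing bag and the vertices of
`Z` are new. -/
theorem BagTree.addLeaf {V : Type*} [DecidableEq V] {H : V → V → Prop} {R : Finset V} {k m : ℕ}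
    {par : ℕ → ℕ} {bag : ℕ → Finset V} (h : BagTree H R k m par bag) {t₀ : ℕ} (ht₀ : t₀ < m)
    {B Z : Finset V} (hB : B ⊆ bag t₀) (hZ : Disjoint Z R) (hk : (B ∪ Z).card ≤ k)
    (hsymm : ∀ u v, H u v → H v u) (hH : ∀ u ∈ Z, ∀ v ∈ R, H u v → v ∈ B) :
    BagTree H (R ∪ Z) k (m + 1) (Function.update par m t₀) (Function.update bag m (B ∪ Z)) := by
  have hbag : ∀ t < m, Function.update bag m (B ∪ Z) t = bag t := fun t ht =>
    Function.update_of_ne ht.ne _ _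
  have hpar : ∀ t < m, Function.update par m t₀ t = par t := fun t ht =>
    Function.update_of_ne ht.ne _ _
  have hBR : B ⊆ R := hB.trans (h.subset t₀ ht₀)
  have hnew : ∀ t < m, ∀ z ∈ Z, z ∉ bag t := fun t ht z hz hzb =>
    Finset.disjoint_left.1 hZ hz (h.subset t ht hzb)
  constructor
  · omega
  · intro t ht h0
    rcases Nat.lt_succ_iff_lt_or_eq.1 ht with ht | rfl
    · rw [hpar t ht]; exact h.par_lt t ht h0
    · simpa using ht₀
  · intro t ht
    rcases Nat.lt_succ_iff_lt_or_eq.1 ht with ht | rfl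
    · rw [hbag t ht]; exact (h.subset t ht).trans Finset.subset_union_left
    · rw [Function.update_self]; exact Finset.union_subset_union hBR subset_rfl
  · intro z hz
    rcases Finset.mem_union.1 hz with hz | hz
    · obtain ⟨t, ht, hzt⟩ := h.covered z hz
      exact ⟨t, by omega, by rwa [hbag t ht]⟩
    · exact ⟨m, by omega, by simp [hz]⟩
  · intro u hu v hv huv
    rcases Finset.mem_union.1 hu with hu | hu <;> rcases Finset.mem_union.1 hv with hv | hv
    · obtain ⟨t, ht, hut⟩ := h.edge u hu v hv huv
      exact ⟨t, by omega, by rwa [hbag t ht]⟩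
    · exact ⟨m, by omega, by simp [hv, hH v hv u hu (hsymm _ _ huv)]⟩
    · exact ⟨m, by omega, by simp [hu, hH u hu v hv huv]⟩
    · exact ⟨m, by omega, by simp [hu, hv]⟩
  · intro t ht h0 z hz
    rcases Nat.lt_succ_iff_lt_or_eq.1 ht with ht | rfl
    · rw [hbag t ht] at hz
      rw [hpar t ht, hbag _ ((h.par_lt t ht h0).trans ht)]
      refine (h.conn t ht h0 z hz).imp_right fun hn t' ht' => ?_
      rw [hbag t' (ht'.trans ht)]; exact hn t' ht'
    · rw [Function.update_self] at hz
      rw [Function.update_self, hbag _ ht₀]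
      rcases Finset.mem_union.1 hz with hz | hz
      · exact Or.inl (hB hz)
      · refine Or.inr fun t' ht' => ?_
        rw [hbag t' ht']; exact hnew t' ht' z hz
  · intro t ht
    rcases Nat.lt_succ_iff_lt_or_eq.1 ht with ht | rfl
    · rw [hbag t ht]; exact h.card_le t ht
    · rwa [Function.update_self]

/-- The graph joining every node `t > 0` to its parent. -/
def parentGraph (m : ℕ) (par : ℕ → ℕ) (hpar : ∀ t < m, 0 < t → par t < t) :
    SimpleGraph (Fin m) where
  Adj i j := (0 < (j : ℕ) ∧ par j = i) ∨ (0 < (i : ℕ) ∧ par i = j)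
  symm := ⟨fun _ _ h => h.symm⟩
  loopless := ⟨fun i h => by
    rcases h with h | h <;> exact absurd h.2 (hpar i i.2 h.1).ne⟩

/-- Following parents leads down to node `0`, so the graph is connected. Every edge is determined by
its child, so there are at most `m - 1` edges. -/
theorem parentGraph_isTree {m : ℕ} {par : ℕ → ℕ} (hm : 0 < m)
    (hpar : ∀ t < m, 0 < t → par t < t) : (parentGraph m par hpar).IsTree := by
  classical
  have hconn : (parentGraph m par hpar).Connected := by
    have key : ∀ t (ht : t < m), (parentGraph m par hpar).Reachable ⟨t, ht⟩ ⟨0, hm⟩ := by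
      intro t
      induction t using Nat.strong_induction_on with
      | _ t ih =>
        intro ht
        rcases Nat.eq_zero_or_pos t with rfl | h0
        · exact SimpleGraph.Reachable.refl _
        · have hp := hpar t ht h0
          have hadj : (parentGraph m par hpar).Adj ⟨t, ht⟩ ⟨par t, hp.trans ht⟩ :=
            Or.inr ⟨h0, rfl⟩
          exact hadj.reachable.trans (ih _ hp _)
    exact (SimpleGraph.connected_iff _).2
      ⟨fun i j => (key i i.2).trans (key j j.2).symm, ⟨⟨0, hm⟩⟩⟩
  refine SimpleGraph.isTree_iff_connected_and_card.2 ⟨hconn, ?_⟩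
  refine le_antisymm ?_ hconn.card_vert_le_card_edgeSet_add_one
  -- The value `0` in the conditional is a dummy for the root, which is erased from the index set.
  have hsub : (parentGraph m par hpar).edgeFinset ⊆
      ((Finset.univ : Finset (Fin m)).erase ⟨0, hm⟩).image fun j : Fin m =>
        s((⟨if 0 < (j : ℕ) then par j else 0, by
          split_ifs with h
          · exact (hpar j j.2 h).trans j.2
          · exact hm⟩ : Fin m), j) := by
    intro e he
    rw [SimpleGraph.mem_edgeFinset] at he
    induction e with
    | _ i j =>
      rw [SimpleGraph.mem_edgeSet] at he
      rw [Finset.mem_image]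
      rcases he with he | he
      · refine ⟨j, by simp [Fin.ext_iff]; omega, ?_⟩
        rw [Sym2.eq_iff]; left; simp [he]
      · refine ⟨i, by simp [Fin.ext_iff]; omega, ?_⟩
        rw [Sym2.eq_iff]; right; simp [he]
  have h1 := (Finset.card_le_card hsub).trans Finset.card_image_le
  rw [Finset.card_erase_of_mem (Finset.mem_univ _), Finset.card_univ, Fintype.card_fin] at h1
  rw [Nat.card_eq_fintype_card, ← SimpleGraph.edgeFinset_card, Nat.card_eq_fintype_card,
    Fintype.card_fin]
  omega

/-- The nodes containing `v` are connected because each of them other than the first one has a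
parent that also contains `v`; so following parents stays among them and ends at the first. The `-1`
in the width is given away. -/
theorem treewidth_le_of_bagTree {V : Type*} [Fintype V] {G : SimpleGraph V} {k m : ℕ}
    {par : ℕ → ℕ} {bag : ℕ → Finset V} (h : BagTree G.Adj Finset.univ k m par bag) :
    treewidth G ≤ k := by
  classical
  have hdec : IsTreeDecomposition G (parentGraph m par h.par_lt) (fun t : Fin m => bag t) := by
    refine ⟨parentGraph_isTree h.pos _, fun u v huv => ?_, fun v => ?_⟩
    · obtain ⟨t, ht, htt⟩ := h.edge u (Finset.mem_univ _) v (Finset.mem_univ _) huv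
      exact ⟨⟨t, ht⟩, htt⟩
    · obtain ⟨h1, h2⟩ := Nat.find_spec (h.covered v (Finset.mem_univ _))
      have hmin := fun t' (ht' : t' < Nat.find (h.covered v (Finset.mem_univ _))) =>
        Nat.find_min (h.covered v (Finset.mem_univ _)) ht'
      set t₀ := Nat.find (h.covered v (Finset.mem_univ _))
      have key : ∀ t (ht : t < m) (hv : v ∈ bag t),
          ((parentGraph m par h.par_lt).induce {t : Fin m | v ∈ bag t}).Reachable
            ⟨⟨t, ht⟩, hv⟩ ⟨⟨t₀, h1⟩, h2⟩ := by
        intro t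
        induction t using Nat.strong_induction_on with
        | _ t ih =>
          intro ht hv
          rcases lt_trichotomy t t₀ with hlt | rfl | hlt
          · exact absurd ⟨ht, hv⟩ (hmin t hlt)
          · exact SimpleGraph.Reachable.refl _
          · have hp := h.par_lt t ht (by omega)
            have hvp : v ∈ bag (par t) := by
              rcases h.conn t ht (by omega) v hv with hc | hc
              · exact hc
              · exact absurd h2 (hc t₀ hlt)
            have hadj : ((parentGraph m par h.par_lt).induce {t : Fin m | v ∈ bag t}).Adj
                ⟨⟨t, ht⟩, hv⟩ ⟨⟨par t, hp.trans ht⟩, hvp⟩ := Or.inr ⟨by simp; omega, rfl⟩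
            exact hadj.reachable.trans (ih _ hp _ _)
      exact (SimpleGraph.connected_iff _).2 ⟨fun i j => (key i.1.1 i.1.2 i.2).trans (key j.1.1 j.1.2 j.2).symm,
        ⟨⟨⟨t₀, h1⟩, h2⟩⟩⟩
  have hmem : decompositionWidth (fun t : Fin m => bag t) ∈
      {k | ∃ (m : ℕ) (T : SimpleGraph (Fin m)) (bag : Fin m → Finset V),
        IsTreeDecomposition G T bag ∧ decompositionWidth bag = k} := ⟨m, _, _, hdec, rfl⟩
  refine (Nat.sInf_le hmem).trans ?_
  refine (Nat.sub_le _ _).trans (Finset.sup_le fun t _ => h.card_le t t.2)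

/-! ### Shortest paths -/

theorem List.Sublist.sum_map_le_of_nonneg {α : Type*} {f : α → ℝ} {l l' : List α}
    (h : l.Sublist l') (hf : ∀ a ∈ l', 0 ≤ f a) : (l.map f).sum ≤ (l'.map f).sum := by
  induction h with
  | slnil => simp
  | cons a _ ih =>
    simp only [List.map_cons, List.sum_cons]
    have := ih fun b hb => hf b (List.mem_cons_of_mem _ hb)
    linarith [hf a List.mem_cons_self]
  | cons_cons a _ ih =>
    simp only [List.map_cons, List.sum_cons]
    have := ih fun b hb => hf b (List.mem_cons_of_mem _ hb)
    linarith

theorem List.le_sum_map_of_mem {α : Type*} {f : α → ℝ} {l : List α} {a : α} (ha : a ∈ l)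
    (hf : ∀ a ∈ l, 0 ≤ f a) : f a ≤ (l.map f).sum := by
  have := (List.singleton_sublist.2 ha).sum_map_le_of_nonneg hf
  simpa using this

namespace OracleRAM

variable {n : ℕ} {G : SimpleGraph (Fin n)} {s : LPSolution n} {w : ℕ}

theorem answerX_nonneg (hs : s.Feasible G w) (p q : ℕ) : 0 ≤ answerX G s p q := by
  unfold answerX
  split_ifs with h h'
  · exact hs.x_nonneg _ h'
  · exact le_rfl
  · exact le_rfl

theorem answerX_symm (p q : ℕ) : answerX G s p q = answerX G s q p := by
  unfold answerX
  by_cases h : p < n ∧ q < n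
  · rw [dif_pos h, dif_pos h.symm]
    by_cases h' : G.Adj ⟨p, h.1⟩ ⟨q, h.2⟩
    · rw [if_pos h', if_pos h'.symm, Sym2.eq_swap]
    · rw [if_neg h', if_neg fun h'' => h' h''.symm]
  · rw [dif_neg h, dif_neg fun h' => h h'.symm]

theorem answerX_of_adj {p q : Fin n} (h : G.Adj p q) : answerX G s p q = s.x s(p, q) := by
  unfold answerX
  rw [dif_pos ⟨p.2, q.2⟩]
  exact if_pos h

theorem answerX_self (p : ℕ) : answerX G s p p = 0 := by
  unfold answerX
  split_ifs with h h'
  · exact absurd h' (G.loopless.irrefl _)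
  · rfl
  · rfl

theorem answerY_nonneg (hs : s.Feasible G w) (S : Finset (Fin n)) (p : ℕ) :
    0 ≤ answerY s S p := by
  unfold answerY
  split_ifs
  · exact hs.y_nonneg _ _
  · exact le_rfl

@[simp] theorem answerY_fin (S : Finset (Fin n)) (p : Fin n) : answerY s S p = s.y S p := by
  simp [answerY]

/-! ### Correctness of repeated relaxation, with an invariant in the style of Dijkstra. -/

/-- Adjacency of natural numbers viewed as vertices. -/
def AdjN (G : SimpleGraph (Fin n)) (p q : ℕ) : Prop :=
  ∃ u v : Fin n, (u : ℕ) = p ∧ (v : ℕ) = q ∧ G.Adj u v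

theorem adjN_fin {p q : Fin n} : AdjN G p q ↔ G.Adj p q :=
  ⟨fun ⟨u, v, hu, hv, h⟩ => by rwa [← Fin.ext hu, ← Fin.ext hv], fun h => ⟨p, q, rfl, rfl, h⟩⟩

theorem AdjN.lt {p q : ℕ} (h : AdjN G p q) : p < n ∧ q < n := by
  obtain ⟨u, v, rfl, rfl, -⟩ := h
  exact ⟨u.2, v.2⟩

/-- The length of passing through `p` and on to `q`. -/
noncomputable def stepLen (G : SimpleGraph (Fin n)) (s : LPSolution n) (S : Finset (Fin n))
    (p q : ℕ) : ℝ :=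
  answerY s S p + answerX G s p q

open Classical in
/-- Relaxation of the pair `(p, q)`. -/
noncomputable def relax (A : ℕ → ℕ → Prop) (c : ℕ → ℕ → ℝ) (p q : ℕ) (e : ℕ → ℝ) : ℕ → ℝ :=
  if A p q ∧ e p + c p q ≤ e q then Function.update e q (e p + c p q) else e

theorem relax_le (A : ℕ → ℕ → Prop) (c : ℕ → ℕ → ℝ) (p q : ℕ) (e : ℕ → ℝ) (z : ℕ) :
    relax A c p q e z ≤ e z := by
  unfold relax
  split_ifs with h
  · by_cases hz : z = q
    · subst hz; simpa using h.2
    · rw [Function.update_of_ne hz]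
  · exact le_rfl

/-- All pairs starting in `T` are relaxed, and `T` consists of the smallest values. -/
def Settled (n : ℕ) (A : ℕ → ℕ → Prop) (c : ℕ → ℕ → ℝ) (T : Finset ℕ) (e : ℕ → ℝ) : Prop :=
  ∀ a ∈ T, (∀ q, A a q → e q ≤ e a + c a q) ∧ ∀ b < n, b ∉ T → e a ≤ e b

/-- State within a round of relaxations, where all pairs before `(p, q)` have been treated. -/
def RoundInv (n : ℕ) (A : ℕ → ℕ → Prop) (c : ℕ → ℕ → ℝ) (it p q : ℕ) (e : ℕ → ℝ) : Prop :=
  ∃ T ⊆ Finset.range n, it ≤ T.card ∧ Settled n A c T e ∧ (it < T.card ∨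
    ∃ a < n, a ∉ T ∧ (∀ b < n, b ∉ T → e a ≤ e b) ∧
      ∀ q', (a < p ∨ a = p ∧ q' < q) → A a q' → e q' ≤ e a + c a q')

/-- No relaxation lowers a settled value. If `p` is settled, its pairs are already relaxed;
otherwise `e p` is at least every settled value and lengths are nonnegative. For the same reasons no
value outside `T` falls below a settled one. -/
theorem relax_settled {A : ℕ → ℕ → Prop} {c : ℕ → ℕ → ℝ} (hc : ∀ p q, 0 ≤ c p q)
    (hA : ∀ p q, A p q → p < n ∧ q < n) {T : Finset ℕ}
    {e : ℕ → ℝ} (h : Settled n A c T e) (p q : ℕ) :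
    Settled n A c T (relax A c p q e) ∧ ∀ a ∈ T, relax A c p q e a = e a := by
  by_cases hr : A p q ∧ e p + c p q ≤ e q
  · have heq : ∀ a ∈ T, relax A c p q e a = e a := by
      intro a ha
      refine le_antisymm (relax_le _ _ _ _ _ _) ?_
      unfold relax
      rw [if_pos hr]
      by_cases haq : a = q
      · subst haq
        rw [Function.update_self]
        by_cases hp : p ∈ T
        · exact (h p hp).1 _ hr.1
        · have := (h a ha).2 p (hA _ _ hr.1).1 hp
          linarith [hc p a]
      · rw [Function.update_of_ne haq]
    refine ⟨fun a ha => ⟨fun z hz => ?_, fun b hb hbT => ?_⟩, heq⟩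
    · rw [heq a ha]
      exact (relax_le _ _ _ _ _ _).trans ((h a ha).1 z hz)
    · rw [heq a ha]
      unfold relax
      rw [if_pos hr]
      by_cases hbq : b = q
      · subst hbq
        rw [Function.update_self]
        by_cases hp : p ∈ T
        · have h1 := (h p hp).1 _ hr.1
          have h2 := (h a ha).2 b hb hbT
          linarith
        · linarith [(h a ha).2 p (hA _ _ hr.1).1 hp, hc p b]
      · rw [Function.update_of_ne hbq]; exact (h a ha).2 b hb hbT
  · have : relax A c p q e = e := if_neg hr
    rw [this]; exact ⟨h, fun _ _ => rfl⟩

/-- The candidate `a`, a minimum outside `T`, keeps its value and stays minimal. Hence pairs leaving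
`a` remain relaxed once treated in this round. -/
theorem RoundInv.relax {A : ℕ → ℕ → Prop} {c : ℕ → ℕ → ℝ} (hc : ∀ p q, 0 ≤ c p q)
    (hA : ∀ p q, A p q → p < n ∧ q < n) {it p q : ℕ} {e : ℕ → ℝ} (h : RoundInv n A c it p q e) :
    RoundInv n A c it p (q + 1) (relax A c p q e) := by
  obtain ⟨T, hT, hcard, hset, h⟩ := h
  obtain ⟨hset', heq⟩ := relax_settled hc hA hset p q
  refine ⟨T, hT, hcard, hset', h.imp_right ?_⟩
  rintro ⟨a, han, haT, hmin, hrel⟩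
  have hea : OracleRAM.relax A c p q e a = e a := by
    refine le_antisymm (relax_le _ _ _ _ _ _) ?_
    unfold OracleRAM.relax
    split_ifs with hr
    · by_cases haq : a = q
      · subst haq
        rw [Function.update_self]
        by_cases hp : p ∈ T
        · exact (hset p hp).1 _ hr.1
        · linarith [hmin p (hA _ _ hr.1).1 hp, hc p a]
      · rw [Function.update_of_ne haq]
    · exact le_rfl
  refine ⟨a, han, haT, fun b hb hbT => ?_, fun q' hq' hAq => ?_⟩
  · rw [hea]
    unfold OracleRAM.relax
    split_ifs with hr
    · by_cases hbq : b = q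
      · subst hbq
        rw [Function.update_self]
        by_cases hp : p ∈ T
        · have h1 := (hset p hp).1 _ hr.1
          linarith [hmin b hb hbT]
        · linarith [hmin p (hA _ _ hr.1).1 hp, hc p b]
      · rw [Function.update_of_ne hbq]; exact hmin b hb hbT
    · exact hmin b hb hbT
  · rw [hea]
    by_cases hlast : a = p ∧ q' = q
    · obtain ⟨rfl, rfl⟩ := hlast
      unfold OracleRAM.relax
      split_ifs with hr
      · rw [Function.update_self]
      · exact (not_le.1 fun hle => hr ⟨hAq, hle⟩).le
    · exact (relax_le _ _ _ _ _ _).trans (hrel q' (by omega) hAq)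

theorem RoundInv.start {A : ℕ → ℕ → Prop} {c : ℕ → ℕ → ℝ} {it : ℕ} {e : ℕ → ℝ} {T : Finset ℕ}
    (hit : it < n) (hT : T ⊆ Finset.range n) (hcard : it ≤ T.card) (h : Settled n A c T e) :
    RoundInv n A c it 0 0 e := by
  refine ⟨T, hT, hcard, h, or_iff_not_imp_left.2 fun hlt => ?_⟩
  have hne : (Finset.range n \ T).Nonempty := by
    rw [← Finset.card_pos, Finset.card_sdiff_of_subset hT, Finset.card_range]; omega
  obtain ⟨a, ha, hmin⟩ := Finset.exists_min_image _ e hne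
  simp only [Finset.mem_sdiff, Finset.mem_range] at ha hmin
  exact ⟨a, ha.1, ha.2, fun b hb hbT => hmin b ⟨hb, hbT⟩, fun q' hq' => by omega⟩

theorem RoundInv.nextRow {A : ℕ → ℕ → Prop} {c : ℕ → ℕ → ℝ} {it p : ℕ} {e : ℕ → ℝ}
    (hA : ∀ p q, A p q → p < n ∧ q < n) (h : RoundInv n A c it p n e) :
    RoundInv n A c it (p + 1) 0 e := by
  obtain ⟨T, hT, hcard, hset, h⟩ := h
  refine ⟨T, hT, hcard, hset, h.imp_right ?_⟩
  rintro ⟨a, han, haT, hmin, hrel⟩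
  exact ⟨a, han, haT, hmin, fun q' hq' hAq => hrel q' (by have := hA _ _ hAq; omega) hAq⟩

/-- After a full round all pairs leaving the minimal unsettled `a` are relaxed, so `a` can be
settled. Each round therefore settles a further vertex, and `n` rounds suffice. -/
theorem RoundInv.finish {A : ℕ → ℕ → Prop} {c : ℕ → ℕ → ℝ} {it : ℕ} {e : ℕ → ℝ}
    (h : RoundInv n A c it n 0 e) :
    ∃ T ⊆ Finset.range n, it + 1 ≤ T.card ∧ Settled n A c T e := by
  obtain ⟨T, hT, hcard, hset, h⟩ := h
  rcases h with h | ⟨a, han, haT, hmin, hrel⟩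
  · exact ⟨T, hT, h, hset⟩
  · refine ⟨insert a T, ?_, ?_, fun b hb => ?_⟩
    · exact Finset.insert_subset (Finset.mem_range.2 han) hT
    · rw [Finset.card_insert_of_notMem haT]; omega
    · rcases Finset.mem_insert.1 hb with rfl | hb
      · exact ⟨fun q hq => hrel q (Or.inl han) hq,
          fun z hz hzT => hmin z hz fun h => hzT (Finset.mem_insert_of_mem h)⟩
      · exact ⟨(hset b hb).1,
          fun z hz hzT => (hset b hb).2 z hz fun h => hzT (Finset.mem_insert_of_mem h)⟩

/-- The tentative distances are nonnegative, and those below `1` are lengths of walks. -/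
def WalkInv (G : SimpleGraph (Fin n)) (s : LPSolution n) (S : Finset (Fin n)) (u : Fin n)
    (e : ℕ → ℝ) : Prop :=
  (∀ z < n, 0 ≤ e z) ∧ e u ≤ 0 ∧ ∀ z : Fin n, e z < 1 → ∃ P : G.Walk u z,
    (P.edges.map s.x).sum + (P.support.map (s.y S)).sum ≤ e z + s.y S z

/-- A new value below `1` arises from a smaller value, hence from a walk, which is extended by one
edge. Entry distances omit the length of the last vertex, whence the term `s.y S z` on the right. -/
theorem WalkInv.relax (hs : s.Feasible G w) {S : Finset (Fin n)} {u : Fin n} {e : ℕ → ℝ}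
    (h : WalkInv G s S u e) (p q : ℕ) :
    WalkInv G s S u (relax (AdjN G) (stepLen G s S) p q e) := by
  obtain ⟨h0, hu, hw⟩ := h
  refine ⟨fun z hz => ?_, (relax_le _ _ _ _ _ _).trans hu, fun z hz => ?_⟩
  · unfold OracleRAM.relax
    split_ifs with hr
    · by_cases hzq : z = q
      · subst hzq
        rw [Function.update_self]
        exact add_nonneg (h0 _ hr.1.lt.1) (add_nonneg (answerY_nonneg hs _ _)
          (answerX_nonneg hs _ _))
      · rw [Function.update_of_ne hzq]; exact h0 z hz
    · exact h0 z hz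
  · unfold OracleRAM.relax at hz ⊢
    split_ifs at hz ⊢ with hr
    · by_cases hzq : (z : ℕ) = q
      · subst hzq
        rw [Function.update_self] at hz ⊢
        obtain ⟨⟨p', v, rfl, hv, hadj⟩, -⟩ := hr
        obtain rfl : v = z := Fin.ext hv
        have hlt : e p' < 1 := by
          have h1 := answerY_nonneg hs S p'
          have h2 := answerX_nonneg hs p' v
          unfold stepLen at hz
          linarith
        obtain ⟨P, hP⟩ := hw p' hlt
        refine ⟨P.concat hadj, ?_⟩
        simp only [stepLen, answerY_fin, answerX_of_adj hadj, SimpleGraph.Walk.edges_concat,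
          SimpleGraph.Walk.support_concat, List.concat_eq_append, List.map_append, List.sum_append,
          List.map_cons, List.map_nil, List.sum_cons, List.sum_nil]
        linarith
      · rw [Function.update_of_ne hzq] at hz ⊢
        exact hw z hz
    · exact hw z hz

/-- `e` is a valid family of (truncated) distances from `u` to the entries of the vertices. -/
structure EntryDist (G : SimpleGraph (Fin n)) (s : LPSolution n) (S : Finset (Fin n)) (u : Fin n)
    (e : Fin n → ℝ) : Prop where
  nonneg : ∀ z, 0 ≤ e z
  self : e u = 0
  step : ∀ p q, G.Adj p q → e q ≤ e p + s.y S p + answerX G s p q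
  dist : ∀ z, e z < 1 → s.d S u z ≤ e z + s.y S z ∧ s.y S u ≤ e z + s.y S z

/-- Settledness of all vertices gives the triangle inequality along edges. Only values below `1`
need to represent walks, because radii stay below `1/4`. -/
theorem entryDist_of_settled (hs : s.Feasible G w) {S : Finset (Fin n)} {u : Fin n} {e : ℕ → ℝ}
    (h : WalkInv G s S u e) {T : Finset ℕ} (hT : T ⊆ Finset.range n) (hcard : n ≤ T.card)
    (hset : Settled n (AdjN G) (stepLen G s S) T e) : EntryDist G s S u (fun z => e z) := by
  obtain ⟨h0, hu, hw⟩ := h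
  obtain rfl : T = Finset.range n := Finset.eq_of_subset_of_card_le hT (by simpa using hcard)
  refine ⟨fun z => h0 z z.2, le_antisymm hu (h0 u u.2), fun p q hpq => ?_, fun z hz => ?_⟩
  · have := (hset p (Finset.mem_range.2 p.2)).1 q (adjN_fin.2 hpq)
    simpa [stepLen, ← add_assoc] using this
  · obtain ⟨P, hP⟩ := hw z hz
    have hx : ∀ e ∈ P.edges, 0 ≤ s.x e := fun e he => hs.x_nonneg e (P.edges_subset_edgeSet he)
    have hx0 : 0 ≤ (P.edges.map s.x).sum := List.sum_nonneg fun r hr => by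
      obtain ⟨e, he, rfl⟩ := List.mem_map.1 hr; exact hx e he
    constructor
    -- The LP bounds only paths. Shortcutting the walk to a path does not increase its length, as
    -- all lengths are nonnegative.
    · refine (hs.path_bound S u z P.bypass P.bypass_isPath).trans (le_trans ?_ hP)
      exact add_le_add (P.edges_bypass_sublist_edges.sum_map_le_of_nonneg hx)
        (P.support_bypass_sublist_support.sum_map_le_of_nonneg fun v _ => hs.y_nonneg S v)
    · refine le_trans ?_ hP
      have := List.le_sum_map_of_mem (f := s.y S) P.start_mem_support fun v _ => hs.y_nonneg S v
      linarith

/-- Spreading: small balls contain at most two thirds of the set. -/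
theorem EntryDist.card_ball_le (hs : s.Feasible G w) {S I : Finset (Fin n)} {u : Fin n}
    {e : Fin n → ℝ} (h : EntryDist G s S u e) (hu : u ∈ S) (hI : I ⊆ S) {r : ℝ} (hr : r < 1 / 4)
    (hIr : ∀ z ∈ I, e z + s.y S z ≤ r) : 3 * I.card ≤ 2 * S.card := by
  classical
  rcases I.eq_empty_or_nonempty with rfl | ⟨z₀, hz₀⟩
  · simp
  have hlt : ∀ z ∈ I, e z < 1 := fun z hz => by
    linarith [hIr z hz, hs.y_nonneg S z]
  have hyu : s.y S u ≤ r := ((h.dist z₀ (hlt z₀ hz₀)).2).trans (hIr z₀ hz₀)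
  -- The spreading constraint requires the centre to belong to `U`, so `u` is added. This is
  -- harmless: `d u u ≤ y u`, and `y u` is at most the exit distance of any vertex of the ball.
  have hd : ∀ z ∈ insert u I, s.d S u z ≤ 1 / 4 := by
    intro z hz
    rcases Finset.mem_insert.1 hz with rfl | hz
    · have := (h.dist z (by rw [h.self]; norm_num)).1
      rw [h.self] at this; linarith
    · linarith [(h.dist z (hlt z hz)).1, hIr z hz]
  have h1 := hs.spreading S (insert u I) (Finset.insert_subset hu hI) u (Finset.mem_insert_self _ _)
  have h2 := Finset.sum_le_card_nsmul _ _ _ hd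
  rw [nsmul_eq_mul] at h2
  have h3 : (I.card : ℝ) ≤ (insert u I).card := by
    exact_mod_cast Finset.card_le_card (Finset.subset_insert _ _)
  have h4 : (3 : ℝ) * I.card ≤ 2 * S.card := by linarith
  exact_mod_cast h4

end OracleRAM

/-! ### Cutting out a ball -/

/-- Data for cutting out a ball: the pairs of vertices that may be cut, their lengths, the entry
distances and lengths of vertices, the vertices that may be removed, and parameters. -/
structure BallData (n : ℕ) where
  T : Finset (Fin n × Fin n)
  x : Fin n → Fin n → ℝ
  e : Fin n → ℝ
  y : Fin n → ℝ
  A : Finset (Fin n)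
  D : ℕ
  b : ℕ
  l : ℕ
  σ : ℝ

namespace BallData

variable {n : ℕ} (β : BallData n)

/-- The pair lies inside the ball of radius `r`. -/
def Inside (r : ℝ) (pq : Fin n × Fin n) : Prop :=
  β.e pq.1 + β.y pq.1 + β.x pq.1 pq.2 ≤ r ∨ β.e pq.2 + β.y pq.2 + β.x pq.1 pq.2 ≤ r

/-- The pair lies outside the ball of radius `r`. -/
def Outside (r : ℝ) (pq : Fin n × Fin n) : Prop :=
  r < β.e pq.1 + β.y pq.1 ∧ r < β.e pq.2 + β.y pq.2

/-- Total volume. -/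
noncomputable def W : ℝ := ∑ pq ∈ β.T, β.D * β.x pq.1 pq.2

open Classical in
/-- Volume inside the ball. -/
noncomputable def volIn (r : ℝ) : ℝ := ∑ pq ∈ β.T with β.Inside r pq, β.D * β.x pq.1 pq.2

open Classical in
/-- Volume outside the ball. -/
noncomputable def volOut (r : ℝ) : ℝ := ∑ pq ∈ β.T with β.Outside r pq, β.D * β.x pq.1 pq.2

open Classical in
/-- The pairs that are cut. -/
noncomputable def cutPairs (r : ℝ) : Finset (Fin n × Fin n) :=
  β.T.filter fun pq => ¬ β.Outside r pq ∧ ¬ β.Inside r pq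

/-- The vertices that are cut. -/
noncomputable def cutVerts (r : ℝ) : Finset (Fin n) :=
  β.A.filter fun z => β.e z ≤ r ∧ r < β.e z + β.y z

/-- The vertex volume of the ball. -/
noncomputable def vertVol (r : ℝ) : ℝ := ∑ z ∈ β.A with β.e z ≤ r, β.y z

/-- The volume of the smaller side, including the pairs that are cut. -/
noncomputable def small (r : ℝ) : ℝ := β.W - max (β.volIn r) (β.volOut r) + β.σ

/-- The number of scales between the smaller side and the whole. -/
noncomputable def scales (r : ℝ) : ℕ := sInf {k : ℕ | β.W + β.σ < 16 ^ k * β.small r}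

/-- The radius is good: few pairs and few vertices are cut. -/
def Good (r : ℝ) : Prop :=
  (β.D * (β.cutPairs r).card : ℝ) ≤ 256 * (β.scales r * (β.l * β.small r)) ∧
    (9 * (β.cutVerts r).card : ℝ) ≤ 1024 * (β.b * β.vertVol r) + 1

/-- The radii at which the combinatorial structure of the ball may change. -/
def Critical (r : ℝ) : Prop :=
  (∃ p, r = β.e p) ∨ ∃ p q, r = β.e p + β.y p + β.x p q

variable {β}

/-- Everything in `Good` is defined through comparisons of `r` with entry distances, exit distances
and exit distances plus lengths. Exit distances are critical because `x p p = 0`. -/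
theorem good_congr {r r' : ℝ} (h : ∀ t, β.Critical t → (t ≤ r ↔ t ≤ r'))
    (hx : ∀ p, β.x p p = 0)
    (hxe : ∀ pq : Fin n × Fin n, β.Critical (β.e pq.2 + β.y pq.2 + β.x pq.1 pq.2)) : β.Good r ↔ β.Good r' := by
  have h1 : ∀ p q, (β.e p + β.y p + β.x p q ≤ r ↔ β.e p + β.y p + β.x p q ≤ r') := fun p q =>
    h _ (Or.inr ⟨p, q, rfl⟩)
  have h2 : ∀ p, (β.e p + β.y p ≤ r ↔ β.e p + β.y p ≤ r') := fun p => by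
    have := h1 p p; rwa [hx, add_zero] at this
  have h3 : ∀ p, (β.e p ≤ r ↔ β.e p ≤ r') := fun p => h _ (Or.inl ⟨p, rfl⟩)
  have hin : β.Inside r = β.Inside r' := by
    funext pq
    refine propext (or_congr (h1 _ _) ?_)
    exact h _ (hxe pq)
  have hout : β.Outside r = β.Outside r' := by
    funext pq
    refine propext (and_congr ?_ ?_) <;> rw [← not_le, ← not_le, h2]
  have hcv : β.cutVerts r = β.cutVerts r' := by
    refine Finset.filter_congr fun z _ => ?_
    rw [h3, ← not_le, ← not_le, h2]
  have hvv : β.vertVol r = β.vertVol r' := by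
    unfold vertVol
    refine Finset.sum_congr (Finset.filter_congr fun z _ => h3 z) fun _ _ => rfl
  unfold Good scales small volIn volOut cutPairs
  rw [hin, hout, hcv, hvv]

/-- A radius can be rounded down to the largest critical value below it; the centre provides the
critical value `0`. This reduces the search to finitely many radii. -/
theorem exists_critical_le (hu : ∃ u, β.e u = 0) {r : ℝ} (hr : 0 ≤ r) :
    ∃ r', β.Critical r' ∧ 0 ≤ r' ∧ r' ≤ r ∧ ∀ t, β.Critical t → (t ≤ r' ↔ t ≤ r) := by
  classical
  obtain ⟨u, hu⟩ := hu
  set C : Finset ℝ := (Finset.univ.image β.e ∪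
    Finset.univ.image fun pq : Fin n × Fin n => β.e pq.1 + β.y pq.1 + β.x pq.1 pq.2) with hC
  have hmem : ∀ t, t ∈ C ↔ β.Critical t := by
    intro t
    simp only [hC, Finset.mem_union, Finset.mem_image, Finset.mem_univ, true_and, Prod.exists,
      Critical]
    refine or_congr ?_ ?_ <;> simp only [eq_comm]
  have h0 : (0 : ℝ) ∈ C.filter (· ≤ r) :=
    Finset.mem_filter.2 ⟨(hmem 0).2 (Or.inl ⟨u, hu.symm⟩), hr⟩
  obtain ⟨r', hr', hmax⟩ := Finset.exists_max_image (C.filter (· ≤ r)) id ⟨0, h0⟩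
  rw [Finset.mem_filter] at hr'
  exact ⟨r', (hmem r').1 hr'.1, hmax 0 h0, hr'.2, fun t ht =>
    ⟨fun h => h.trans hr'.2, fun h => hmax t (Finset.mem_filter.2 ⟨(hmem t).2 ht, h⟩)⟩⟩

theorem volIn_nonneg (hx : ∀ p q, 0 ≤ β.x p q) (r : ℝ) : 0 ≤ β.volIn r :=
  Finset.sum_nonneg fun _ _ => mul_nonneg (Nat.cast_nonneg _) (hx _ _)

theorem volOut_nonneg (hx : ∀ p q, 0 ≤ β.x p q) (r : ℝ) : 0 ≤ β.volOut r :=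
  Finset.sum_nonneg fun _ _ => mul_nonneg (Nat.cast_nonneg _) (hx _ _)

theorem not_inside_of_outside (hx : ∀ p q, 0 ≤ β.x p q) {r : ℝ} {pq : Fin n × Fin n}
    (h : β.Outside r pq) : ¬ β.Inside r pq := by
  have := hx pq.1 pq.2
  rintro (h' | h')
  · linarith [h.1]
  · linarith [h.2]

theorem volIn_add_volOut_le (hx : ∀ p q, 0 ≤ β.x p q) (r : ℝ) : β.volIn r + β.volOut r ≤ β.W := by
  classical
  unfold volIn volOut W
  rw [Finset.sum_filter, Finset.sum_filter, ← Finset.sum_add_distrib]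
  refine Finset.sum_le_sum fun pq _ => ?_
  have h0 : 0 ≤ β.D * β.x pq.1 pq.2 := mul_nonneg (Nat.cast_nonneg _) (hx _ _)
  by_cases h : β.Outside r pq
  · rw [if_neg (not_inside_of_outside hx h), if_pos h]; simp
  · rw [if_neg h]; split_ifs <;> simp [h0]

theorem small_pos (hx : ∀ p q, 0 ≤ β.x p q) (hσ : 0 < β.σ) (r : ℝ) : 0 < β.small r := by
  have h1 := volIn_add_volOut_le hx r
  have : max (β.volIn r) (β.volOut r) ≤ β.W :=
    max_le (by linarith [volOut_nonneg hx r]) (by linarith [volIn_nonneg hx r])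
  unfold small; linarith

theorem small_le (hx : ∀ p q, 0 ≤ β.x p q) (r : ℝ) : β.small r ≤ β.W + β.σ := by
  have := (volIn_nonneg hx r).trans (le_max_left _ (β.volOut r))
  unfold small; linarith

/-- The set of exponents is nonempty because `small` is positive, so the infimum is attained. It is
not `0`, as `small ≤ W + σ`. -/
theorem scales_spec (hx : ∀ p q, 0 ≤ β.x p q) (hσ : 0 < β.σ) (r : ℝ) :
    β.W + β.σ < 16 ^ β.scales r * β.small r ∧ 1 ≤ β.scales r ∧
      16 ^ (β.scales r - 1) * β.small r ≤ β.W + β.σ := by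
  have hs := small_pos hx hσ r
  have hne : {k : ℕ | β.W + β.σ < 16 ^ k * β.small r}.Nonempty := by
    obtain ⟨k, hk⟩ := pow_unbounded_of_one_lt ((β.W + β.σ) / β.small r) (by norm_num : (1 : ℝ) < 16)
    exact ⟨k, (div_lt_iff₀ hs).1 hk⟩
  have h1 : β.W + β.σ < 16 ^ β.scales r * β.small r := Nat.sInf_mem hne
  have h2 : 1 ≤ β.scales r := by
    rw [Nat.one_le_iff_ne_zero]
    intro h0
    rw [h0, pow_zero, one_mul] at h1
    exact absurd (small_le hx r) (not_le.2 h1)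
  refine ⟨h1, h2, not_lt.1 fun hlt => ?_⟩
  exact Nat.notMem_of_lt_sInf (show β.scales r - 1 < _ from Nat.sub_lt h2 one_pos) hlt

/-- Some critical radius below `1 / 4` is good. -/
theorem exists_good (hx : ∀ p q, 0 ≤ β.x p q) (hxx : ∀ p, β.x p p = 0)
    (hxs : ∀ p q, β.x p q = β.x q p) (he : ∀ z, 0 ≤ β.e z) (hy : ∀ z, 0 ≤ β.y z)
    (hD : 0 < β.D) (hσ : 0 < β.σ) (hb : 1 ≤ β.b) (hl : 1 ≤ β.l) (hu : ∃ u, β.e u = 0)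
    (hlog : Real.log (1 + Real.log ((β.W + β.σ) / β.σ)) ≤ 3 * β.l)
    (hlog' : Real.log (1024 * β.b * (∑ z ∈ β.A, β.y z) + 1) ≤ 14 * β.b) :
    ∃ r, β.Critical r ∧ r + r + r + r < 1 ∧ β.Good r := by
  classical
  have hb' : (1 : ℝ) ≤ β.b := by exact_mod_cast hb
  have hl' : (1 : ℝ) ≤ β.l := by exact_mod_cast hl
  have hD' : (0 : ℝ) < β.D := by exact_mod_cast hD
  have hWs : β.W = β.D * ∑ pq ∈ β.T, β.x pq.1 pq.2 := by rw [W, Finset.mul_sum]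
  have hratio : (∑ pq ∈ β.T, β.x pq.1 pq.2 + β.σ / β.D) / (β.σ / β.D) = (β.W + β.σ) / β.σ := by
    rw [hWs]; field_simp
  have hratio' : (∑ z ∈ β.A, β.y z + 1 / (1024 * β.b)) / (1 / (1024 * β.b)) =
      1024 * β.b * (∑ z ∈ β.A, β.y z) + 1 := by
    field_simp
  -- Region growing is applied to the unscaled lengths, hence the seed `σ / D`. The available
  -- increase `1/4` is shared as `3/32` for edges and `63/512` for vertices, and `τ` is chosen so
  -- that the vertex seed contributes `1/9` to the bound.
  obtain ⟨r, hr0, hr1, hX, hY⟩ := exists_radius β.T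
    (fun pq => min (β.e pq.1 + β.y pq.1) (β.e pq.2 + β.y pq.2)) (fun pq => β.x pq.1 pq.2) β.A β.e β.y
    (fun pq _ => le_min (add_nonneg (he _) (hy _)) (add_nonneg (he _) (hy _)))
    (fun pq _ => hx _ _) (fun z _ => hy z) (σ := β.σ / β.D) (τ := 1 / (1024 * β.b))
    (α := 64 * β.l) (β := 1024 * β.b / 9) (by positivity) (by positivity) (by positivity)
    (by positivity) (by
      rw [hratio, hratio']
      have h1 : 2 / (64 * β.l) * Real.log (1 + Real.log ((β.W + β.σ) / β.σ)) ≤ 3 / 32 := by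
        refine (mul_le_mul_of_nonneg_left hlog (by positivity)).trans (le_of_eq ?_)
        field_simp; norm_num
      have h2 : 1 / (1024 * β.b / 9) * Real.log (1024 * β.b * (∑ z ∈ β.A, β.y z) + 1) ≤
          63 / 512 := by
        refine (mul_le_mul_of_nonneg_left hlog' (by positivity)).trans (le_of_eq ?_)
        field_simp; norm_num
      linarith)
  have hgood : β.Good r := by
    constructor
    · have hin : ∑ pq ∈ β.T with min (β.e pq.1 + β.y pq.1) (β.e pq.2 + β.y pq.2) +
          β.x pq.1 pq.2 ≤ r, β.x pq.1 pq.2 = β.volIn r / β.D := by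
        rw [eq_div_iff hD'.ne', volIn, mul_comm, Finset.mul_sum]
        refine Finset.sum_congr (Finset.filter_congr fun pq _ => ?_) fun _ _ => rfl
        rw [← min_add_add_right, min_le_iff]; rfl
      have hout : ∑ pq ∈ β.T with r < min (β.e pq.1 + β.y pq.1) (β.e pq.2 + β.y pq.2),
          β.x pq.1 pq.2 = β.volOut r / β.D := by
        rw [eq_div_iff hD'.ne', volOut, mul_comm, Finset.mul_sum]
        refine Finset.sum_congr (Finset.filter_congr fun pq _ => ?_) fun _ _ => rfl
        rw [lt_min_iff]; rfl
      have hcut : (β.T.filter fun pq => min (β.e pq.1 + β.y pq.1) (β.e pq.2 + β.y pq.2) ≤ r ∧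
          r < min (β.e pq.1 + β.y pq.1) (β.e pq.2 + β.y pq.2) + β.x pq.1 pq.2) = β.cutPairs r := by
        refine Finset.filter_congr fun pq _ => ?_
        rw [← not_lt, lt_min_iff, ← min_add_add_right, lt_min_iff, Outside, Inside, not_or,
          not_le, not_le]
      have h1 := hX _ rfl
      rw [hin, hout, hcut] at h1
      obtain ⟨s1, s2, -⟩ := scales_spec hx hσ r
      have hsm := small_pos hx hσ r
      have e1 : ∑ pq ∈ β.T, β.x pq.1 pq.2 - max (β.volIn r / β.D) (β.volOut r / β.D) +
          β.σ / β.D = β.small r / β.D := by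
        rw [small, hWs, max_div_div_right hD'.le]; field_simp
      have e2 : Real.exp 1 * (∑ pq ∈ β.T, β.x pq.1 pq.2 + β.σ / β.D) / (β.small r / β.D) =
          Real.exp 1 * ((β.W + β.σ) / β.small r) := by
        rw [hWs]; field_simp
      rw [e1, e2] at h1
      have hW0 : 0 ≤ β.W := by
        linarith [volIn_add_volOut_le hx r, volIn_nonneg hx r, volOut_nonneg hx r]
      have s2' : (1 : ℝ) ≤ β.scales r := by exact_mod_cast s2
      -- The real logarithm is replaced by the integer number of scales, using `1 + k log 16 ≤ 4 k`
      -- for `k ≥ 1`. With `α = 64 l` this gives the constant `256`.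
      have hk : Real.log (Real.exp 1 * ((β.W + β.σ) / β.small r)) ≤ 4 * β.scales r := by
        have hpos : 0 < (β.W + β.σ) / β.small r := by positivity
        rw [Real.log_mul (Real.exp_pos 1).ne' hpos.ne', Real.log_exp]
        have h2 : Real.log ((β.W + β.σ) / β.small r) ≤ Real.log (16 ^ β.scales r) :=
          Real.log_le_log hpos ((div_le_iff₀ hsm).2 s1.le)
        have h16 : Real.log 16 = 4 * Real.log 2 := by
          rw [show (16 : ℝ) = 2 ^ 4 by norm_num, Real.log_pow]; norm_num
        rw [Real.log_pow, h16] at h2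
        have := Real.log_two_lt_d9
        nlinarith
      have h2 : ((β.cutPairs r).card : ℝ) ≤
          64 * β.l * (β.small r / β.D * (4 * β.scales r)) := by
        refine h1.trans ?_
        have : 0 ≤ β.small r / β.D := by positivity
        gcongr
      calc (β.D * (β.cutPairs r).card : ℝ)
          ≤ β.D * (64 * β.l * (β.small r / β.D * (4 * β.scales r))) := by gcongr
        _ = 256 * (β.scales r * (β.l * β.small r)) := by field_simp; ring
    · have h1 : ((β.cutVerts r).card : ℝ) ≤ 1024 * β.b / 9 * (β.vertVol r + 1 / (1024 * β.b)) := hY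
      have h2 : 9 * (1024 * β.b / 9 * (β.vertVol r + 1 / (1024 * β.b))) =
          1024 * (β.b * β.vertVol r) + 1 := by field_simp
      linarith
  obtain ⟨r', hc, -, hle, hiff⟩ := exists_critical_le hu hr0
  refine ⟨r', hc, by linarith, (good_congr hiff hxx fun pq => ?_).2 hgood⟩
  exact Or.inr ⟨pq.2, pq.1, by rw [hxs]⟩

end BallData

/-! ### Configurations of the algorithm -/

namespace OracleRAM

open BallData

variable {n : ℕ} {G : SimpleGraph (Fin n)} {s : LPSolution n} {w : ℕ}

/-- A configuration: the pairs cut so far, the removed vertices, the labels of the pieces, and the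
largest label. -/
structure Conf (n : ℕ) where
  cut : Fin n → Fin n → Prop
  rem : Finset (Fin n)
  lab : Fin n → ℕ
  top : ℕ

namespace Conf

/-- Adjacency in the remaining graph. -/
def Alive (G : SimpleGraph (Fin n)) (c : Conf n) (p q : Fin n) : Prop := G.Adj p q ∧ ¬ c.cut p q

/-- The piece with label `ℓ`. -/
def cls (c : Conf n) (ℓ : ℕ) : Finset (Fin n) := Finset.univ.filter fun z => z ∉ c.rem ∧ c.lab z = ℓ

open Classical in
/-- The boundary of the piece with label `ℓ`. -/
noncomputable def nbr (G : SimpleGraph (Fin n)) (c : Conf n) (ℓ : ℕ) : Finset (Fin n) :=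
  Finset.univ.filter fun z => z ∈ c.rem ∧ ∃ u ∈ c.cls ℓ, c.Alive G u z

open Classical in
/-- The remaining pairs that meet the vertex set `C`. -/
noncomputable def touch (G : SimpleGraph (Fin n)) (c : Conf n) (C : Finset (Fin n)) :
    Finset (Fin n × Fin n) :=
  Finset.univ.filter fun pq => c.Alive G pq.1 pq.2 ∧ (pq.1 ∈ C ∨ pq.2 ∈ C)

/-- The data of the ball with entry distances `e` in the vertex set `A`, relative to `B`. -/
noncomputable def ballData (G : SimpleGraph (Fin n)) (s : LPSolution n) (c : Conf n)
    (B A : Finset (Fin n)) (e : Fin n → ℝ) (D b l : ℕ) (σ : ℝ) : BallData n where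
  T := c.touch G (A \ B)
  x p q := answerX G s p q
  e := e
  y := s.y B
  A := A
  D := D
  b := b
  l := l
  σ := σ

open Classical in
/-- The configuration after cutting out a ball of radius `r`. -/
noncomputable def afterBall (c : Conf n) (β : BallData n) (B : Finset (Fin n)) (r : ℝ) : Conf n where
  cut p q := c.cut p q ∨ (p, q) ∈ β.cutPairs r
  rem := c.rem ∪ (β.cutVerts r \ B)
  lab z := if z ∈ β.A ∧ z ∉ B ∧ β.e z + β.y z ≤ r then c.top + 1 else c.lab z
  top := c.top + 1

/-- Removing a vertex. -/
def remove (c : Conf n) (v : Fin n) : Conf n := { c with rem := insert v c.rem }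

theorem mem_cls {c : Conf n} {ℓ : ℕ} {z : Fin n} : z ∈ c.cls ℓ ↔ z ∉ c.rem ∧ c.lab z = ℓ := by
  simp [cls]

theorem mem_nbr {c : Conf n} {ℓ : ℕ} {z : Fin n} :
    z ∈ c.nbr G ℓ ↔ z ∈ c.rem ∧ ∃ u ∈ c.cls ℓ, c.Alive G u z := by
  simp [nbr]

theorem mem_touch {c : Conf n} {C : Finset (Fin n)} {p q : Fin n} :
    (p, q) ∈ c.touch G C ↔ c.Alive G p q ∧ (p ∈ C ∨ q ∈ C) := by
  simp [touch]

/-- Invariant between two steps of the algorithm. -/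
structure StepInv (G : SimpleGraph (Fin n)) (K : ℕ) (c : Conf n) : Prop where
  symm : ∀ p q, c.cut p q → c.cut q p
  same : ∀ p q, c.Alive G p q → p ∉ c.rem → q ∉ c.rem → c.lab p = c.lab q
  lab_le : ∀ z, c.lab z ≤ c.top
  card_nbr : ∀ ℓ, (c.nbr G ℓ).card ≤ K
  tree : ∃ m par bag, BagTree (c.Alive G) c.rem (2 * K) m par bag ∧
    ∀ ℓ, ∃ t < m, c.nbr G ℓ ⊆ bag t

/-- Invariant while balls are cut out of the piece with label `ℓ` of the configuration `c₀`, whose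
boundary is `B`. The vertex set `A` remains to be treated, `Q` are the vertices cut so far, and
`I ℓ'` is the part of `B` in the ball with label `ℓ'`. -/
structure PhaseInv (G : SimpleGraph (Fin n)) (s : LPSolution n) (b : ℕ) (c₀ : Conf n) (ℓ : ℕ)
    (v : Fin n) (B : Finset (Fin n)) (c : Conf n) (A Q : Finset (Fin n)) (I : ℕ → Finset (Fin n)) :
    Prop where
  cut_mono : ∀ p q, c₀.cut p q → c.cut p q
  symm : ∀ p q, c.cut p q → c.cut q p
  same : ∀ p q, c.Alive G p q → p ∉ c.rem → q ∉ c.rem → c.lab p = c.lab q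
  lab_le : ∀ z, c.lab z ≤ c.top
  top_le : c₀.top ≤ c.top
  ell_le : ℓ ≤ c₀.top
  boundary : B = c₀.nbr G ℓ
  mem_v : v ∈ c₀.cls ℓ
  rem_eq : c.rem = insert v c₀.rem ∪ (Q \ B)
  cut_sub : Q ⊆ (B ∪ c₀.cls ℓ) \ A
  active_sub : A ⊆ B ∪ c₀.cls ℓ
  active_eq : A \ B = c.cls ℓ
  lab_out : ∀ z, z ∉ c₀.cls ℓ → c.lab z = c₀.lab z
  lab_in : ∀ z, z ∈ c₀.cls ℓ → z ∉ c.rem → c.lab z = ℓ ∨ c₀.top < c.lab z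
  nbr_old : c.nbr G ℓ ⊆ insert v Q ∪ (B ∩ A)
  nbr_new : ∀ ℓ', c₀.top < ℓ' → c.nbr G ℓ' ⊆ insert v Q ∪ I ℓ'
  ball_sub : ∀ ℓ', I ℓ' ⊆ B
  ball_card : ∀ ℓ', 3 * (I ℓ').card ≤ 2 * B.card
  cost : (9 * Q.card : ℝ) ≤ 1024 * (b * ∑ z ∈ Finset.univ \ A, s.y B z) + (B \ A).card

/-- Nothing is removed at the start. A bag tree needs at least one node, so it has a single empty
bag. -/
theorem StepInv.init {K : ℕ} : StepInv G K ⟨fun _ _ => False, ∅, fun _ => 0, 0⟩ := by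
  have hn : ∀ ℓ, nbr G (⟨fun _ _ => False, ∅, fun _ => 0, 0⟩ : Conf n) ℓ = ∅ := by
    intro ℓ; ext z; simp [mem_nbr]
  refine ⟨fun _ _ h => h, fun _ _ _ _ _ => rfl, fun _ => le_rfl, fun ℓ => by simp [hn], 1,
    fun _ => 0, fun _ => ∅, ⟨by omega, ?_, ?_, ?_, ?_, ?_, ?_⟩, fun ℓ => ⟨0, by omega, by simp [hn]⟩⟩
  · intro t ht h0; omega
  · simp
  · simp
  · simp
  · simp
  · simp

/-- A phase begins right after the removal of `v`, which can enlarge a boundary only by `v` itself.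
Labels above the old top are unused, so no ball has to be accounted for yet. -/
theorem PhaseInv.init (hs : s.Feasible G w) {b K : ℕ} {c₀ : Conf n} (h : StepInv G K c₀)
    {v : Fin n} (hv : v ∉ c₀.rem) :
    PhaseInv G s b c₀ (c₀.lab v) v (c₀.nbr G (c₀.lab v)) (c₀.remove v)
      (c₀.nbr G (c₀.lab v) ∪ (c₀.remove v).cls (c₀.lab v)) ∅ fun _ => ∅ := by
  have hcls : ∀ ℓ z, z ∈ (c₀.remove v).cls ℓ ↔ z ≠ v ∧ z ∈ c₀.cls ℓ := by
    intro ℓ z; simp [mem_cls, remove, and_assoc]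
  have hBr : ∀ ℓ, ∀ z ∈ c₀.nbr G ℓ, z ∈ c₀.rem := fun ℓ z hz => (mem_nbr.1 hz).1
  have hal : ∀ p q, (c₀.remove v).Alive G p q ↔ c₀.Alive G p q := fun p q => Iff.rfl
  have hnbr : ∀ ℓ z, z ∈ (c₀.remove v).nbr G ℓ → z = v ∨ z ∈ c₀.nbr G ℓ := by
    intro ℓ z hz
    obtain ⟨hz, u, hu, huz⟩ := mem_nbr.1 hz
    refine (Finset.mem_insert.1 hz).imp_right fun hz => mem_nbr.2 ⟨hz, u, ((hcls _ _).1 hu).2, huz⟩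
  constructor
  · exact fun _ _ h => h
  · exact h.symm
  · exact fun p q hpq hp hq => h.same p q hpq (fun h => hp (Finset.mem_insert_of_mem h))
      fun h => hq (Finset.mem_insert_of_mem h)
  · exact h.lab_le
  · exact le_rfl
  · exact h.lab_le v
  · rfl
  · exact mem_cls.2 ⟨hv, rfl⟩
  · simp [remove]
  · simp
  · intro z hz
    rcases Finset.mem_union.1 hz with hz | hz
    · exact Finset.mem_union_left _ hz
    · exact Finset.mem_union_right _ ((hcls _ _).1 hz).2
  · ext z
    rw [Finset.mem_sdiff, Finset.mem_union]
    refine ⟨fun h => h.1.resolve_left h.2, fun h => ⟨Or.inr h, fun h' => ?_⟩⟩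
    exact (mem_cls.1 h).1 (Finset.mem_insert_of_mem (hBr _ _ h'))
  · exact fun _ _ => rfl
  · exact fun z hz _ => Or.inl (mem_cls.1 hz).2
  · intro z hz
    rcases hnbr _ _ hz with rfl | hz
    · simp
    · simp [hz]
  · intro ℓ' hℓ' z hz
    obtain ⟨-, u, hu, -⟩ := mem_nbr.1 hz
    have h1 := (mem_cls.1 hu).2
    have h2 : c₀.lab u ≤ c₀.top := h.lab_le u
    simp only [remove] at h1
    omega
  · simp
  · simp
  · have : 0 ≤ ∑ z ∈ Finset.univ \ (c₀.nbr G (c₀.lab v) ∪ (c₀.remove v).cls (c₀.lab v)),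
        s.y (c₀.nbr G (c₀.lab v)) z := Finset.sum_nonneg fun z _ => hs.y_nonneg _ _
    simp only [Finset.card_empty, Nat.cast_zero, mul_zero]
    positivity

/-- Pairs starting at a vertex outside the ball are outside unless they are cut. -/
theorem outside_of_lt (hs : s.Feasible G w) {c : Conf n} {B A : Finset (Fin n)} {e : Fin n → ℝ}
    {u : Fin n} (he : EntryDist G s B u e) {D b l : ℕ} {σ r : ℝ} {p q : Fin n}
    (h : (c.afterBall (c.ballData G s B A e D b l σ) B r).Alive G p q) (hp : p ∈ A \ B)
    (hr : r < e p) : (c.ballData G s B A e D b l σ).Outside r (p, q) := by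
  by_contra hout
  have hT : (p, q) ∈ c.touch G (A \ B) := mem_touch.2 ⟨⟨h.1, fun h' => h.2 (Or.inl h')⟩, Or.inl hp⟩
  have hin : (c.ballData G s B A e D b l σ).Inside r (p, q) := by
    by_contra hin
    exact h.2 (Or.inr (by classical exact Finset.mem_filter.2 ⟨hT, hout, hin⟩))
  have hx := answerX_nonneg hs (p : ℕ) q
  have hy := hs.y_nonneg B p
  rcases hin with hin | hin
  · have hin : e p + s.y B p + answerX G s p q ≤ r := hin
    linarith
  · have hin : e q + s.y B q + answerX G s p q ≤ r := hin
    have := he.step q p h.1.symm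
    rw [answerX_symm] at this
    linarith

/-- Neighbours of vertices inside the ball enter the ball, unless the pair is cut. -/
theorem entry_le_of_le (hs : s.Feasible G w) {c : Conf n} {B A : Finset (Fin n)} {e : Fin n → ℝ}
    {u : Fin n} (he : EntryDist G s B u e) {D b l : ℕ} {σ r : ℝ} {p q : Fin n}
    (h : (c.afterBall (c.ballData G s B A e D b l σ) B r).Alive G p q) (hp : p ∈ A \ B)
    (hr : e p + s.y B p ≤ r) :
    (c.ballData G s B A e D b l σ).Inside r (p, q) ∧ e q ≤ r := by
  have hT : (p, q) ∈ c.touch G (A \ B) := mem_touch.2 ⟨⟨h.1, fun h' => h.2 (Or.inl h')⟩, Or.inl hp⟩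
  have hout : ¬ (c.ballData G s B A e D b l σ).Outside r (p, q) := fun h => by
    have : r < e p + s.y B p := h.1
    linarith
  have hin : (c.ballData G s B A e D b l σ).Inside r (p, q) := by
    by_contra hin
    exact h.2 (Or.inr (by classical exact Finset.mem_filter.2 ⟨hT, hout, hin⟩))
  refine ⟨hin, ?_⟩
  have hx := answerX_nonneg hs (p : ℕ) q
  have hy := hs.y_nonneg B q
  rcases hin with hin | hin
  · have hin : e p + s.y B p + answerX G s p q ≤ r := hin
    linarith [he.step p q h.1]
  · have hin : e q + s.y B q + answerX G s p q ≤ r := hin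
    linarith

theorem afterBall_symm {c : Conf n} (hc : ∀ p q, c.cut p q → c.cut q p) {B A : Finset (Fin n)}
    {e : Fin n → ℝ} {D b l : ℕ} {σ r : ℝ} (p q : Fin n)
    (h : (c.afterBall (c.ballData G s B A e D b l σ) B r).cut p q) :
    (c.afterBall (c.ballData G s B A e D b l σ) B r).cut q p := by
  classical
  refine h.imp (hc p q) fun h => ?_
  obtain ⟨h1, h2, h3⟩ := Finset.mem_filter.1 h
  obtain ⟨h4, h5⟩ := mem_touch.1 h1
  refine Finset.mem_filter.2 ⟨mem_touch.2 ⟨⟨h4.1.symm, fun h => h4.2 (hc _ _ h)⟩, h5.symm⟩,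
    fun h => h2 h.symm, fun h => h3 ?_⟩
  refine h.symm.imp (fun h => ?_) fun h => ?_
  · have h : e p + s.y B p + answerX G s q p ≤ r := h
    rw [answerX_symm] at h; exact h
  · have h : e q + s.y B q + answerX G s q p ≤ r := h
    rw [answerX_symm] at h; exact h

/-- Cutting out a ball preserves the invariant. -/
theorem PhaseInv.ball (hs : s.Feasible G w) {b : ℕ} {c₀ : Conf n} {ℓ : ℕ} {v : Fin n}
    {B : Finset (Fin n)} {c : Conf n} {A Q : Finset (Fin n)} {I : ℕ → Finset (Fin n)}
    (h : PhaseInv G s b c₀ ℓ v B c A Q I) {u : Fin n} (huA : u ∈ A) (huB : u ∈ B)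
    {e : Fin n → ℝ} (he : EntryDist G s B u e) {D l : ℕ} {σ r : ℝ} (hr0 : 0 ≤ r)
    (hr : r + r + r + r < 1) (hg : (c.ballData G s B A e D b l σ).Good r) :
    ∃ Q' I', PhaseInv G s b c₀ ℓ v B (c.afterBall (c.ballData G s B A e D b l σ) B r)
      (A.filter fun z => r < e z) Q' I' := by
  classical
  set β := c.ballData G s B A e D b l σ with hβ
  set c' := c.afterBall β B r with hc'
  set A' := A.filter fun z => r < e z with hA'
  set Z := β.cutVerts r with hZ
  have hy : ∀ z, 0 ≤ s.y B z := fun z => hs.y_nonneg B z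
  have memZ : ∀ z, z ∈ Z ↔ z ∈ A ∧ e z ≤ r ∧ r < e z + s.y B z := fun z => by
    rw [hZ, cutVerts, Finset.mem_filter]; rfl
  have memA' : ∀ z, z ∈ A' ↔ z ∈ A ∧ r < e z := fun z => Finset.mem_filter
  have memrem : ∀ z, z ∈ c'.rem ↔ z ∈ c.rem ∨ z ∈ Z ∧ z ∉ B := fun z => by
    rw [hc', afterBall, Finset.mem_union, Finset.mem_sdiff]
  have lab_eq : ∀ z, c'.lab z = if z ∈ A ∧ z ∉ B ∧ e z + s.y B z ≤ r then c.top + 1 else c.lab z :=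
    fun z => rfl
  have alive_sub : ∀ p q, c'.Alive G p q → c.Alive G p q := fun p q hpq =>
    ⟨hpq.1, fun h => hpq.2 (Or.inl h)⟩
  have hsymm : ∀ p q, c'.cut p q → c'.cut q p := afterBall_symm h.symm
  have alive_symm : ∀ p q, c'.Alive G p q → c'.Alive G q p := fun p q hpq =>
    ⟨hpq.1.symm, fun h => hpq.2 (hsymm _ _ h)⟩
  have memC : ∀ z, z ∈ A \ B ↔ z ∉ c.rem ∧ c.lab z = ℓ := fun z => by rw [h.active_eq, mem_cls]
  have hBrem : ∀ z ∈ B, z ∈ c.rem := fun z hz => by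
    rw [h.rem_eq]
    refine Finset.mem_union_left _ (Finset.mem_insert_of_mem ?_)
    rw [h.boundary] at hz; exact (mem_nbr.1 hz).1
  have hnotrem : ∀ z, z ∉ c'.rem → z ∉ c.rem ∧ (z ∈ A → e z ≤ r → e z + s.y B z ≤ r) := by
    intro z hz
    rw [memrem, not_or] at hz
    refine ⟨hz.1, fun hzA hez => not_lt.1 fun hlt => hz.2 ⟨(memZ z).2 ⟨hzA, hez, hlt⟩, fun hzB => ?_⟩⟩
    exact hz.1 (hBrem z hzB)
  have hcls : A' \ B = c'.cls ℓ := by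
    ext z
    rw [Finset.mem_sdiff, memA', mem_cls]
    constructor
    · rintro ⟨⟨hzA, hlt⟩, hzB⟩
      have h1 := (memC z).1 (Finset.mem_sdiff.2 ⟨hzA, hzB⟩)
      refine ⟨fun hz => ?_, ?_⟩
      · rcases (memrem z).1 hz with hz | hz
        · exact h1.1 hz
        · linarith [((memZ z).1 hz.1).2.1]
      · rw [lab_eq, if_neg, h1.2]
        rintro ⟨-, -, hle⟩
        linarith [hy z]
    · rintro ⟨hz, hlab⟩
      obtain ⟨h1, h2⟩ := hnotrem z hz
      rw [lab_eq] at hlab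
      split_ifs at hlab with hc
      · have := h.ell_le; have := h.top_le; omega
      · have h3 := (memC z).2 ⟨h1, hlab⟩
        rw [Finset.mem_sdiff] at h3
        refine ⟨⟨h3.1, not_le.1 fun hle => hc ⟨h3.1, h3.2, h2 h3.1 hle⟩⟩, h3.2⟩
  have hinside : ∀ p q, c'.Alive G p q → p ∉ c'.rem → q ∉ c'.rem → p ∈ A \ B →
      e p + s.y B p ≤ r → q ∈ A \ B → e q + s.y B q ≤ r := by
    intro p q hpq _ hq hpC hpr hqC
    have := (entry_le_of_le hs he hpq hpC hpr).2
    exact (hnotrem q hq).2 (Finset.mem_sdiff.1 hqC).1 this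
  -- The crossing vertices join `Q`, including those of `B`, which are already removed. The new
  -- piece is assigned the active part of `B` lying fully inside the ball.
  refine ⟨Q ∪ Z, Function.update I (c.top + 1) ((B ∩ A).filter fun z => e z + s.y B z ≤ r), ?_⟩
  constructor
  · exact fun p q hpq => Or.inl (h.cut_mono p q hpq)
  · exact hsymm
  · intro p q hpq hp hq
    have hl := h.same p q (alive_sub _ _ hpq) (hnotrem p hp).1 (hnotrem q hq).1
    have hC : p ∈ A \ B ↔ q ∈ A \ B := by
      rw [memC, memC, hl]
      simp [(hnotrem p hp).1, (hnotrem q hq).1]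
    have hiff : (p ∈ A ∧ p ∉ B ∧ e p + s.y B p ≤ r) ↔ (q ∈ A ∧ q ∉ B ∧ e q + s.y B q ≤ r) := by
      constructor
      · rintro ⟨h1, h2, h3⟩
        have hpC := Finset.mem_sdiff.2 ⟨h1, h2⟩
        have hqC := hC.1 hpC
        exact ⟨(Finset.mem_sdiff.1 hqC).1, (Finset.mem_sdiff.1 hqC).2,
          hinside p q hpq hp hq hpC h3 hqC⟩
      · rintro ⟨h1, h2, h3⟩
        have hqC := Finset.mem_sdiff.2 ⟨h1, h2⟩
        have hpC := hC.2 hqC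
        exact ⟨(Finset.mem_sdiff.1 hpC).1, (Finset.mem_sdiff.1 hpC).2,
          hinside q p (alive_symm _ _ hpq) hq hp hqC h3 hpC⟩
    rw [lab_eq, lab_eq, hl]
    exact if_congr hiff rfl rfl
  · intro z
    rw [lab_eq]
    have : c'.top = c.top + 1 := rfl
    have := h.lab_le z
    split_ifs <;> omega
  · exact h.top_le.trans (Nat.le_succ _)
  · exact h.ell_le
  · exact h.boundary
  · exact h.mem_v
  · change c.rem ∪ (Z \ B) = _
    rw [h.rem_eq, Finset.union_assoc, Finset.union_sdiff_distrib]
  · intro z hz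
    rcases Finset.mem_union.1 hz with hz | hz
    · obtain ⟨h1, h2⟩ := Finset.mem_sdiff.1 (h.cut_sub hz)
      exact Finset.mem_sdiff.2 ⟨h1, fun h => h2 ((memA' z).1 h).1⟩
    · obtain ⟨h1, h2, h3⟩ := (memZ z).1 hz
      exact Finset.mem_sdiff.2 ⟨h.active_sub h1, fun h => by linarith [((memA' z).1 h).2]⟩
  · exact (Finset.filter_subset _ _).trans h.active_sub
  · exact hcls
  · intro z hz
    rw [lab_eq, if_neg, h.lab_out z hz]
    rintro ⟨h1, h2, -⟩
    exact ((Finset.mem_union.1 (h.active_sub h1)).elim h2 hz)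
  · intro z hz hzr
    rw [lab_eq]
    split_ifs
    · right; have := h.top_le; omega
    · exact h.lab_in z hz (hnotrem z hzr).1
  · intro z hz
    obtain ⟨hzr, p, hp, hpz⟩ := mem_nbr.1 hz
    rw [← hcls, Finset.mem_sdiff, memA'] at hp
    have hpC : p ∈ A \ B := Finset.mem_sdiff.2 ⟨hp.1.1, hp.2⟩
    by_cases hzZ : z ∈ Z
    · simp [hzZ]
    · have hzc : z ∈ c.rem := ((memrem z).1 hzr).resolve_right fun h => hzZ h.1
      have h1 := h.nbr_old (mem_nbr.2 ⟨hzc, p, by rwa [← h.active_eq], alive_sub _ _ hpz⟩)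
      rcases Finset.mem_union.1 h1 with h1 | h1
      · rcases Finset.mem_insert.1 h1 with rfl | h1
        · simp
        · simp [h1]
      -- A boundary vertex seen from outside the ball along a surviving pair has its exit beyond
      -- `r`. If it does not cross the sphere, its entry is beyond `r` as well, so it stays active.
      · have hout := (outside_of_lt hs he hpz hpC hp.1.2).2
        have hout : r < e z + s.y B z := hout
        obtain ⟨h2, h3⟩ := Finset.mem_inter.1 h1
        refine Finset.mem_union_right _ (Finset.mem_inter.2 ⟨h2, (memA' z).2 ⟨h3, ?_⟩⟩)
        exact not_le.1 fun hle => hzZ ((memZ z).2 ⟨h3, hle, hout⟩)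
  · intro ℓ' hℓ' z hz
    obtain ⟨hzr, p, hp, hpz⟩ := mem_nbr.1 hz
    obtain ⟨hpr, hplab⟩ := mem_cls.1 hp
    rw [lab_eq] at hplab
    by_cases hpI : p ∈ A ∧ p ∉ B ∧ e p + s.y B p ≤ r
    · rw [if_pos hpI] at hplab
      subst hplab
      rw [Function.update_self]
      have hpC : p ∈ A \ B := Finset.mem_sdiff.2 ⟨hpI.1, hpI.2.1⟩
      by_cases hzZ : z ∈ Z
      · simp [hzZ]
      · have hzc : z ∈ c.rem := ((memrem z).1 hzr).resolve_right fun h => hzZ h.1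
        have h1 := h.nbr_old (mem_nbr.2 ⟨hzc, p, by rwa [← h.active_eq], alive_sub _ _ hpz⟩)
        rcases Finset.mem_union.1 h1 with h1 | h1
        · rcases Finset.mem_insert.1 h1 with rfl | h1
          · simp
          · simp [h1]
        -- Conversely, a boundary vertex seen from inside has its entry within `r`. If it does not
        -- cross the sphere, it lies in the ball.
        · have hin := (entry_le_of_le hs he hpz hpC hpI.2.2).2
          obtain ⟨h2, h3⟩ := Finset.mem_inter.1 h1
          refine Finset.mem_union_right _ (Finset.mem_filter.2 ⟨h1, ?_⟩)
          exact not_lt.1 fun hlt => hzZ ((memZ z).2 ⟨h3, hin, hlt⟩)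
    · rw [if_neg hpI] at hplab
      have hpl := h.lab_le p
      rw [Function.update_of_ne (by omega)]
      rcases (memrem z).1 hzr with hzc | hzZ
      · have h1 := h.nbr_new ℓ' hℓ' (mem_nbr.2 ⟨hzc, p,
          mem_cls.2 ⟨(hnotrem p hpr).1, hplab⟩, alive_sub _ _ hpz⟩)
        rcases Finset.mem_union.1 h1 with h1 | h1
        · rcases Finset.mem_insert.1 h1 with rfl | h1
          · simp
          · simp [h1]
        · exact Finset.mem_union_right _ h1
      · have hzC := (memC z).1 (Finset.mem_sdiff.2 ⟨((memZ z).1 hzZ.1).1, hzZ.2⟩)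
        have := h.same p z (alive_sub _ _ hpz) (hnotrem p hpr).1 hzC.1
        have := h.ell_le
        omega
  · intro ℓ'
    by_cases hl : ℓ' = c.top + 1
    · subst hl; rw [Function.update_self]
      exact (Finset.filter_subset _ _).trans Finset.inter_subset_left
    · rw [Function.update_of_ne hl]; exact h.ball_sub ℓ'
  · intro ℓ'
    by_cases hl : ℓ' = c.top + 1
    · subst hl; rw [Function.update_self]
      exact he.card_ball_le hs huB ((Finset.filter_subset _ _).trans Finset.inter_subset_left)
        (by linarith : r < 1 / 4) fun z hz => (Finset.mem_filter.1 hz).2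
    · rw [Function.update_of_ne hl]; exact h.ball_card ℓ'
  · have h1 := h.cost
    have h2 : (9 * Z.card : ℝ) ≤ 1024 * (b * ∑ z ∈ A with e z ≤ r, s.y B z) + 1 := hg.2
    have h3 : ((Q ∪ Z).card : ℝ) ≤ Q.card + Z.card := by exact_mod_cast Finset.card_union_le _ _
    have h4 : Finset.univ \ A' = (Finset.univ \ A) ∪ A.filter fun z => e z ≤ r := by
      ext z; simp only [Finset.mem_sdiff, Finset.mem_univ, true_and, memA', Finset.mem_union,
        Finset.mem_filter, not_and, not_lt]; tauto
    have h5 : ∑ z ∈ Finset.univ \ A', s.y B z =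
        ∑ z ∈ Finset.univ \ A, s.y B z + ∑ z ∈ A with e z ≤ r, s.y B z := by
      rw [h4, Finset.sum_union]
      refine Finset.disjoint_left.2 fun z hz hz' => ?_
      exact (Finset.mem_sdiff.1 hz).2 (Finset.mem_filter.1 hz').1
    -- The additive `1` in the vertex bound is charged to the centre `u`, which leaves the active
    -- part of `B`.
    have h6 : insert u (B \ A) ⊆ B \ A' := by
      intro z hz
      rcases Finset.mem_insert.1 hz with rfl | hz
      · exact Finset.mem_sdiff.2 ⟨huB, fun h => by linarith [((memA' z).1 h).2, he.self]⟩
      · obtain ⟨h7, h8⟩ := Finset.mem_sdiff.1 hz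
        exact Finset.mem_sdiff.2 ⟨h7, fun h => h8 ((memA' z).1 h).1⟩
    have h7 : ((B \ A).card : ℝ) + 1 ≤ (B \ A').card := by
      have := Finset.card_le_card h6
      rw [Finset.card_insert_of_notMem fun h => (Finset.mem_sdiff.1 h).2 huA] at this
      exact_mod_cast this
    rw [h5, mul_add, mul_add]
    linarith

/-- At the end of a step the invariant between steps holds. -/
theorem PhaseInv.finish {K b : ℕ} (hK : 9 ≤ K) {c₀ : Conf n} (h₀ : StepInv G K c₀) {ℓ : ℕ}
    {v : Fin n} {B : Finset (Fin n)} {c : Conf n} {A Q : Finset (Fin n)} {I : ℕ → Finset (Fin n)}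
    (h : PhaseInv G s b c₀ ℓ v B c A Q I) (hQ : 9 * Q.card ≤ 2 * K)
    (hfin : B ∩ A = ∅ ∨ Q = ∅ ∧ B.card < K) : StepInv G K c := by
  classical
  have hB : B.card ≤ K := by rw [h.boundary]; exact h₀.card_nbr ℓ
  have hBr : ∀ z ∈ B, z ∈ c₀.rem := fun z hz => by
    rw [h.boundary] at hz; exact (mem_nbr.1 hz).1
  have alive_sub : ∀ p q, c.Alive G p q → c₀.Alive G p q := fun p q hpq =>
    ⟨hpq.1, fun h' => hpq.2 (h.cut_mono _ _ h')⟩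
  set Z := insert v (Q \ B) with hZ
  have hZcls : ∀ z ∈ Z, z ∈ c₀.cls ℓ := by
    intro z hz
    rcases Finset.mem_insert.1 hz with rfl | hz
    · exact h.mem_v
    · obtain ⟨h1, h2⟩ := Finset.mem_sdiff.1 hz
      exact (Finset.mem_union.1 (Finset.mem_sdiff.1 (h.cut_sub h1)).1).resolve_left h2
  have hrem : c.rem = c₀.rem ∪ Z := by
    rw [h.rem_eq, hZ, Finset.union_insert, Finset.insert_union]
  have hsubs : insert v Q ⊆ B ∪ Z := by
    intro z hz
    by_cases hzB : z ∈ B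
    · exact Finset.mem_union_left _ hzB
    · refine Finset.mem_union_right _ ?_
      rcases Finset.mem_insert.1 hz with rfl | hz
      · exact Finset.mem_insert_self _ _
      · exact Finset.mem_insert_of_mem (Finset.mem_sdiff.2 ⟨hz, hzB⟩)
  -- Pieces cut out as balls and the rest of the old piece have boundaries inside the new bag. Any
  -- other piece sees no newly removed vertex, because those come from piece `ℓ` and no surviving
  -- edge joins different pieces.
  have hcase : ∀ ℓ', (c.nbr G ℓ' ⊆ c₀.nbr G ℓ') ∨
      (c.nbr G ℓ' ⊆ B ∪ Z ∧ (c.nbr G ℓ').card ≤ K) := by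
    intro ℓ'
    rcases lt_or_ge c₀.top ℓ' with hl | hl
    · right
      have h1 := h.nbr_new ℓ' hl
      refine ⟨h1.trans (Finset.union_subset hsubs
        -- For a ball the count is `1 + 2K/9 + 2K/3 = 1 + 8K/9`, which is at most `K` since `K ≥ 9`.
        ((h.ball_sub ℓ').trans Finset.subset_union_left)), ?_⟩
      have h2 := Finset.card_le_card h1
      have h3 := Finset.card_union_le (insert v Q) (I ℓ')
      have h4 := Finset.card_insert_le v Q
      have h5 := h.ball_card ℓ'
      omega
    · rcases eq_or_ne ℓ' ℓ with rfl | hne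
      · right
        have h1 := h.nbr_old
        refine ⟨h1.trans (Finset.union_subset hsubs
          (Finset.inter_subset_left.trans Finset.subset_union_left)), ?_⟩
        have h2 := Finset.card_le_card h1
        have h3 := Finset.card_union_le (insert v Q) (B ∩ A)
        have h4 := Finset.card_insert_le v Q
        rcases hfin with hf | ⟨hf, hf'⟩
        · rw [hf] at h2 h3; rw [Finset.card_empty] at h3; omega
        · have h5 := Finset.card_le_card (Finset.inter_subset_left : B ∩ A ⊆ B)
          rw [hf, Finset.card_empty] at h4
          rw [hf] at h2 h3
          omega
      · left
        intro z hz
        obtain ⟨hzr, p, hp, hpz⟩ := mem_nbr.1 hz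
        obtain ⟨hpr, hpl⟩ := mem_cls.1 hp
        have hp0 : p ∉ c₀.cls ℓ := fun hc => by
          rcases h.lab_in p hc hpr with h1 | h1 <;> omega
        have hpr0 : p ∉ c₀.rem := fun h' => hpr (by rw [hrem]; exact Finset.mem_union_left _ h')
        have hpl0 : c₀.lab p = ℓ' := by rw [← h.lab_out p hp0, hpl]
        rw [hrem] at hzr
        rcases Finset.mem_union.1 hzr with hzr | hzZ
        · exact mem_nbr.2 ⟨hzr, p, mem_cls.2 ⟨hpr0, hpl0⟩, alive_sub _ _ hpz⟩
        · have h1 := mem_cls.1 (hZcls z hzZ)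
          have h2 := h₀.same p z (alive_sub _ _ hpz) hpr0 h1.1
          omega
  refine ⟨h.symm, h.same, h.lab_le, fun ℓ' => ?_, ?_⟩
  · rcases hcase ℓ' with h1 | h1
    · exact (Finset.card_le_card h1).trans (h₀.card_nbr ℓ')
    · exact h1.2
  · obtain ⟨m, par, bag, htree, hbag⟩ := h₀.tree
    obtain ⟨t₀, ht₀, hB₀⟩ := hbag ℓ
    rw [← h.boundary] at hB₀
    -- The new bag `B ∪ {v} ∪ Q` hangs below a bag containing `B`. Every surviving edge from the
    -- newly removed vertices to earlier removed ones ends in `B`.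
    have htree' := (htree.mono alive_sub).addLeaf ht₀ hB₀ (Z := Z)
      (Finset.disjoint_left.2 fun z hz hz' => (mem_cls.1 (hZcls z hz)).1 hz')
      (by
        have h1 := Finset.card_union_le B Z
        have h2 := Finset.card_insert_le v (Q \ B)
        rw [← hZ] at h2
        have h3 := Finset.card_le_card (Finset.sdiff_subset : Q \ B ⊆ Q)
        omega)
      (fun p q hpq => ⟨hpq.1.symm, fun h' => hpq.2 (h.symm _ _ h')⟩)
      (fun p hp z hz hpz => by
        rw [h.boundary]
        exact mem_nbr.2 ⟨hz, p, hZcls p hp, alive_sub _ _ hpz⟩)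
    rw [← hrem] at htree'
    refine ⟨_, _, _, htree', fun ℓ' => ?_⟩
    rcases hcase ℓ' with h1 | h1
    · obtain ⟨t, ht, hsub⟩ := hbag ℓ'
      refine ⟨t, by omega, ?_⟩
      rw [Function.update_of_ne ht.ne]
      exact h1.trans hsub
    · exact ⟨m, by omega, by rw [Function.update_self]; exact h1.1⟩

end Conf
end OracleRAM

/-! ### The number of pairs that are cut -/

namespace OracleRAM

open BallData

variable {n : ℕ} {G : SimpleGraph (Fin n)} {s : LPSolution n} {w : ℕ}

namespace Conf

/-- The volume of the remaining pairs that meet `C`. -/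
noncomputable def vol (G : SimpleGraph (Fin n)) (s : LPSolution n) (D : ℕ) (c : Conf n)
    (C : Finset (Fin n)) : ℝ :=
  ∑ pq ∈ c.touch G C, D * answerX G s pq.1 pq.2

/-- The potential of a configuration. -/
noncomputable def pot (G : SimpleGraph (Fin n)) (s : LPSolution n) (D : ℕ) (σ : ℝ) (c : Conf n) : ℝ :=
  ∑ ℓ ∈ Finset.range (c.top + 1), entropyPot σ (c.vol G s D (c.cls ℓ))

open Classical in
/-- The set of cut pairs. -/
noncomputable def cutSet (c : Conf n) : Finset (Fin n × Fin n) :=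
  Finset.univ.filter fun pq => c.cut pq.1 pq.2

theorem vol_nonneg (hs : s.Feasible G w) (D : ℕ) (c : Conf n) (C : Finset (Fin n)) :
    0 ≤ c.vol G s D C :=
  Finset.sum_nonneg fun _ _ => mul_nonneg (Nat.cast_nonneg _) (answerX_nonneg hs _ _)

theorem vol_mono (hs : s.Feasible G w) {D : ℕ} {c c' : Conf n} {C C' : Finset (Fin n)}
    (hc : ∀ p q, c.cut p q → c'.cut p q) (hC : C' ⊆ C) : c'.vol G s D C' ≤ c.vol G s D C := by
  refine Finset.sum_le_sum_of_subset_of_nonneg (fun pq h => ?_) fun _ _ _ =>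
    mul_nonneg (Nat.cast_nonneg _) (answerX_nonneg hs _ _)
  obtain ⟨p, q⟩ := pq
  obtain ⟨h1, h2⟩ := mem_touch.1 h
  exact mem_touch.2 ⟨⟨h1.1, fun h => h1.2 (hc _ _ h)⟩, h2.imp (fun h => hC h) fun h => hC h⟩

/-- Bound for the number of cut pairs in terms of the decrease of the potential. -/
structure CostInv (G : SimpleGraph (Fin n)) (s : LPSolution n) (D l : ℕ) (σ Ψ : ℝ) (Λ : ℕ)
    (c : Conf n) : Prop where
  pos : ∀ p q, c.cut p q → G.Adj p q ∧ 0 < answerX G s p q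
  cost : (D * c.cutSet.card : ℝ) ≤ 256 * l * (4 * (Ψ - c.pot G s D σ) + 8 * σ * Λ * c.top)

/-- Removing a vertex shrinks its piece, so volumes and the potential can only decrease, while no
pair is cut. -/
theorem CostInv.remove (hs : s.Feasible G w) {D l Λ : ℕ} {σ Ψ : ℝ} (hσ : 0 < σ) {c : Conf n}
    (h : CostInv G s D l σ Ψ Λ c) (v : Fin n) : CostInv G s D l σ Ψ Λ (c.remove v) := by
  refine ⟨h.pos, h.cost.trans ?_⟩
  have : (c.remove v).pot G s D σ ≤ c.pot G s D σ := by
    refine Finset.sum_le_sum fun ℓ _ => entropyPot_mono hσ (vol_nonneg hs _ _ _) ?_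
    refine vol_mono hs (fun _ _ h => h) fun z hz => ?_
    rw [mem_cls] at hz ⊢
    exact ⟨fun h => hz.1 (Finset.mem_insert_of_mem h), hz.2⟩
  have hl : (0 : ℝ) ≤ 256 * l := by positivity
  have htop : (c.remove v).top = c.top := rfl
  rw [htop]
  exact mul_le_mul_of_nonneg_left (by linarith) hl

/-- A ball splits the volume of one piece into at most `volIn` and `volOut` and does not increase
any other volume. The potential thus drops by the amount of `entropyPot_drop`, which pays for the
cut allowed by `Good`. The seed is paid once per ball, and `top` counts the balls. -/
theorem CostInv.ball (hs : s.Feasible G w) {D l Λ b : ℕ} {σ Ψ : ℝ} (hσ : 0 < σ) {c : Conf n}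
    (h : CostInv G s D l σ Ψ Λ c) {B A : Finset (Fin n)} {ℓ : ℕ} (hAB : A \ B = c.cls ℓ)
    (hℓ : ℓ ≤ c.top) (hlab : ∀ z, c.lab z ≤ c.top) {u : Fin n} {e : Fin n → ℝ}
    (he : EntryDist G s B u e) {r : ℝ} (hg : (c.ballData G s B A e D b l σ).Good r)
    (hΛ : (c.ballData G s B A e D b l σ).scales r ≤ Λ) :
    CostInv G s D l σ Ψ Λ (c.afterBall (c.ballData G s B A e D b l σ) B r) := by
  classical
  set β := c.ballData G s B A e D b l σ with hβ
  set c' := c.afterBall β B r with hc'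
  have hx : ∀ p q, 0 ≤ β.x p q := fun p q => answerX_nonneg hs _ _
  have hy : ∀ z, 0 ≤ s.y B z := fun z => hs.y_nonneg B z
  have lab_eq : ∀ z, c'.lab z = if z ∈ A ∧ z ∉ B ∧ e z + s.y B z ≤ r then c.top + 1 else c.lab z :=
    fun z => rfl
  have hmono : ∀ p q, c.cut p q → c'.cut p q := fun p q h => Or.inl h
  have hrem : ∀ z, z ∉ c'.rem → z ∉ c.rem ∧ ¬ (z ∈ β.cutVerts r ∧ z ∉ B) := by
    intro z hz
    rw [hc', afterBall, Finset.mem_union, Finset.mem_sdiff, not_or] at hz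
    exact hz
  have memC : ∀ z, z ∈ A \ B ↔ z ∉ c.rem ∧ c.lab z = ℓ := fun z => by rw [hAB, mem_cls]
  have hW : β.W = c.vol G s D (c.cls ℓ) := by rw [← hAB]; rfl
  have hcutT : ∀ p q, (p, q) ∈ β.T → ¬ c'.cut p q → β.Outside r (p, q) ∨ β.Inside r (p, q) := by
    intro p q hT hcut
    by_contra hcon
    rw [not_or] at hcon
    exact hcut (Or.inr (Finset.mem_filter.2 ⟨hT, hcon⟩))
  -- A surviving pair of the old piece is inside or outside. One meeting the new piece has an
  -- endpoint with exit within `r`, so it is not outside.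
  have hnew : c'.vol G s D (c'.cls (c.top + 1)) ≤ β.volIn r := by
    refine Finset.sum_le_sum_of_subset_of_nonneg (fun pq h => ?_) fun _ _ _ =>
      mul_nonneg (Nat.cast_nonneg _) (answerX_nonneg hs _ _)
    obtain ⟨p, q⟩ := pq
    obtain ⟨h1, h2⟩ := mem_touch.1 h
    have hin : ∀ z, z ∈ c'.cls (c.top + 1) → z ∈ A \ B ∧ e z + s.y B z ≤ r := by
      intro z hz
      have hz := (mem_cls.1 hz).2
      rw [lab_eq] at hz
      split_ifs at hz with hc
      · exact ⟨Finset.mem_sdiff.2 ⟨hc.1, hc.2.1⟩, hc.2.2⟩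
      · have := hlab z; omega
    have hT : (p, q) ∈ β.T := mem_touch.2 ⟨⟨h1.1, fun h => h1.2 (hmono _ _ h)⟩,
      h2.imp (fun h => (hin p h).1) fun h => (hin q h).1⟩
    refine Finset.mem_filter.2 ⟨hT, (hcutT p q hT h1.2).resolve_left fun hout => ?_⟩
    have hout1 : r < e p + s.y B p := hout.1
    have hout2 : r < e q + s.y B q := hout.2
    rcases h2 with h2 | h2
    · linarith [(hin p h2).2]
    · linarith [(hin q h2).2]
  -- A pair meeting the remaining piece has an endpoint with entry beyond `r`. By the triangle
  -- inequality along the edge it cannot be inside.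
  have hold : c'.vol G s D (c'.cls ℓ) ≤ β.volOut r := by
    refine Finset.sum_le_sum_of_subset_of_nonneg (fun pq h => ?_) fun _ _ _ =>
      mul_nonneg (Nat.cast_nonneg _) (answerX_nonneg hs _ _)
    obtain ⟨p, q⟩ := pq
    obtain ⟨h1, h2⟩ := mem_touch.1 h
    have hout : ∀ z, z ∈ c'.cls ℓ → z ∈ A \ B ∧ r < e z := by
      intro z hz
      obtain ⟨hz1, hz⟩ := mem_cls.1 hz
      obtain ⟨hz2, hz3⟩ := hrem z hz1
      rw [lab_eq] at hz
      split_ifs at hz with hc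
      · omega
      · have hzC := (memC z).2 ⟨hz2, hz⟩
        refine ⟨hzC, not_le.1 fun hle => ?_⟩
        obtain ⟨h3, h4⟩ := Finset.mem_sdiff.1 hzC
        refine hz3 ⟨Finset.mem_filter.2 ⟨h3, hle, not_le.1 fun hle' => hc ⟨h3, h4, hle'⟩⟩, h4⟩
    have hT : (p, q) ∈ β.T := mem_touch.2 ⟨⟨h1.1, fun h => h1.2 (hmono _ _ h)⟩,
      h2.imp (fun h => (hout p h).1) fun h => (hout q h).1⟩
    refine Finset.mem_filter.2 ⟨hT, (hcutT p q hT h1.2).resolve_right fun hin => ?_⟩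
    have hin : e p + s.y B p + answerX G s p q ≤ r ∨ e q + s.y B q + answerX G s p q ≤ r := hin
    have hx := answerX_nonneg hs (p : ℕ) q
    have s1 := he.step p q h1.1
    have s2 := he.step q p h1.1.symm
    rw [answerX_symm] at s2
    have y1 := hy p
    have y2 := hy q
    rcases h2 with h2 | h2
    · have := (hout p h2).2
      rcases hin with hin | hin <;> linarith
    · have := (hout q h2).2
      rcases hin with hin | hin <;> linarith
  have hother : ∀ ℓ' ≤ c.top, ℓ' ≠ ℓ → c'.vol G s D (c'.cls ℓ') ≤ c.vol G s D (c.cls ℓ') := by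
    intro ℓ' hl hne
    refine vol_mono hs hmono fun z hz => ?_
    obtain ⟨hz1, hz2⟩ := mem_cls.1 hz
    rw [lab_eq] at hz2
    split_ifs at hz2 with hc
    · omega
    · exact mem_cls.2 ⟨(hrem z hz1).1, hz2⟩
  have hpot : c'.pot G s D σ + (entropyPot σ β.W - entropyPot σ (β.volIn r) -
      entropyPot σ (β.volOut r)) ≤ c.pot G s D σ := by
    have hmem : ℓ ∈ Finset.range (c.top + 1) := Finset.mem_range.2 (by omega)
    have e1 : c'.pot G s D σ = ∑ ℓ' ∈ Finset.range (c.top + 1),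
        entropyPot σ (c'.vol G s D (c'.cls ℓ')) +
        entropyPot σ (c'.vol G s D (c'.cls (c.top + 1))) := Finset.sum_range_succ _ _
    have e2 := entropyPot_mono hσ (vol_nonneg hs _ _ _) hnew
    have e3 := entropyPot_mono hσ (vol_nonneg hs _ _ _) hold
    have e4 : ∑ ℓ' ∈ (Finset.range (c.top + 1)).erase ℓ, entropyPot σ (c'.vol G s D (c'.cls ℓ')) ≤
        ∑ ℓ' ∈ (Finset.range (c.top + 1)).erase ℓ, entropyPot σ (c.vol G s D (c.cls ℓ')) := by
      refine Finset.sum_le_sum fun ℓ' hl => entropyPot_mono hσ (vol_nonneg hs _ _ _) ?_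
      obtain ⟨h1, h2⟩ := Finset.mem_erase.1 hl
      exact hother ℓ' (by have := Finset.mem_range.1 h2; omega) h1
    rw [e1, pot, ← Finset.add_sum_erase _ _ hmem, ← Finset.add_sum_erase _ _ hmem, hW]
    linarith
  obtain ⟨-, k1, k2⟩ := scales_spec (β := β) hx hσ r
  have hdrop := entropyPot_drop (m := β.small r) hσ (volIn_nonneg hx r) (volOut_nonneg hx r)
    (volIn_add_volOut_le hx r) rfl k1 k2
  have hcard : (c'.cutSet.card : ℝ) ≤ c.cutSet.card + (β.cutPairs r).card := by
    have hsub : c'.cutSet ⊆ c.cutSet ∪ β.cutPairs r := by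
      intro pq hpq
      rw [Finset.mem_union]
      exact (Finset.mem_filter.1 hpq).2.imp_left fun h => Finset.mem_filter.2 ⟨Finset.mem_univ _, h⟩
    exact_mod_cast (Finset.card_le_card hsub).trans (Finset.card_union_le _ _)
  constructor
  -- A cut pair has an endpoint with exit within `r`, while adding the length leads beyond `r`; so
  -- the length is positive.
  · intro p q hpq
    rcases hpq with hpq | hpq
    · exact h.pos p q hpq
    · obtain ⟨h1, h2, h3⟩ := Finset.mem_filter.1 hpq
      refine ⟨(mem_touch.1 h1).1.1, ?_⟩
      have h3 : ¬ (e p + s.y B p + answerX G s p q ≤ r ∨ e q + s.y B q + answerX G s p q ≤ r) := h3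
      have h2 : ¬ (r < e p + s.y B p ∧ r < e q + s.y B q) := h2
      rw [not_or, not_le, not_le] at h3
      rw [not_and_or, not_lt, not_lt] at h2
      rcases h2 with h2 | h2 <;> linarith
  · have hg1 : (D * (β.cutPairs r).card : ℝ) ≤ 256 * (β.scales r * (l * β.small r)) := hg.1
    have h1 := h.cost
    have hD : (0 : ℝ) ≤ D := Nat.cast_nonneg _
    have hl : (0 : ℝ) ≤ l := Nat.cast_nonneg _
    have h2 := mul_le_mul_of_nonneg_left hcard hD
    have hk : (β.scales r : ℝ) ≤ Λ := by exact_mod_cast hΛ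
    have h3 : 8 * σ * (β.scales r : ℝ) ≤ 8 * σ * Λ := mul_le_mul_of_nonneg_left hk (by positivity)
    have htop : (c'.top : ℝ) = c.top + 1 := by
      change ((c.top + 1 : ℕ) : ℝ) = _
      push_cast; ring
    rw [htop]
    have h4 : (β.scales r : ℝ) * β.small r ≤
        4 * (c.pot G s D σ - c'.pot G s D σ) + 8 * σ * Λ := by linarith
    have h5 := mul_le_mul_of_nonneg_left h4 (by positivity : (0 : ℝ) ≤ 256 * l)
    nlinarith

/-- At the start there is one piece containing every vertex, and its volume is the full scaled sum,
as non-edges count `0`. -/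
theorem CostInv.init {D l Λ : ℕ} {σ : ℝ} :
    CostInv G s D l σ (entropyPot σ (∑ p : Fin n, ∑ q : Fin n, D * answerX G s p q)) Λ
      ⟨fun _ _ => False, ∅, fun _ => 0, 0⟩ := by
  classical
  refine ⟨fun _ _ h => h.elim, ?_⟩
  set c : Conf n := ⟨fun _ _ => False, ∅, fun _ => 0, 0⟩ with hc
  have h1 : c.cutSet = ∅ := by simp [cutSet, hc]
  have h2 : c.pot G s D σ =
      entropyPot σ (∑ p : Fin n, ∑ q : Fin n, D * answerX G s p q) := by
    have : c.vol G s D (c.cls 0) = ∑ p : Fin n, ∑ q : Fin n, D * answerX G s p q := by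
      rw [vol, ← Finset.sum_product']
      refine Finset.sum_subset (Finset.subset_univ _) fun pq _ hpq => ?_
      obtain ⟨p, q⟩ := pq
      have hadj : ¬ G.Adj p q := fun hadj => hpq (mem_touch.2 ⟨⟨hadj, fun h => h⟩,
        Or.inl (mem_cls.2 ⟨by simp [hc], rfl⟩)⟩)
      have : answerX G s p q = 0 := by
        unfold answerX
        rw [dif_pos ⟨p.2, q.2⟩]; exact if_neg hadj
      simp [this]
    change ∑ ℓ ∈ Finset.range 1, _ = _
    rw [Finset.sum_range_one, this]
  rw [h1, h2]
  have : c.top = 0 := rfl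
  simp [this]

end Conf
end OracleRAM

/-! ### The program -/

namespace OracleRAM

/-- Entry `(0, j)` of an array of natural numbers. -/
abbrev NatExpr.vec (a : ℕ) (j : NatExpr) : NatExpr := .get a (.const 0) j

/-- Entry `(0, j)` of an array of reals. -/
abbrev RealExpr.vec (a : ℕ) (j : NatExpr) : RealExpr := .get a (.const 0) j

/-- The expression is nonzero. -/
abbrev Test.nonzero (e : NatExpr) : Test := .not (.natLE e (.const 0))

/-- The expression is zero. -/
abbrev Test.zero (e : NatExpr) : Test := .natLE e (.const 0)

/-- Integer multiples of a real expression. -/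
def RealExpr.scale (e : RealExpr) : ℕ → RealExpr
  | 0 => .ofNat (.const 0)
  | k + 1 => .add (e.scale k) e

@[simp] theorem RealExpr.eval_scale {n : ℕ} {G : SimpleGraph (Fin n)} {s : LPSolution n}
    (M : Memory) (e : RealExpr) (k : ℕ) : (e.scale k).eval G s M = k * e.eval G s M := by
  induction k with
  | zero => simp [scale]
  | succ k ih => simp [scale, ih]; ring

namespace SProg

/-- Sets a scalar. -/
abbrev setN (a : ℕ) (e : NatExpr) : SProg := .setNat a (.const 0) (.const 0) e

/-- Sets a real scalar. -/
abbrev setR (a : ℕ) (e : RealExpr) : SProg := .setReal a (.const 0) (.const 0) e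

/-- Adds to a scalar. -/
abbrev addN (a : ℕ) (e : NatExpr) : SProg := setN a (.add (.var a) e)

/-- Adds to a real scalar. -/
abbrev addR (a : ℕ) (e : RealExpr) : SProg := setR a (.add (.var a) e)

/-- Conditional without alternative. -/
abbrev when (b : Test) (p : SProg) : SProg := .ite b p .skip

/-- Writes to `dst` the number of binary digits of the value of `e`. -/
def sizeProg (dst tmp i : ℕ) (e : NatExpr) : SProg :=
  .seq (.setN tmp (.const 1)) <| .seq (.setN dst (.const 0)) <|
  .forN i (.when (.natLE (.var tmp) e)
    (.seq (.addN tmp (.var tmp)) (.addN dst (.const 1))))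

/-- Computes `K = 1024 b w`. -/
def boundProg : SProg :=
  .forN 22 (.when (.not (.natLE (.var 9) (.var 22)))
    (.forN 23 (.when (.not (.natLE (.get 1 (.const 0) (.const 1)) (.var 23)))
      (.addN 12 (.const 1024)))))

/-- Adds all lengths to the array of scaled lengths. -/
def addLengths : SProg :=
  .forN 25 (.forN 26 (.setReal 0 (.var 25) (.var 26)
    (.add (.get 0 (.var 25) (.var 26)) (.queryX (.var 25) (.var 26)))))

/-- Computes `n ^ 3` and the lengths multiplied by it. -/
def scaleProg : SProg :=
  .forN 22 (.forN 23 (.forN 24 (.seq (.addN 13 (.const 1)) addLengths)))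

/-- Computes the sum of the lengths of all pairs, or `1` if it vanishes. -/
def totalProg : SProg :=
  .seq (.forN 22 (.forN 23 (.addR 2 (.queryX (.var 22) (.var 23)))))
    (.when (.realLE (.var 2) (.ofNat (.const 0))) (.setR 2 (.ofNat (.const 1))))

/-- Computes the boundary of the piece with the label of vertex `20`. -/
def boundaryProg : SProg :=
  .forN 22 (.seq (.setNat 5 (.const 0) (.var 22) (.const 0))
    (.forN 23 (.when
      (.and (.nonzero (.vec 3 (.var 22))) <| .and (.zero (.vec 3 (.var 23))) <|
        .and (.and (.natLE (.vec 4 (.var 23)) (.var 15)) (.natLE (.var 15) (.vec 4 (.var 23)))) <|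
        .and (.nonzero (.get 0 (.var 23) (.var 22))) (.zero (.get 2 (.var 23) (.var 22))))
      (.setNat 5 (.const 0) (.var 22) (.const 1)))))

/-- Counts the boundary. -/
def countProg : SProg :=
  .seq (.setN 14 (.const 0)) <|
  .forN 22 (.when (.nonzero (.vec 5 (.var 22))) (.addN 14 (.const 1)))

/-- Initializes the set of vertices to be treated. -/
def activeProg : SProg :=
  .forN 22 (.ite
    (.not (.and (.zero (.vec 5 (.var 22))) (.not (.and (.zero (.vec 3 (.var 22)))
      (.and (.natLE (.vec 4 (.var 22)) (.var 15)) (.natLE (.var 15) (.vec 4 (.var 22))))))))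
    (.setNat 6 (.const 0) (.var 22) (.const 1)) (.setNat 6 (.const 0) (.var 22) (.const 0)))

/-- Exit distance of a vertex. -/
abbrev exitDist (z : NatExpr) : RealExpr := .add (.vec 1 z) (.queryY 5 (.const 0) z)

/-- Computes the entry distances from vertex `21`. -/
def distProg : SProg :=
  .seq (.forN 22 (.setReal 1 (.const 0) (.var 22) (.ofNat (.const 1)))) <|
  .seq (.setReal 1 (.const 0) (.var 21) (.ofNat (.const 0))) <|
  .forN 22 (.forN 23 (.forN 24 (.when
    (.and (.nonzero (.get 0 (.var 23) (.var 24)))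
      (.realLE (.add (exitDist (.var 23)) (.queryX (.var 23) (.var 24))) (.vec 1 (.var 24))))
    (.setReal 1 (.const 0) (.var 24)
      (.add (exitDist (.var 23)) (.queryX (.var 23) (.var 24)))))))

/-- The pair may be cut. -/
def touchTest (p q : NatExpr) : Test :=
  .and (.nonzero (.get 0 p q)) <| .and (.zero (.get 2 p q)) <|
  .not (.and (.not (.and (.nonzero (.vec 6 p)) (.zero (.vec 5 p))))
    (.not (.and (.nonzero (.vec 6 q)) (.zero (.vec 5 q)))))

/-- The pair is outside the ball of radius `3`. -/
def outsideTest (p q : NatExpr) : Test :=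
  .and (.not (.realLE (exitDist p) (.var 3))) (.not (.realLE (exitDist q) (.var 3)))

/-- The pair is inside the ball of radius `3`. -/
def insideTest (p q : NatExpr) : Test :=
  .not (.and (.not (.realLE (.add (exitDist p) (.queryX p q)) (.var 3)))
    (.not (.realLE (.add (exitDist q) (.queryX p q)) (.var 3))))

/-- Computes the volumes and the number of pairs cut. -/
def pairSums : SProg :=
  .seq (.setR 5 (.ofNat (.const 0))) <| .seq (.setR 6 (.ofNat (.const 0))) <|
  .seq (.setR 7 (.ofNat (.const 0))) <| .seq (.setN 16 (.const 0)) <|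
  .forN 24 (.forN 25 (.when (touchTest (.var 24) (.var 25)) <|
    .seq (.addR 5 (.get 0 (.var 24) (.var 25))) <|
    .ite (outsideTest (.var 24) (.var 25)) (.addR 7 (.get 0 (.var 24) (.var 25))) <|
    .ite (insideTest (.var 24) (.var 25)) (.addR 6 (.get 0 (.var 24) (.var 25))) <|
    .addN 16 (.var 13)))

/-- Computes the vertex volume and the number of vertices cut. -/
def vertSums : SProg :=
  .seq (.setR 11 (.ofNat (.const 0))) <| .seq (.setN 17 (.const 0)) <|
  .forN 24 (.when (.and (.nonzero (.vec 6 (.var 24))) (.realLE (.vec 1 (.var 24)) (.var 3))) <|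
    .seq (.addR 11 (.queryY 5 (.const 0) (.var 24))) <|
    .when (.not (.realLE (exitDist (.var 24)) (.var 3))) (.addN 17 (.const 1)))

/-- Computes the volume of the smaller side, and multiples. -/
def multProg : SProg :=
  .seq (.ite (.realLE (.var 6) (.var 7))
    (.setR 8 (.add (.sub (.var 5) (.var 7)) (.var 2)))
    (.setR 8 (.add (.sub (.var 5) (.var 6)) (.var 2)))) <|
  .seq (.setR 13 (.ofNat (.const 0))) <| .seq (.setR 12 (.ofNat (.const 0))) <|
  .forN 24 (.seq
    (.when (.not (.natLE (.var 11) (.var 24))) (.addR 13 (.var 8)))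
    (.when (.not (.natLE (.var 9) (.var 24))) (.addR 12 (.var 11))))

/-- Computes the multiple given by the number of scales. -/
def scalesProg : SProg :=
  .seq (.setR 9 (.var 8)) <| .seq (.setR 10 (.ofNat (.const 0))) <|
  .forN 24 (.when (.realLE (.var 9) (.add (.var 5) (.var 2)))
    (.seq (.setR 9 ((RealExpr.var 9).scale 16)) (.addR 10 (.var 13))))

/-- Tests the radius `3`, unless a good radius has been found. -/
def testProg : SProg :=
  .when (.and (.zero (.var 18)) (.not (.realLE (.ofNat (.const 1)) ((RealExpr.var 3).scale 4)))) <|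
  .seq pairSums <| .seq vertSums <| .seq multProg <| .seq scalesProg <|
  .when (.and (.realLE (.ofNat (.var 16)) ((RealExpr.var 10).scale 256))
    (.realLE ((RealExpr.ofNat (.var 17)).scale 9)
      (.add ((RealExpr.var 12).scale 1024) (.ofNat (.const 1)))))
    (.seq (.setN 18 (.const 1)) (.setR 4 (.var 3)))

/-- Searches for a good radius. -/
def searchProg : SProg :=
  .seq (.setN 18 (.const 0)) <| .seq (.setR 4 (.ofNat (.const 0))) <|
  .seq (.forN 22 (.forN 23 (.seq
    (.seq (.setR 3 (.vec 1 (.var 22))) testProg)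
    (.seq (.setR 3 (.add (exitDist (.var 22)) (.queryX (.var 22) (.var 23)))) testProg)))) <|
  .setR 3 (.var 4)

/-- Cuts pairs. -/
def cutProg : SProg :=
  .forN 22 (.forN 23 (.when
    (.and (touchTest (.var 22) (.var 23)) (.and (.not (outsideTest (.var 22) (.var 23)))
      (.not (insideTest (.var 22) (.var 23)))))
    (.setNat 2 (.var 22) (.var 23) (.const 1))))

/-- Separates the ball from the rest of the piece. -/
def relabelProg : SProg :=
  .seq (.addN 7 (.const 1)) <|
  .forN 22 (.when (.and (.nonzero (.vec 6 (.var 22))) (.realLE (.vec 1 (.var 22)) (.var 3))) <|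
    .seq (.setNat 6 (.const 0) (.var 22) (.const 0)) <|
    .when (.zero (.vec 5 (.var 22))) <|
    .ite (.realLE (exitDist (.var 22)) (.var 3)) (.setNat 4 (.const 0) (.var 22) (.var 7))
      (.setNat 3 (.const 0) (.var 22) (.const 1)))

/-- Cuts out a ball around vertex `21`. -/
def ballProg : SProg := .seq distProg <| .seq searchProg <| .seq cutProg relabelProg

/-- Cuts out balls around all boundary vertices. -/
def phaseProg : SProg :=
  .seq activeProg <|
  .forN 21 (.when (.and (.nonzero (.vec 6 (.var 21))) (.nonzero (.vec 5 (.var 21)))) ballProg)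

/-- Removes vertex `20` and separates its piece if the boundary is large. -/
def stepProg : SProg :=
  .seq (.setN 15 (.vec 4 (.var 20))) <| .seq boundaryProg <| .seq countProg <|
  .seq (.setNat 3 (.const 0) (.var 20) (.const 1)) <|
  .when (.natLE (.var 12) (.var 14)) phaseProg

/-- Initialization. -/
def setupProg : SProg :=
  .seq (sizeProg 9 8 22 (.get 1 (.const 0) (.const 1))) <| .seq (sizeProg 10 8 22 (.var 1)) <|
  .seq (sizeProg 11 8 22 (.var 10)) <| .seq boundProg <| .seq scaleProg totalProg

/-- The program. -/
def mainProg : SProg :=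
  .when (.not (.natLE (.var 1) (.get 1 (.const 0) (.const 1)))) <|
  .seq setupProg (.forN 20 (.when (.zero (.vec 3 (.var 20))) stepProg))

/-- Memory layout, natural numbers: `0` adjacency, `1` input sizes, `2` cut pairs, `3` removed
vertices, `4` labels, `5` boundary `B`, `6` active set, `7` largest label, `9`, `10`, `11` the digit
counts of `w`, of `n` and of the latter, `12` the bound `K`, `13` the cube `n³`, `14` the size of
`B`, `15` the current label, `16` to `18` search results, `20` to `26` counters. Reals: `0` scaled
lengths, `1` entry distances, `2` the seed `σ`, `3` and `4` radii, `5` to `13` volumes and their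
multiples. -/
theorem mainProg_wf : mainProg.WF ∧ 1 ∉ mainProg.natWrites := by decide

end SProg
end OracleRAM

/-! ### The memory after initialization -/

namespace OracleRAM

variable {n : ℕ} {G : SimpleGraph (Fin n)} {s : LPSolution n} {w : ℕ}

namespace SProg

/-- The array `tmp` holds a power of two that is doubled as long as it does not exceed `N`, and
`dst` counts the doublings. Since `N < 2 ^ n`, the `n` rounds are enough. -/
theorem sizeProg_spec {dst tmp i : ℕ} {e : NatExpr} {M : Memory} {N : ℕ} (h1 : dst ≠ tmp)
    (h2 : dst ≠ i) (h3 : tmp ≠ i)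
    (he : ∀ M' : Memory, (∀ a, a ≠ dst → a ≠ tmp → a ≠ i → M'.nat a = M.nat a) → e.eval M' = N)
    (hN : N < 2 ^ n) :
    ∃ d, ((sizeProg dst tmp i e).den G s M).nat dst 0 0 = d ∧ d ≤ n ∧ N < 2 ^ d ∧
      (d = 0 ∨ 2 ^ (d - 1) ≤ N) := by
  set M₁ := ((setN tmp (.const 1)).seq (setN dst (.const 0))).den G s M with hM₁
  have hmain := forN_inv (G := G) (s := s) (n := n) (i := i) (M := M₁)
    (p := .when (.natLE (.var tmp) e) (.seq (.addN tmp (.var tmp)) (.addN dst (.const 1))))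
    (fun j M' => (∀ a, a ≠ dst → a ≠ tmp → a ≠ i → M'.nat a = M.nat a) ∧
      M'.nat tmp 0 0 = 2 ^ (M'.nat dst 0 0) ∧ M'.nat dst 0 0 ≤ j ∧
      (M'.nat dst 0 0 = 0 ∨ 2 ^ (M'.nat dst 0 0 - 1) ≤ N) ∧ (M'.nat dst 0 0 = j ∨ N < 2 ^ M'.nat dst 0 0))
    ?_ ?_ ?_
  · obtain ⟨-, -, h4, h5, h6⟩ := hmain
    refine ⟨_, rfl, h4, ?_, h5⟩
    rcases h6 with h6 | h6
    · have h6' : ((sizeProg dst tmp i e).den G s M).nat dst 0 0 = n := h6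
      rw [h6']; exact hN
    · exact h6
  · rintro j k M' ⟨h4, h5, h6, h7, h8⟩
    refine ⟨fun a ha hb hc => ?_, ?_⟩
    · rw [writeNat_nat_of_ne hc]; exact h4 a ha hb hc
    · rw [writeNat_nat_of_ne h2, writeNat_nat_of_ne h3]
      exact ⟨h5, h6, h7, h8⟩
  · refine ⟨fun a ha hb hc => ?_, ?_⟩
    · rw [hM₁, den_seq, den_setNat, den_setNat, writeNat_nat_of_ne ha, writeNat_nat_of_ne hb]
    · simp [hM₁, Ne.symm h1]
  · rintro j M' hj - - - ⟨h4, h5, h6, h7, h8⟩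
    have hev := he M' h4
    rw [den_ite]
    split_ifs with hle
    · simp only [Test.Holds, hev, NatExpr.eval] at hle
      rw [h5] at hle
      have hdj : M'.nat dst 0 0 = j := h8.resolve_right (by omega)
      refine ⟨fun a ha hb hc => ?_, ?_⟩
      · rw [den_seq, den_setNat, den_setNat, writeNat_nat_of_ne ha, writeNat_nat_of_ne hb]
        exact h4 a ha hb hc
      · simp only [den_seq, den_setNat, NatExpr.eval, writeNat_nat, h1, Ne.symm h1, false_and,
          if_false, and_self, if_true]
        refine ⟨by rw [h5, pow_succ]; ring, by omega, Or.inr (by simpa using hle), by omega⟩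
    · simp only [Test.Holds, hev, NatExpr.eval] at hle
      rw [h5] at hle
      exact ⟨h4, h5, by rw [den_skip]; omega, h7, Or.inr (by rw [den_skip]; omega)⟩

/-- There is no multiplication, so the product is a double loop of additions. Loops have length `n`,
which is why `b` and `w` must not exceed `n`; the minima in the invariants express this truncation.
-/
theorem boundProg_spec {M : Memory} {b : ℕ} (hb : M.nat 9 0 0 = b) (hw : M.nat 1 0 1 = w)
    (hbn : b ≤ n) (hwn : w ≤ n) (h0 : M.nat 12 0 0 = 0) :
    (boundProg.den G s M).nat 12 0 0 = 1024 * (b * w) := by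
  have inner : ∀ M₁ : Memory, M₁.nat 1 0 1 = w →
      ((forN 23 (.when (.not (.natLE (.get 1 (.const 0) (.const 1)) (.var 23)))
      (.addN 12 (.const 1024)))).den G s M₁).nat 12 0 0 = M₁.nat 12 0 0 + 1024 * w := by
    intro M₁ h1
    have := forN_inv (G := G) (s := s) (n := n) (i := 23) (M := M₁)
      (p := .when (.not (.natLE (.get 1 (.const 0) (.const 1)) (.var 23))) (.addN 12 (.const 1024)))
      (fun j M' => M'.nat 12 0 0 = M₁.nat 12 0 0 + 1024 * min j w) ?_ ?_ ?_
    · rw [this, min_eq_right hwn]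
    · intro j k M' h; simpa using h
    · simp
    · intro j M' hj hi hN _ h
      have e1 := hN 1 (by decide)
      simp only [den_ite, Test.Holds, NatExpr.eval, hi, e1, h1]
      split_ifs with hc
      · rw [den_skip, h]; omega
      · simp only [den_setNat, NatExpr.eval, writeNat_nat, and_self, if_true, h]; omega
  have := forN_inv (G := G) (s := s) (n := n) (i := 22) (M := M)
    (p := .when (.not (.natLE (.var 9) (.var 22)))
      (.forN 23 (.when (.not (.natLE (.get 1 (.const 0) (.const 1)) (.var 23)))
      (.addN 12 (.const 1024)))))
    (fun j M' => M'.nat 12 0 0 = 1024 * (min j b * w)) ?_ ?_ ?_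
  · exact this.trans (by rw [min_eq_right hbn])
  · intro j k M' h; simpa using h
  · simpa using h0
  · intro j M' hj hi hN _ h
    have e1 := hN 1 (by decide)
    have e9 := hN 9 (by decide)
    simp only [den_ite, Test.Holds, NatExpr.eval, hi, e9, hb]
    split_ifs with hc
    · rw [den_skip, h, show min (j + 1) b = min j b by omega]
    · rw [inner M' (by rw [e1, hw]), h, show min (j + 1) b = j + 1 by omega,
        show min j b = j by omega]; ring

theorem addLengths_spec (M : Memory) (p q : ℕ) :
    (addLengths.den G s M).real 0 p q = M.real 0 p q + answerX G s p q := by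
  have inner : ∀ (M₁ : Memory) (p q : ℕ), ((forN 26 (.setReal 0 (.var 25) (.var 26)
      (.add (.get 0 (.var 25) (.var 26)) (.queryX (.var 25) (.var 26))))).den G s M₁).real 0 p q =
      if p = M₁.nat 25 0 0 then M₁.real 0 p q + answerX G s p q else M₁.real 0 p q := by
    intro M₁ p q
    have := forN_inv (G := G) (s := s) (n := n) (i := 26) (M := M₁)
      (p := .setReal 0 (.var 25) (.var 26)
        (.add (.get 0 (.var 25) (.var 26)) (.queryX (.var 25) (.var 26))))
      (fun j M' => ∀ p q, M'.real 0 p q = if p = M₁.nat 25 0 0 ∧ q < j then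
        M₁.real 0 p q + answerX G s p q else M₁.real 0 p q) ?_ ?_ ?_
    · rw [this]
      by_cases hq : q < n
      · simp [hq]
      · have : answerX G s p q = 0 := by
          unfold answerX; rw [dif_neg (by omega)]
        simp [hq, this]
    · intro j k M' h; simpa using h
    · simp
    · intro j M' hj hi hN _ h p q
      have e1 := hN 25 (by decide)
      simp only [den_setReal, NatExpr.eval, RealExpr.eval, writeReal_real, e1, hi, true_and]
      by_cases hp : p = M₁.nat 25 0 0
      · by_cases hq : q = j
        · subst hq; subst hp; simp [h]
        · rw [if_neg (by tauto), h]
          exact if_congr (by omega) rfl rfl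
      · rw [if_neg (by tauto), h]; simp [hp]
  have := forN_inv (G := G) (s := s) (n := n) (i := 25) (M := M)
    (p := .forN 26 (.setReal 0 (.var 25) (.var 26)
      (.add (.get 0 (.var 25) (.var 26)) (.queryX (.var 25) (.var 26)))))
    (fun j M' => ∀ p q, M'.real 0 p q = if p < j then
        M.real 0 p q + answerX G s p q else M.real 0 p q) ?_ ?_ ?_
  · refine (this p q).trans ?_
    by_cases hp : p < n
    · simp [hp]
    · have : answerX G s p q = 0 := by
        unfold answerX; rw [dif_neg (by omega)]
      simp [hp, this]
  · intro j k M' h; simpa using h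
  · simp
  · intro j M' hj hi hN _ h p q
    rw [inner, hi, h]
    by_cases hp : p = j
    · subst hp; simp
    · rw [if_neg hp]; exact if_congr (by omega) rfl rfl

theorem scaleProg_spec {M : Memory} (h13 : M.nat 13 0 0 = 0) (h0 : ∀ p q, M.real 0 p q = 0) :
    (scaleProg.den G s M).nat 13 0 0 = n ^ 3 ∧
      ∀ p q, (scaleProg.den G s M).real 0 p q = (n ^ 3 : ℕ) * answerX G s p q := by
  -- Wrapping a loop around a body that adds `k` copies of every length yields a body that adds `n
  -- k` copies. Three applications give `n³`.
  have rule : ∀ (i : ℕ) (P : SProg) (k : ℕ), i ≠ 13 →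
      (∀ M' : Memory, (P.den G s M').nat 13 0 0 = M'.nat 13 0 0 + k ∧
        ∀ p q, (P.den G s M').real 0 p q = M'.real 0 p q + k * answerX G s p q) →
      ∀ M' : Memory, ((forN i P).den G s M').nat 13 0 0 = M'.nat 13 0 0 + (n * k : ℕ) ∧
        ∀ p q, ((forN i P).den G s M').real 0 p q = M'.real 0 p q + (n * k : ℕ) * answerX G s p q := by
    intro i P k hi hP M'
    refine forN_inv (G := G) (s := s) (n := n) (i := i) (M := M') (p := P)
      (fun j M'' => M''.nat 13 0 0 = M'.nat 13 0 0 + (j * k : ℕ) ∧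
        ∀ p q, M''.real 0 p q = M'.real 0 p q + (j * k : ℕ) * answerX G s p q) ?_ ?_ ?_
    · intro j k M' h; simpa [Ne.symm hi] using h
    · simp
    · intro j M'' _ _ _ _ h
      refine ⟨?_, fun p q => ?_⟩
      · rw [(hP M'').1, h.1]; ring
      · rw [(hP M'').2, h.2]; push_cast; ring
  have h1 := rule 24 (.seq (.addN 13 (.const 1)) addLengths) 1 (by decide) (fun M' => by
    refine ⟨?_, fun p q => ?_⟩
    · rw [den_seq, den_nat addLengths (by decide)]; simp
    · rw [den_seq, addLengths_spec]; simp)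
  have h2 := rule 23 _ _ (by decide) h1
  have h3 := rule 22 _ _ (by decide) h2 M
  refine ⟨h3.1.trans (by rw [h13]; ring), fun p q => (h3.2 p q).trans ?_⟩
  rw [h0]; push_cast; ring

/-- The total length serves as the seed and must be positive, so it is replaced by `1` when the sum
vanishes. -/
theorem totalProg_spec {M : Memory} (h2 : M.real 2 0 0 = 0) :
    (totalProg.den G s M).real 2 0 0 =
      if ∑ p : Fin n, ∑ q : Fin n, answerX G s p q ≤ 0 then 1
        else ∑ p : Fin n, ∑ q : Fin n, answerX G s p q := by
  have inner : ∀ M₁ : Memory, ((forN 23 (.addR 2 (.queryX (.var 22) (.var 23)))).den G s M₁).real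
      2 0 0 = M₁.real 2 0 0 + ∑ q ∈ Finset.range n, answerX G s (M₁.nat 22 0 0) q := by
    intro M₁
    refine forN_inv (G := G) (s := s) (n := n) (i := 23) (M := M₁)
      (p := .addR 2 (.queryX (.var 22) (.var 23)))
      (fun j M' => M'.real 2 0 0 = M₁.real 2 0 0 +
        ∑ q ∈ Finset.range j, answerX G s (M₁.nat 22 0 0) q) ?_ ?_ ?_
    · intro j k M' h; simpa using h
    · simp
    · intro j M' hj hi hN _ h
      have e1 := hN 22 (by decide)
      simp only [den_setReal, NatExpr.eval, RealExpr.eval, writeReal_real, and_self, if_true, e1, hi,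
        h, Finset.sum_range_succ]
      ring
  have outer : ((forN 22 (.forN 23 (.addR 2 (.queryX (.var 22) (.var 23))))).den G s M).real 2 0 0 =
      ∑ p ∈ Finset.range n, ∑ q ∈ Finset.range n, answerX G s p q := by
    refine forN_inv (G := G) (s := s) (n := n) (i := 22) (M := M)
      (p := .forN 23 (.addR 2 (.queryX (.var 22) (.var 23))))
      (fun j M' => M'.real 2 0 0 = ∑ p ∈ Finset.range j, ∑ q ∈ Finset.range n, answerX G s p q)
      ?_ ?_ ?_
    · intro j k M' h; simpa using h
    · simpa using h2
    · intro j M' hj hi hN _ h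
      rw [inner, hi, h, Finset.sum_range_succ]
  simp only [Finset.sum_range] at outer
  simp only [totalProg, den_seq, den_ite, Test.Holds, RealExpr.eval, NatExpr.eval, outer,
    Nat.cast_zero]
  split_ifs with h
  · simp
  · simpa using outer

/-- The parameters computed by the initialization. -/
structure Params (G : SimpleGraph (Fin n)) (s : LPSolution n) (w b l : ℕ) (σ : ℝ) (M : Memory) :
    Prop where
  adj : ∀ p q, M.nat 0 p q ≠ 0 ↔ AdjN G p q
  bits : M.nat 9 0 0 = b
  loglog : M.nat 11 0 0 = l
  bound : M.nat 12 0 0 = 1024 * (b * w)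
  cube : M.nat 13 0 0 = n ^ 3
  len : ∀ p q, M.real 0 p q = (n ^ 3 : ℕ) * answerX G s p q
  total : M.real 2 0 0 = σ

theorem setupProg_spec (hwn : w < n) : ∃ b l₁ l : ℕ,
    Params G s w b l (if ∑ p : Fin n, ∑ q : Fin n, answerX G s p q ≤ 0 then 1
        else ∑ p : Fin n, ∑ q : Fin n, answerX G s p q) (setupProg.den G s (input G w)) ∧
      (b ≤ n ∧ w < 2 ^ b ∧ (b = 0 ∨ 2 ^ (b - 1) ≤ w)) ∧
      (n < 2 ^ l₁ ∧ (l₁ = 0 ∨ 2 ^ (l₁ - 1) ≤ n)) ∧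
      (l ≤ n ∧ l₁ < 2 ^ l ∧ (l = 0 ∨ 2 ^ (l - 1) ≤ l₁)) := by
  set M₀ := input G w with hM₀
  have i0 : ∀ p q, M₀.nat 0 p q ≠ 0 ↔ AdjN G p q := by
    intro p q
    simp only [hM₀, input, if_true]
    unfold AdjN
    split_ifs with h
    · exact ⟨fun _ => h, fun _ => one_ne_zero⟩
    · exact ⟨fun h' => absurd rfl h', fun h' => absurd h' h⟩
  have i1 : M₀.nat 1 0 0 = n := by simp [hM₀, input]
  have i1' : M₀.nat 1 0 1 = w := by simp [hM₀, input]
  have i12 : M₀.nat 12 0 0 = 0 := by simp [hM₀, input]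
  have i13 : M₀.nat 13 0 0 = 0 := by simp [hM₀, input]
  obtain ⟨b, hb, hbn, hb1, hb2⟩ := sizeProg_spec (n := n) (G := G) (s := s) (dst := 9) (tmp := 8)
    (i := 22) (e := .get 1 (.const 0) (.const 1)) (M := M₀) (N := w) (by decide) (by decide)
    (by decide) (fun M' h => by simp [h 1 (by decide) (by decide) (by decide), i1']) (hwn.trans Nat.lt_two_pow_self)
  set M₁ := (sizeProg 9 8 22 (.get 1 (.const 0) (.const 1))).den G s M₀ with hM₁
  have f1 : ∀ a, a ∉ (sizeProg 9 8 22 (.get 1 (.const 0) (.const 1))).natWrites →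
    M₁.nat a = M₀.nat a := fun a ha => den_nat _ ha _
  obtain ⟨l₁, hl1, hl1n, hl11, hl12⟩ := sizeProg_spec (n := n) (G := G) (s := s) (dst := 10) (tmp := 8)
    (i := 22) (e := .var 1) (M := M₁) (N := n) (by decide) (by decide)
    (by decide) (fun M' h => by simp [h 1, f1 1 (by decide), i1]) Nat.lt_two_pow_self
  set M₂ := (sizeProg 10 8 22 (.var 1)).den G s M₁ with hM₂
  have f2 : ∀ a, a ∉ (sizeProg 10 8 22 (.var 1)).natWrites → M₂.nat a = M₁.nat a :=
    fun a ha => den_nat _ ha _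
  obtain ⟨l, hl, hln, hl3, hl4⟩ := sizeProg_spec (n := n) (G := G) (s := s) (dst := 11) (tmp := 8)
    (i := 22) (e := .var 10) (M := M₂) (N := l₁) (by decide) (by decide)
    (by decide) (fun M' h => by simp [h 10, hl1]) (hl1n.trans_lt Nat.lt_two_pow_self)
  set M₃ := (sizeProg 11 8 22 (.var 10)).den G s M₂ with hM₃
  have f3 : ∀ a, a ∉ (sizeProg 11 8 22 (.var 10)).natWrites → M₃.nat a = M₂.nat a :=
    fun a ha => den_nat _ ha _
  have hK := boundProg_spec (n := n) (G := G) (s := s) (w := w) (M := M₃) (b := b)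
    (by rw [f3 9 (by decide), f2 9 (by decide), hb])
    (by rw [f3 1 (by decide), f2 1 (by decide), f1 1 (by decide), i1']) hbn hwn.le
    (by rw [f3 12 (by decide), f2 12 (by decide), f1 12 (by decide), i12])
  set M₄ := boundProg.den G s M₃ with hM₄
  have f4 : ∀ a, a ∉ boundProg.natWrites → M₄.nat a = M₃.nat a := fun a ha => den_nat _ ha _
  have r4 : M₄.real = M₀.real := by
    funext a
    rw [hM₄, den_real _ (by simp [boundProg, realWrites]), hM₃, den_real _ (by simp [sizeProg, realWrites]),
      hM₂, den_real _ (by simp [sizeProg, realWrites]), hM₁, den_real _ (by simp [sizeProg, realWrites])]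
  obtain ⟨hD, hxs⟩ := scaleProg_spec (n := n) (G := G) (s := s) (M := M₄)
    (by rw [f4 13 (by decide), f3 13 (by decide), f2 13 (by decide), f1 13 (by decide), i13])
    (fun p q => by rw [r4]; rfl)
  set M₅ := scaleProg.den G s M₄ with hM₅
  have f5 : ∀ a, a ∉ scaleProg.natWrites → M₅.nat a = M₄.nat a := fun a ha => den_nat _ ha _
  have htot := totalProg_spec (n := n) (G := G) (s := s) (M := M₅)
    (by rw [hM₅, den_real _ (by decide), r4]; rfl)
  have hM₆ : setupProg.den G s M₀ = totalProg.den G s M₅ := rfl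
  have f6 : ∀ a, a ∉ totalProg.natWrites → (totalProg.den G s M₅).nat a = M₅.nat a :=
    fun a ha => den_nat _ ha _
  refine ⟨b, l₁, l, ?_, ⟨hbn, hb1, hb2⟩, ⟨hl11, hl12⟩, ⟨hln, hl3, hl4⟩⟩
  rw [hM₆]
  constructor
  · intro p q
    rw [f6 0 (by decide), f5 0 (by decide), f4 0 (by decide), f3 0 (by decide), f2 0 (by decide),
      f1 0 (by decide), i0]
  · rw [f6 9 (by decide), f5 9 (by decide), f4 9 (by decide), f3 9 (by decide), f2 9 (by decide), hb]
  · rw [f6 11 (by decide), f5 11 (by decide), f4 11 (by decide), hl]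
  · rw [f6 12 (by decide), f5 12 (by decide), hK]
  · rw [f6 13 (by decide), hD]
  · intro p q
    rw [den_real _ (by decide), hxs]
  · exact htot

end SProg
end OracleRAM

/-! ### Computing distances -/

namespace OracleRAM

variable {n : ℕ} {G : SimpleGraph (Fin n)} {s : LPSolution n} {w : ℕ}

theorem rowSet_congr {M M' : Memory} {a : ℕ} (h : M'.nat a = M.nat a) (i : ℕ) :
    M'.rowSet n a i = M.rowSet n a i := by
  unfold Memory.rowSet; rw [h]

theorem mem_rowSet {M : Memory} {a i : ℕ} {z : Fin n} : z ∈ M.rowSet n a i ↔ M.nat a i z ≠ 0 := by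
  simp [Memory.rowSet]

namespace SProg

/-- One relaxation. -/
abbrev relaxProg : SProg := .when
  (.and (.nonzero (.get 0 (.var 23) (.var 24)))
    (.realLE (.add (exitDist (.var 23)) (.queryX (.var 23) (.var 24))) (.vec 1 (.var 24))))
  (.setReal 1 (.const 0) (.var 24) (.add (exitDist (.var 23)) (.queryX (.var 23) (.var 24))))

theorem relaxProg_spec {M : Memory} (hadj : ∀ p q, M.nat 0 p q ≠ 0 ↔ AdjN G p q) :
    (relaxProg.den G s M).real 1 0 = relax (AdjN G) (stepLen G s (M.rowSet n 5 0))
      (M.nat 23 0 0) (M.nat 24 0 0) (M.real 1 0) := by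
  have h1 : ((Test.and (.nonzero (.get 0 (.var 23) (.var 24)))
      (.realLE (.add (exitDist (.var 23)) (.queryX (.var 23) (.var 24))) (.vec 1 (.var 24)))).Holds
        G s M) ↔ (AdjN G (M.nat 23 0 0) (M.nat 24 0 0) ∧ M.real 1 0 (M.nat 23 0 0) +
          stepLen G s (M.rowSet n 5 0) (M.nat 23 0 0) (M.nat 24 0 0) ≤
            M.real 1 0 (M.nat 24 0 0)) := by
    simp only [Test.Holds, NatExpr.eval, RealExpr.eval, ← hadj, stepLen, add_assoc,
      Nat.le_zero, ne_eq]
  rw [den_ite, relax]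
  by_cases h : AdjN G (M.nat 23 0 0) (M.nat 24 0 0) ∧ M.real 1 0 (M.nat 23 0 0) +
      stepLen G s (M.rowSet n 5 0) (M.nat 23 0 0) (M.nat 24 0 0) ≤ M.real 1 0 (M.nat 24 0 0)
  · rw [if_pos (h1.2 h), if_pos h]
    funext z
    simp only [den_setReal, writeReal_real, NatExpr.eval, RealExpr.eval, true_and,
      Function.update_apply, stepLen, add_assoc]
  · rw [if_neg fun h' => h (h1.1 h'), if_neg h, den_skip]

/-- Distances are taken in the whole graph `G`, not in the remaining one, since the LP speaks of
paths in `G`. All values start at `1`, so distances come out truncated there. -/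
theorem distProg_spec (hs : s.Feasible G w) {M : Memory}
    (hadj : ∀ p q, M.nat 0 p q ≠ 0 ↔ AdjN G p q) {u : Fin n} (hu : M.nat 21 0 0 = u) :
    EntryDist G s (M.rowSet n 5 0) u fun z => (distProg.den G s M).real 1 0 z := by
  set S := M.rowSet n 5 0 with hS
  have hc : ∀ p q, 0 ≤ stepLen G s S p q := fun p q =>
    add_nonneg (answerY_nonneg hs _ _) (answerX_nonneg hs _ _)
  have hA : ∀ p q, AdjN G p q → p < n ∧ q < n := fun p q h => h.lt
  have inner : ∀ (M₁ : Memory) (it : ℕ), M₁.nat 0 = M.nat 0 → M₁.nat 5 = M.nat 5 →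
      WalkInv G s S u (M₁.real 1 0) ∧
        RoundInv n (AdjN G) (stepLen G s S) it (M₁.nat 23 0 0) 0 (M₁.real 1 0) →
      WalkInv G s S u (((forN 24 relaxProg).den G s M₁).real 1 0) ∧
        RoundInv n (AdjN G) (stepLen G s S) it (M₁.nat 23 0 0) n
          (((forN 24 relaxProg).den G s M₁).real 1 0) := by
    intro M₁ it h0 h5 hI
    refine forN_inv (G := G) (s := s) (n := n) (i := 24) (M := M₁) (p := relaxProg)
      (fun j M' => WalkInv G s S u (M'.real 1 0) ∧
        RoundInv n (AdjN G) (stepLen G s S) it (M₁.nat 23 0 0) j (M'.real 1 0)) ?_ hI ?_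
    · intro j k M' h; exact h
    · intro j M' hj hi hN _ h
      rw [relaxProg_spec (by rw [hN 0 (by decide), h0]; exact hadj),
        rowSet_congr ((hN 5 (by decide)).trans h5), hN 23 (by decide), hi]
      exact ⟨h.1.relax hs _ _, h.2.relax hc hA⟩
  have middle : ∀ (M₁ : Memory) (it : ℕ), M₁.nat 0 = M.nat 0 → M₁.nat 5 = M.nat 5 →
      WalkInv G s S u (M₁.real 1 0) ∧
        RoundInv n (AdjN G) (stepLen G s S) it 0 0 (M₁.real 1 0) →
      WalkInv G s S u (((forN 23 (forN 24 relaxProg)).den G s M₁).real 1 0) ∧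
        RoundInv n (AdjN G) (stepLen G s S) it n 0
          (((forN 23 (forN 24 relaxProg)).den G s M₁).real 1 0) := by
    intro M₁ it h0 h5 hI
    refine forN_inv (G := G) (s := s) (n := n) (i := 23) (M := M₁) (p := forN 24 relaxProg)
      (fun j M' => WalkInv G s S u (M'.real 1 0) ∧
        RoundInv n (AdjN G) (stepLen G s S) it j 0 (M'.real 1 0)) ?_ hI ?_
    · intro j k M' h; exact h
    · intro j M' hj hi hN _ h
      have := inner M' it ((hN 0 (by decide)).trans h0) ((hN 5 (by decide)).trans h5)
        (by rw [hi]; exact h)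
      rw [hi] at this
      exact ⟨this.1, this.2.nextRow hA⟩
  set M₁ := (forN 22 (.setReal 1 (.const 0) (.var 22) (.ofNat (.const 1)))).den G s M with hM₁
  have hinit : ∀ z < n, M₁.real 1 0 z = 1 := by
    refine forN_inv (G := G) (s := s) (n := n) (i := 22) (M := M)
      (p := .setReal 1 (.const 0) (.var 22) (.ofNat (.const 1)))
      (fun j M' => ∀ z < j, M'.real 1 0 z = 1) ?_ ?_ ?_
    · intro j k M' h; exact h
    · intro z hz; omega
    · intro j M' hj hi hN _ h z hz
      simp only [den_setReal, writeReal_real, NatExpr.eval, RealExpr.eval, hi, true_and]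
      split_ifs with hzj
      · simp
      · exact h z (by omega)
  set M₂ := (setReal 1 (.const 0) (.var 21) (.ofNat (.const 0))).den G s M₁ with hM₂
  have h21 : M₁.nat 21 0 0 = u := by rw [hM₁, den_nat _ (by decide), hu]
  have he₂ : ∀ z < n, M₂.real 1 0 z = if z = u then 0 else 1 := by
    intro z hz
    simp only [hM₂, den_setReal, writeReal_real, NatExpr.eval, RealExpr.eval, h21, true_and,
      hinit z hz, Nat.cast_zero]
  have hn₂ : ∀ a, a ≠ 22 → M₂.nat a = M.nat a := by
    intro a ha
    change M₁.nat a = M.nat a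
    rw [hM₁, den_nat _ (by simpa [natWrites] using ha)]
  have hw₂ : WalkInv G s S u (M₂.real 1 0) := by
    refine ⟨fun z hz => ?_, ?_, fun z hz => ?_⟩
    · rw [he₂ z hz]; split_ifs <;> norm_num
    · rw [he₂ u u.2, if_pos rfl]
    · rw [he₂ z z.2] at hz ⊢
      split_ifs at hz ⊢ with h
      · obtain rfl : z = u := Fin.ext h
        exact ⟨SimpleGraph.Walk.nil, by simp⟩
      · exact absurd hz (lt_irrefl _)
  have hfin := forN_inv (G := G) (s := s) (n := n) (i := 22) (M := M₂)
    (p := forN 23 (forN 24 relaxProg))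
    (fun j M' => WalkInv G s S u (M'.real 1 0) ∧ ∃ T ⊆ Finset.range n, j ≤ T.card ∧
      Settled n (AdjN G) (stepLen G s S) T (M'.real 1 0)) ?_ ?_ ?_
  · obtain ⟨h1, T, hT, hcard, hset⟩ := hfin
    exact entryDist_of_settled hs h1 hT hcard hset
  · intro j k M' h; exact h
  · exact ⟨hw₂, ∅, by simp, by simp, fun a ha => absurd ha (by simp)⟩
  · rintro j M' hj hi hN - ⟨h1, T, hT, hcard, hset⟩
    have := middle M' j ((hN 0 (by decide)).trans (hn₂ 0 (by decide)))
      ((hN 5 (by decide)).trans (hn₂ 5 (by decide))) ⟨h1, RoundInv.start hj hT hcard hset⟩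
    exact ⟨this.1, this.2.finish⟩

end SProg
end OracleRAM

/-! ### Searching for a good radius -/

namespace OracleRAM

variable {n : ℕ} {G : SimpleGraph (Fin n)} {s : LPSolution n} {w : ℕ}

namespace SProg

/-- A loop that adds `f j` in its `j`-th round. -/
theorem forN_sum {α : Type*} [AddCommMonoid α] {i : ℕ} {p : SProg} {M : Memory}
    (val : Memory → α) (f : Fin n → α) (hval : ∀ (k : ℕ) (M' : Memory), val (M'.writeNat i 0 0 k) = val M')
    (hs : ∀ (j : Fin n) (M' : Memory), M'.nat i 0 0 = (j : ℕ) → (∀ a, a ∉ i :: p.natWrites → M'.nat a = M.nat a) →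
      (∀ a, a ∉ p.realWrites → M'.real a = M.real a) → val (p.den G s M') = val M' + f j) :
    val ((forN i p).den G s M) = val M + ∑ j, f j := by
  have := forN_inv (G := G) (s := s) (n := n) (i := i) (M := M) (p := p)
    (fun j M' => val M' = val M + ∑ k ∈ Finset.univ.filter (fun k : Fin n => (k : ℕ) < j), f k)
    ?_ ?_ ?_
  · rw [this, Finset.filter_true_of_mem fun k _ => k.2]
  · intro j k M' h; rw [hval, h]
  · simp
  · intro j M' hj hi hN hR h
    rw [hs ⟨j, hj⟩ M' hi hN hR, h, add_assoc]
    congr 1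
    have : Finset.univ.filter (fun k : Fin n => (k : ℕ) < j + 1) =
        insert ⟨j, hj⟩ (Finset.univ.filter (fun k : Fin n => (k : ℕ) < j)) := by
      ext k
      simp only [Finset.mem_filter, Finset.mem_univ, true_and, Finset.mem_insert, Fin.ext_iff]
      omega
    rw [this, Finset.sum_insert (by simp), add_comm]

/-- The memory holds the data of the ball. -/
structure BallMem (G : SimpleGraph (Fin n)) (s : LPSolution n) (β : BallData n) (M : Memory) :
    Prop where
  pairs : ∀ p q : Fin n, (p, q) ∈ β.T ↔ M.nat 0 p q ≠ 0 ∧ M.nat 2 p q = 0 ∧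
    ((M.nat 6 0 p ≠ 0 ∧ M.nat 5 0 p = 0) ∨ (M.nat 6 0 q ≠ 0 ∧ M.nat 5 0 q = 0))
  active : ∀ z : Fin n, z ∈ β.A ↔ M.nat 6 0 z ≠ 0
  entry : ∀ z : Fin n, M.real 1 0 z = β.e z
  vert : ∀ z : Fin n, answerY s (M.rowSet n 5 0) z = β.y z
  edge : ∀ p q : Fin n, answerX G s p q = β.x p q
  len : ∀ p q : Fin n, M.real 0 p q = β.D * β.x p q
  cube : M.nat 13 0 0 = β.D
  bits : M.nat 9 0 0 = β.b
  loglog : M.nat 11 0 0 = β.l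
  total : M.real 2 0 0 = β.σ

theorem BallMem.congr {β : BallData n} {M M' : Memory} (h : BallMem G s β M)
    (hN : ∀ a ∈ [0, 2, 5, 6, 9, 11, 13], M'.nat a = M.nat a)
    (hR : ∀ a ∈ [0, 1, 2], M'.real a = M.real a) : BallMem G s β M' := by
  have e0 := hN 0 (by decide)
  have e2 := hN 2 (by decide)
  have e5 := hN 5 (by decide)
  have e6 := hN 6 (by decide)
  have e9 := hN 9 (by decide)
  have e11 := hN 11 (by decide)
  have e13 := hN 13 (by decide)
  have r0 := hR 0 (by decide)
  have r1 := hR 1 (by decide)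
  have r2 := hR 2 (by decide)
  refine ⟨?_, ?_, ?_, ?_, h.edge, ?_, ?_, ?_, ?_, ?_⟩
  · rw [e0, e2, e5, e6]; exact h.pairs
  · rw [e6]; exact h.active
  · rw [r1]; exact h.entry
  · rw [rowSet_congr e5]; exact h.vert
  · rw [r0]; exact h.len
  · rw [e13]; exact h.cube
  · rw [e9]; exact h.bits
  · rw [e11]; exact h.loglog
  · rw [r2]; exact h.total

variable {β : BallData n} {M : Memory}

theorem touchTest_holds (h : BallMem G s β M) {P Q : NatExpr} {p q : Fin n} (hP : P.eval M = p)
    (hQ : Q.eval M = q) : (touchTest P Q).Holds G s M ↔ (p, q) ∈ β.T := by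
  rw [h.pairs]
  simp only [touchTest, Test.Holds, NatExpr.eval, hP, hQ]
  simp only [Nat.le_zero]
  tauto

theorem exitDist_eval (h : BallMem G s β M) {P : NatExpr} {p : Fin n} (hP : P.eval M = p) :
    (exitDist P).eval G s M = β.e p + β.y p := by
  simp only [RealExpr.eval, NatExpr.eval, hP, h.entry, h.vert]

theorem outsideTest_holds (h : BallMem G s β M) {P Q : NatExpr} {p q : Fin n} (hP : P.eval M = p)
    (hQ : Q.eval M = q) :
    (outsideTest P Q).Holds G s M ↔ β.Outside (M.real 3 0 0) (p, q) := by
  have h1 := exitDist_eval h hP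
  have h2 := exitDist_eval h hQ
  simp only [outsideTest, Test.Holds, h1, h2, BallData.Outside, not_le]
  rfl

theorem insideTest_holds (h : BallMem G s β M) {P Q : NatExpr} {p q : Fin n} (hP : P.eval M = p)
    (hQ : Q.eval M = q) :
    (insideTest P Q).Holds G s M ↔ β.Inside (M.real 3 0 0) (p, q) := by
  have h1 := exitDist_eval h hP
  have h2 := exitDist_eval h hQ
  have h3 : (RealExpr.add (exitDist P) (.queryX P Q)).eval G s M =
      β.e p + β.y p + β.x p q := by rw [RealExpr.eval, h1]; simp [hP, hQ, h.edge]
  have h4 : (RealExpr.add (exitDist Q) (.queryX P Q)).eval G s M =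
      β.e q + β.y q + β.x p q := by rw [RealExpr.eval, h2]; simp [hP, hQ, h.edge]
  simp only [insideTest, Test.Holds, h3, h4, BallData.Inside]
  simp only [RealExpr.eval, NatExpr.eval]
  tauto

/-- Body of the loops of `pairSums`. -/
abbrev pairBody : SProg := .when (touchTest (.var 24) (.var 25)) <|
    .seq (.addR 5 (.get 0 (.var 24) (.var 25))) <|
    .ite (outsideTest (.var 24) (.var 25)) (.addR 7 (.get 0 (.var 24) (.var 25))) <|
    .ite (insideTest (.var 24) (.var 25)) (.addR 6 (.get 0 (.var 24) (.var 25))) <|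
    .addN 16 (.var 13)

/-- The sums computed by `pairSums`. -/
def pairVal (M : Memory) : ℝ × ℝ × ℝ × ℕ :=
  (M.real 5 0 0, M.real 6 0 0, M.real 7 0 0, M.nat 16 0 0)

open Classical in
/-- The contribution of a pair. -/
noncomputable def pairTerm (β : BallData n) (r : ℝ) (p q : Fin n) : ℝ × ℝ × ℝ × ℕ :=
  if (p, q) ∈ β.T then
    (β.D * β.x p q, if β.Inside r (p, q) then β.D * β.x p q else 0,
      if β.Outside r (p, q) then β.D * β.x p q else 0,
      if ¬ β.Outside r (p, q) ∧ ¬ β.Inside r (p, q) then β.D else 0)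
  else 0

theorem pairBody_spec (h : BallMem G s β M) (hx : ∀ p q, 0 ≤ β.x p q) {p q : Fin n}
    (hp : M.nat 24 0 0 = p) (hq : M.nat 25 0 0 = q) :
    pairVal (pairBody.den G s M) = pairVal M + pairTerm β (M.real 3 0 0) p q := by
  have hP : (NatExpr.var 24).eval M = p := by simpa using hp
  have hQ : (NatExpr.var 25).eval M = q := by simpa using hq
  have hlen := h.len p q
  rw [den_ite, pairTerm]
  by_cases hT : (p, q) ∈ β.T
  · rw [if_pos ((touchTest_holds h hP hQ).2 hT), if_pos hT, den_seq]
    set M₁ := (addR 5 (.get 0 (.var 24) (.var 25))).den G s M with hM₁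
    have h₁ : BallMem G s β M₁ := h.congr (fun a _ => rfl) fun a ha => by
      rw [hM₁, den_real _ (by revert a; decide)]
    have hP₁ : (NatExpr.var 24).eval M₁ = p := hP
    have hQ₁ : (NatExpr.var 25).eval M₁ = q := hQ
    have h3 : M₁.real 3 0 0 = M.real 3 0 0 := rfl
    have o := outsideTest_holds h₁ hP₁ hQ₁
    have ii := insideTest_holds h₁ hP₁ hQ₁
    rw [h3] at o ii
    have hv : pairVal M₁ = pairVal M + (β.D * β.x p q, 0, 0, 0) := by
      simp [pairVal, hM₁, hp, hq, hlen]
    have hg : M₁.real 0 (M₁.nat 24 0 0) (M₁.nat 25 0 0) = β.D * β.x p q := by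
      rw [show M₁.nat 24 0 0 = p from hp, show M₁.nat 25 0 0 = q from hq, h₁.len]
    rw [den_ite]
    by_cases ho : β.Outside (M.real 3 0 0) (p, q)
    · rw [if_pos (o.2 ho), if_pos ho, if_neg (BallData.not_inside_of_outside hx ho), if_neg (by tauto)]
      simp only [pairVal, Prod.mk_add_mk, Prod.mk.injEq, add_zero] at hv ⊢
      simp [hv, hg]
    · rw [if_neg fun h' => ho (o.1 h'), if_neg ho, den_ite]
      by_cases hi : β.Inside (M.real 3 0 0) (p, q)
      · rw [if_pos (ii.2 hi), if_pos hi, if_neg (by tauto)]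
        simp only [pairVal, Prod.mk_add_mk, Prod.mk.injEq, add_zero] at hv ⊢
        simp [hv, hg]
      · rw [if_neg fun h' => hi (ii.1 h'), if_neg hi, if_pos ⟨ho, hi⟩]
        simp only [pairVal, Prod.mk_add_mk, Prod.mk.injEq, add_zero] at hv ⊢
        simp [hv, h₁.cube]
  · rw [if_neg fun h' => hT ((touchTest_holds h hP hQ).1 h'), if_neg hT, add_zero, den_skip]

/-- All four sums are treated as one sum of quadruples, so `forN_sum` is applied once per loop. The
count of cut pairs is accumulated in units of `D`, which provides the product needed in `Good`. -/
theorem pairSums_spec (h : BallMem G s β M) (hx : ∀ p q, 0 ≤ β.x p q) :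
    pairVal (pairSums.den G s M) = (β.W, β.volIn (M.real 3 0 0), β.volOut (M.real 3 0 0),
      (β.cutPairs (M.real 3 0 0)).card * β.D) := by
  classical
  set r := M.real 3 0 0 with hr
  have inner : ∀ (M₁ : Memory) (p : Fin n), BallMem G s β M₁ → M₁.real 3 0 0 = r →
      M₁.nat 24 0 0 = p → pairVal ((forN 25 pairBody).den G s M₁) =
        pairVal M₁ + ∑ q, pairTerm β r p q := by
    intro M₁ p h₁ h3 hp
    refine forN_sum pairVal _ (fun k M' => rfl) fun j M' hj hN hR => ?_
    have h' : BallMem G s β M' := h₁.congr (fun a ha => hN a (by revert a; decide))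
      fun a ha => hR a (by revert a; decide)
    rw [pairBody_spec h' hx ((congrArg (fun f => f 0 0) (hN 24 (by decide))).trans hp) hj,
      hR 3 (by decide), h3]
  set M₀ := ((setR 5 (.ofNat (.const 0))).seq <| .seq (.setR 6 (.ofNat (.const 0))) <|
    .seq (.setR 7 (.ofNat (.const 0))) (.setN 16 (.const 0))).den G s M with hM₀
  have hN₀ : ∀ a, a ≠ 16 → M₀.nat a = M.nat a := fun a ha => den_nat _ (by simpa [natWrites] using ha) _
  have hR₀ : ∀ a, a ∉ [5, 6, 7] → M₀.real a = M.real a := fun a ha =>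
    den_real _ (by simpa [realWrites] using ha) _
  have h₀ : BallMem G s β M₀ := h.congr (fun a ha => hN₀ a (by revert a; decide))
    fun a ha => hR₀ a (by revert a; decide)
  have outer : pairVal ((forN 24 (forN 25 pairBody)).den G s M₀) =
      pairVal M₀ + ∑ p, ∑ q, pairTerm β r p q := by
    refine forN_sum pairVal _ (fun k M' => rfl) fun j M' hj hN hR => ?_
    have h' : BallMem G s β M' := h₀.congr (fun a ha => hN a (by revert a; decide))
      fun a ha => hR a (by revert a; decide)
    exact inner M' j h' (by rw [hR 3 (by decide), hR₀ 3 (by decide)]) hj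
  have hz : pairVal M₀ = 0 := by simp [pairVal, hM₀]
  have hfin : pairSums.den G s M = (forN 24 (forN 25 pairBody)).den G s M₀ := rfl
  rw [hfin, outer, hz, zero_add, ← Fintype.sum_prod_type']
  have e : ∑ pq : Fin n × Fin n, pairTerm β r pq.1 pq.2 = ∑ pq ∈ β.T,
      (β.D * β.x pq.1 pq.2, if β.Inside r pq then β.D * β.x pq.1 pq.2 else 0,
      if β.Outside r pq then β.D * β.x pq.1 pq.2 else 0,
      if ¬ β.Outside r pq ∧ ¬ β.Inside r pq then β.D else 0) := by
    rw [← Finset.sum_filter_add_sum_filter_not Finset.univ (· ∈ β.T)]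
    rw [Finset.sum_eq_zero (s := Finset.univ.filter fun pq => ¬ pq ∈ β.T) fun pq hpq => by
      rw [pairTerm, if_neg (Finset.mem_filter.1 hpq).2], add_zero, Finset.filter_mem_eq_inter,
      Finset.univ_inter]
    exact Finset.sum_congr rfl fun pq hpq => by rw [pairTerm, if_pos hpq]
  rw [e]
  refine Prod.ext ?_ (Prod.ext ?_ (Prod.ext ?_ ?_))
  · simp only [Prod.fst_sum]; rfl
  · simp only [Prod.snd_sum, Prod.fst_sum]
    rw [BallData.volIn, Finset.sum_filter]
  · simp only [Prod.snd_sum, Prod.fst_sum]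
    rw [BallData.volOut, Finset.sum_filter]
  · simp only [Prod.snd_sum]
    rw [BallData.cutPairs, ← Finset.sum_filter, Finset.sum_const, smul_eq_mul]

theorem vertSums_spec (h : BallMem G s β M) :
    (vertSums.den G s M).real 11 0 0 = β.vertVol (M.real 3 0 0) ∧
      (vertSums.den G s M).nat 17 0 0 = (β.cutVerts (M.real 3 0 0)).card := by
  classical
  set r := M.real 3 0 0 with hr
  set M₀ := ((setR 11 (.ofNat (.const 0))).seq (.setN 17 (.const 0))).den G s M with hM₀
  have hN₀ : ∀ a, a ≠ 17 → M₀.nat a = M.nat a := fun a ha => den_nat _ (by simpa [natWrites] using ha) _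
  have hR₀ : ∀ a, a ≠ 11 → M₀.real a = M.real a := fun a ha =>
    den_real _ (by simpa [realWrites] using ha) _
  have h₀ : BallMem G s β M₀ := h.congr (fun a ha => hN₀ a (by revert a; decide))
    fun a ha => hR₀ a (by revert a; decide)
  have key := forN_sum (G := G) (s := s) (i := 24) (M := M₀)
    (p := .when (.and (.nonzero (.vec 6 (.var 24))) (.realLE (.vec 1 (.var 24)) (.var 3))) <|
      .seq (.addR 11 (.queryY 5 (.const 0) (.var 24))) <|
      .when (.not (.realLE (exitDist (.var 24)) (.var 3))) (.addN 17 (.const 1)))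
    (fun M => (M.real 11 0 0, M.nat 17 0 0))
    (fun z : Fin n => ((if z ∈ β.A ∧ β.e z ≤ r then β.y z else 0 : ℝ),
      (if z ∈ β.A ∧ β.e z ≤ r ∧ r < β.e z + β.y z then 1 else 0 : ℕ))) (fun k M' => rfl) ?_
  · have hz : ((M₀.real 11 0 0, M₀.nat 17 0 0) : ℝ × ℕ) = 0 := by simp [hM₀]
    rw [hz, zero_add, Prod.ext_iff, Prod.fst_sum, Prod.snd_sum] at key
    refine ⟨key.1.trans ?_, key.2.trans ?_⟩
    · dsimp only
      rw [BallData.vertVol, ← Finset.sum_filter]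
      refine Finset.sum_congr ?_ fun _ _ => rfl
      ext z; simp
    · dsimp only
      rw [BallData.cutVerts, ← Finset.card_filter]
      congr 1
      ext z; simp
  · intro j M' hj hN hR
    have h' : BallMem G s β M' := h₀.congr (fun a ha => hN a (by revert a; decide))
      fun a ha => hR a (by revert a; decide)
    have hP : (NatExpr.var 24).eval M' = j := by simpa using hj
    have h3 : M'.real 3 0 0 = r := by rw [hR 3 (by decide), hR₀ 3 (by decide)]
    have c1 : (Test.and (.nonzero (.vec 6 (.var 24))) (.realLE (.vec 1 (.var 24)) (.var 3))).Holds
        G s M' ↔ j ∈ β.A ∧ β.e j ≤ r := by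
      simp only [Test.Holds, NatExpr.eval, RealExpr.eval, hj, h'.active, h'.entry, h3, Nat.le_zero]
    rw [den_ite]
    by_cases hc : j ∈ β.A ∧ β.e j ≤ r
    · rw [if_pos (c1.2 hc), if_pos hc, den_seq]
      set M₁ := (addR 11 (.queryY 5 (.const 0) (.var 24))).den G s M' with hM₁
      have hv : M₁.real 11 0 0 = M'.real 11 0 0 + β.y j := by
        simp [hM₁, hj, h'.vert]
      have h₁ : BallMem G s β M₁ := h'.congr (fun a _ => rfl) fun a ha => by
        rw [hM₁, den_real _ (by revert a; decide)]
      have hd := exitDist_eval h₁ (P := .var 24) (p := j) hP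
      have c2 : (Test.not (.realLE (exitDist (.var 24)) (.var 3))).Holds G s M₁ ↔
          r < β.e j + β.y j := by
        simp only [Test.Holds, hd, not_le]
        rw [show (RealExpr.var 3).eval G s M₁ = r from h3]
      rw [den_ite]
      by_cases hlt : r < β.e j + β.y j
      · rw [if_pos (c2.2 hlt), if_pos ⟨hc.1, hc.2, hlt⟩]
        exact Prod.ext hv rfl
      · rw [if_neg fun h => hlt (c2.1 h), if_neg (by tauto), den_skip, hv]
        simp [hM₁]
    · rw [if_neg fun h => hc (c1.1 h), if_neg hc, if_neg (by tauto), den_skip]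
      simp

theorem multProg_spec (h : BallMem G s β M) {r : ℝ} (h5 : M.real 5 0 0 = β.W)
    (h6 : M.real 6 0 0 = β.volIn r) (h7 : M.real 7 0 0 = β.volOut r)
    (h11 : M.real 11 0 0 = β.vertVol r) (hb : β.b ≤ n) (hl : β.l ≤ n) :
    (multProg.den G s M).real 8 0 0 = β.small r ∧
      (multProg.den G s M).real 13 0 0 = β.l * β.small r ∧
      (multProg.den G s M).real 12 0 0 = β.b * β.vertVol r := by
  set M₁ := ((ite (.realLE (.var 6) (.var 7))
    (.setR 8 (.add (.sub (.var 5) (.var 7)) (.var 2)))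
    (.setR 8 (.add (.sub (.var 5) (.var 6)) (.var 2)))).seq <|
    .seq (.setR 13 (.ofNat (.const 0))) (.setR 12 (.ofNat (.const 0)))).den G s M with hM₁
  have h8 : M₁.real 8 0 0 = β.small r := by
    simp only [hM₁, den_seq, den_ite, Test.Holds, RealExpr.eval, NatExpr.eval, h6, h7, BallData.small]
    split_ifs with hc
    · simp [h5, h7, h.total, max_eq_right hc]
    · simp [h5, h6, h.total, max_eq_left (not_le.1 hc).le]
  have hN₁ : ∀ a, M₁.nat a = M.nat a := fun a => den_nat _ (by simp [natWrites]) _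
  have hR₁ : ∀ a, a ∉ [8, 13, 12] → M₁.real a = M.real a := fun a ha =>
    den_real _ (by simpa [realWrites] using ha) _
  have hmain := forN_inv (G := G) (s := s) (n := n) (i := 24) (M := M₁)
    (p := .seq (.when (.not (.natLE (.var 11) (.var 24))) (.addR 13 (.var 8)))
      (.when (.not (.natLE (.var 9) (.var 24))) (.addR 12 (.var 11))))
    (fun j M' => M'.real 13 0 0 = (min j β.l : ℕ) * β.small r ∧
      M'.real 12 0 0 = (min j β.b : ℕ) * β.vertVol r) ?_ ?_ ?_
  · rw [min_eq_right hb, min_eq_right hl] at hmain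
    refine ⟨?_, hmain⟩
    have : multProg.den G s M = (forN 24 (.seq
      (.when (.not (.natLE (.var 11) (.var 24))) (.addR 13 (.var 8)))
      (.when (.not (.natLE (.var 9) (.var 24))) (.addR 12 (.var 11))))).den G s M₁ := rfl
    rw [this, den_real _ (by decide), h8]
  · intro j k M' h; exact h
  · simp [hM₁]
  · rintro j M' hj hi hN hR ⟨e13, e12⟩
    have n9 : M'.nat 9 0 0 = β.b := by rw [hN 9 (by decide), hN₁, h.bits]
    have n11 : M'.nat 11 0 0 = β.l := by rw [hN 11 (by decide), hN₁, h.loglog]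
    have r8 : M'.real 8 0 0 = β.small r := by rw [hR 8 (by decide), h8]
    have r11 : M'.real 11 0 0 = β.vertVol r := by rw [hR 11 (by decide), hR₁ 11 (by decide), h11]
    have m1 : ∀ b : ℕ, b ≤ j → min (j + 1) b = min j b := fun b hb => by omega
    have m2 : ∀ b : ℕ, ¬ b ≤ j → min (j + 1) b = min j b + 1 := fun b hb => by omega
    simp only [den_seq, den_ite, Test.Holds, NatExpr.eval, n11, hi]
    by_cases c1 : β.l ≤ j <;> by_cases c2 : β.b ≤ j
    · simp [c1, c2, n9, hi, e13, e12, m1]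
    · simp [c1, c2, n9, hi, e13, e12, r11, m1, m2, add_mul]
    · simp [c1, c2, n9, hi, e13, e12, r8, m1, m2, add_mul]
    · simp [c1, c2, n9, hi, e13, e12, r8, r11, m2, add_mul]

/-- The smaller side is multiplied by `16` until it exceeds `W + σ`, and each time one more copy of
array `13` is added. By `hn` the threshold is passed within `n` rounds. -/
theorem scalesProg_spec (h : BallMem G s β M) {r : ℝ} (h5 : M.real 5 0 0 = β.W)
    (h8 : M.real 8 0 0 = β.small r) (hn : β.W + β.σ < 16 ^ n * β.small r) :
    (scalesProg.den G s M).real 10 0 0 = β.scales r * M.real 13 0 0 := by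
  set M₁ := ((setR 9 (.var 8)).seq (.setR 10 (.ofNat (.const 0)))).den G s M with hM₁
  have hR₁ : ∀ a, a ∉ [9, 10] → M₁.real a = M.real a := fun a ha =>
    den_real _ (by simpa [realWrites] using ha) _
  have hmain := forN_inv (G := G) (s := s) (n := n) (i := 24) (M := M₁)
    (p := .when (.realLE (.var 9) (.add (.var 5) (.var 2)))
      (.seq (.setR 9 ((RealExpr.var 9).scale 16)) (.addR 10 (.var 13))))
    (fun j M' => ∃ k : ℕ, M'.real 9 0 0 = 16 ^ k * β.small r ∧
      M'.real 10 0 0 = k * M.real 13 0 0 ∧ (∀ i < k, 16 ^ i * β.small r ≤ β.W + β.σ) ∧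
      (k = j ∨ β.W + β.σ < 16 ^ k * β.small r)) ?_ ?_ ?_
  · obtain ⟨k, -, h2, h3, h4⟩ := hmain
    have hk : β.W + β.σ < 16 ^ k * β.small r := by
      rcases h4 with rfl | h4
      · exact hn
      · exact h4
    have : β.scales r = k := by
      refine le_antisymm (Nat.sInf_le hk) (not_lt.1 fun hlt => ?_)
      exact absurd (Nat.sInf_mem (s := {k : ℕ | β.W + β.σ < 16 ^ k * β.small r}) ⟨k, hk⟩)
        (not_lt.2 (h3 _ hlt))
    rw [this]; exact h2
  · intro j k M' h; exact h
  · exact ⟨0, by simp [hM₁, h8], by simp [hM₁], by simp, Or.inl rfl⟩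
  · rintro j M' hj hi hN hR ⟨k, e9, e10, h3, h4⟩
    have r5 : M'.real 5 0 0 = β.W := by rw [hR 5 (by decide), hR₁ 5 (by decide), h5]
    have r2 : M'.real 2 0 0 = β.σ := by rw [hR 2 (by decide), hR₁ 2 (by decide), h.total]
    have r13 : M'.real 13 0 0 = M.real 13 0 0 := by rw [hR 13 (by decide), hR₁ 13 (by decide)]
    simp only [den_ite, Test.Holds, NatExpr.eval, RealExpr.eval, e9, r5, r2]
    split_ifs with hc
    · refine ⟨k + 1, ?_, ?_, fun i hi => ?_, ?_⟩
      · simp [e9, pow_succ]; ring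
      · simp [e10, r13]; ring
      · rcases Nat.lt_succ_iff_lt_or_eq.1 hi with hi | rfl
        · exact h3 i hi
        · exact hc
      · left; rw [h4.resolve_right (not_lt.2 hc)]
    · exact ⟨k, e9, e10, h3, Or.inr (not_le.1 hc)⟩

end SProg
end OracleRAM

/-! ### The search -/

namespace OracleRAM

variable {n : ℕ} {G : SimpleGraph (Fin n)} {s : LPSolution n} {w : ℕ}

namespace SProg

variable {β : BallData n} {M : Memory}

/-- The seed bounds the smaller side from below; this limits the number of scales. -/
theorem small_ge (hx : ∀ p q, 0 ≤ β.x p q) (r : ℝ) : β.σ ≤ β.small r := by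
  have h1 := BallData.volIn_add_volOut_le hx r
  have : max (β.volIn r) (β.volOut r) ≤ β.W :=
    max_le (by linarith [BallData.volOut_nonneg hx r]) (by linarith [BallData.volIn_nonneg hx r])
  unfold BallData.small; linarith

/-- Admissible radii. -/
def Fit (β : BallData n) (r : ℝ) : Prop := β.Critical r ∧ r + r + r + r < 1 ∧ β.Good r

/-- State of the search after the radii in `P` have been tested. -/
def SearchInv (β : BallData n) (P : ℝ → Prop) (M : Memory) : Prop :=
  (M.nat 18 0 0 = 1 ∧ Fit β (M.real 4 0 0)) ∨ (M.nat 18 0 0 = 0 ∧ ∀ r, P r → ¬ Fit β r)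

theorem SearchInv.mono {P P' : ℝ → Prop} (h : SearchInv β P M) (hP : ∀ r, P' r → P r) :
    SearchInv β P' M :=
  h.imp_right fun h => ⟨h.1, fun r hr => h.2 r (hP r hr)⟩

/-- The commands of `testProg` that compute the quantities to be compared. -/
abbrev evalProg : SProg := .seq pairSums <| .seq vertSums <| .seq multProg scalesProg

theorem evalProg_spec (h : BallMem G s β M) (hx : ∀ p q, 0 ≤ β.x p q) (hb : β.b ≤ n)
    (hl : β.l ≤ n) (hn : β.W + β.σ < 16 ^ n * β.σ) {r : ℝ} (h3 : M.real 3 0 0 = r) :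
    (evalProg.den G s M).nat 16 0 0 = (β.cutPairs r).card * β.D ∧
      (evalProg.den G s M).nat 17 0 0 = (β.cutVerts r).card ∧
      (evalProg.den G s M).real 10 0 0 = β.scales r * (β.l * β.small r) ∧
      (evalProg.den G s M).real 12 0 0 = β.b * β.vertVol r := by
  set M₁ := pairSums.den G s M with hM₁
  set M₂ := vertSums.den G s M₁ with hM₂
  set M₃ := multProg.den G s M₂ with hM₃
  have hfin : evalProg.den G s M = scalesProg.den G s M₃ := rfl
  have s1 := pairSums_spec h hx
  rw [h3, ← hM₁, pairVal, Prod.mk.injEq, Prod.mk.injEq, Prod.mk.injEq] at s1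
  obtain ⟨a5, a6, a7, a16⟩ := s1
  have h₁ : BallMem G s β M₁ := h.congr
    (fun a ha => den_nat _ (by revert a; decide) _) fun a ha => den_real _ (by revert a; decide) _
  have h₂ : BallMem G s β M₂ := h₁.congr
    (fun a ha => den_nat _ (by revert a; decide) _) fun a ha => den_real _ (by revert a; decide) _
  have h₃ : BallMem G s β M₃ := h₂.congr
    (fun a ha => den_nat _ (by revert a; decide) _) fun a ha => den_real _ (by revert a; decide) _
  have e3 : M₁.real 3 0 0 = r := by rw [hM₁, den_real _ (by decide), h3]
  obtain ⟨b11, b17⟩ := vertSums_spec h₁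
  rw [e3] at b11 b17
  obtain ⟨c8, c13, c12⟩ := multProg_spec (r := r) h₂ (by rw [hM₂, den_real _ (by decide), a5])
    (by rw [hM₂, den_real _ (by decide), a6]) (by rw [hM₂, den_real _ (by decide), a7]) b11 hb hl
  have d := scalesProg_spec (r := r) h₃
    (by rw [hM₃, den_real _ (by decide), hM₂, den_real _ (by decide), a5]) c8
    (hn.trans_le (mul_le_mul_of_nonneg_left (small_ge hx r) (by positivity)))
  rw [hfin]
  refine ⟨?_, ?_, ?_, ?_⟩
  · rw [den_nat _ (by decide), hM₃, den_nat _ (by decide), hM₂, den_nat _ (by decide), a16]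
  · rw [den_nat _ (by decide), hM₃, den_nat _ (by decide), b17]
  · rw [d, c13]
  · rw [den_real _ (by decide), c12]

/-- Once a radius is accepted the flag in array `18` protects it, so later tests do nothing. The
condition `r < 1/4` is tested as `4 r < 1`, as the machine cannot divide. -/
theorem testProg_spec (h : BallMem G s β M) (hx : ∀ p q, 0 ≤ β.x p q) (hb : β.b ≤ n)
    (hl : β.l ≤ n) (hn : β.W + β.σ < 16 ^ n * β.σ) {r : ℝ} (h3 : M.real 3 0 0 = r)
    (hr : β.Critical r) {P : ℝ → Prop} (hI : SearchInv β P M) :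
    SearchInv β (fun t => P t ∨ t = r) (testProg.den G s M) := by
  rw [testProg, den_ite]
  have ht : (Test.and (.zero (.var 18))
      (.not (.realLE (.ofNat (.const 1)) ((RealExpr.var 3).scale 4)))).Holds G s M ↔
      M.nat 18 0 0 = 0 ∧ r + r + r + r < 1 := by
    simp only [Test.Holds, NatExpr.eval, RealExpr.eval, RealExpr.eval_scale, h3, Nat.le_zero,
      not_le]
    refine and_congr_right fun _ => ?_
    push_cast
    constructor <;> intro h <;> linarith
  by_cases hc : M.nat 18 0 0 = 0 ∧ r + r + r + r < 1
  · rw [if_pos (ht.2 hc)]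
    set M₁ := evalProg.den G s M with hM₁
    obtain ⟨a16, a17, a10, a12⟩ := evalProg_spec h hx hb hl hn h3
    rw [← hM₁] at a16 a17 a10 a12
    have e3 : M₁.real 3 0 0 = r := by rw [hM₁, den_real _ (by decide), h3]
    have e18 : M₁.nat 18 0 0 = 0 := by rw [hM₁, den_nat _ (by decide), hc.1]
    have hN := (hI.resolve_left fun h' => by omega).2
    have hfin : ∀ p : SProg, (SProg.seq pairSums <| .seq vertSums <| .seq multProg <|
        .seq scalesProg p).den G s M = p.den G s M₁ := fun p => rfl
    rw [hfin, den_ite]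
    have ht' : (Test.and (.realLE (.ofNat (.var 16)) ((RealExpr.var 10).scale 256))
        (.realLE ((RealExpr.ofNat (.var 17)).scale 9)
          (.add ((RealExpr.var 12).scale 1024) (.ofNat (.const 1))))).Holds G s M₁ ↔ β.Good r := by
      simp only [Test.Holds, NatExpr.eval, RealExpr.eval, RealExpr.eval_scale, a16, a17, a10, a12,
        BallData.Good]
      push_cast
      rw [mul_comm (β.D : ℝ)]
    by_cases hg : β.Good r
    · rw [if_pos (ht'.2 hg)]
      left
      simp only [den_seq, den_setNat, den_setReal, NatExpr.eval, RealExpr.eval, writeReal_nat,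
        writeNat_nat, writeReal_real, writeNat_real, and_self, if_true, e3, true_and]
      exact ⟨hr, hc.2, hg⟩
    · rw [if_neg fun h' => hg (ht'.1 h'), den_skip]
      exact Or.inr ⟨e18, fun t ht => ht.elim (hN t) fun ht hF => hg (ht ▸ hF.2.2)⟩
  · rw [if_neg fun h' => hc (ht.1 h'), den_skip]
    refine hI.imp_right fun h' => ⟨h'.1, fun t ht => ht.elim (h'.2 t) fun ht hF => hc ⟨h'.1, ?_⟩⟩
    rw [← ht]; exact hF.2.1

/-- Body of the loops of `searchProg`. -/
abbrev tryProg : SProg := .seq (.seq (.setR 3 (.vec 1 (.var 22))) testProg)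
  (.seq (.setR 3 (.add (exitDist (.var 22)) (.queryX (.var 22) (.var 23)))) testProg)

theorem tryProg_spec (h : BallMem G s β M) (hx : ∀ p q, 0 ≤ β.x p q) (hb : β.b ≤ n)
    (hl : β.l ≤ n) (hn : β.W + β.σ < 16 ^ n * β.σ) {p q : Fin n} (hp : M.nat 22 0 0 = p)
    (hq : M.nat 23 0 0 = q) {P : ℝ → Prop} (hI : SearchInv β P M) :
    SearchInv β (fun t => P t ∨ t = β.e p ∨ t = β.e p + β.y p + β.x p q) (tryProg.den G s M) := by
  have key : ∀ (M : Memory) (E : RealExpr) (t : ℝ) (P : ℝ → Prop), BallMem G s β M →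
      β.Critical t → E.eval G s M = t → SearchInv β P M →
      SearchInv β (fun t' => P t' ∨ t' = t) ((SProg.seq (.setR 3 E) testProg).den G s M) := by
    intro M E t P h ht he hI
    rw [den_seq]
    have h' : BallMem G s β ((setR 3 E).den G s M) := h.congr (fun a _ => rfl) fun a ha =>
      den_real (.setR 3 E) (by
        have : ∀ a ∈ [0, 1, 2], a ∉ [3] := by decide
        exact this a ha) M
    exact testProg_spec h' hx hb hl hn (by simp [he]) ht hI
  have h1 := key M (.vec 1 (.var 22)) (β.e p) P h (Or.inl ⟨p, rfl⟩)
    (by simp only [RealExpr.eval, NatExpr.eval, hp, h.entry]) hI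
  set M₁ := (SProg.seq (.setR 3 (.vec 1 (.var 22))) testProg).den G s M with hM₁
  have h₁ : BallMem G s β M₁ := h.congr
    (fun a ha => den_nat _ (by revert a; decide) _) fun a ha => den_real _ (by revert a; decide) _
  have p₁ : M₁.nat 22 0 0 = p := by rw [hM₁, den_nat _ (by decide), hp]
  have q₁ : M₁.nat 23 0 0 = q := by rw [hM₁, den_nat _ (by decide), hq]
  have h2 := key M₁ (.add (exitDist (.var 22)) (.queryX (.var 22) (.var 23)))
    (β.e p + β.y p + β.x p q) _ h₁ (Or.inr ⟨p, q, rfl⟩)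
    (by rw [RealExpr.eval, exitDist_eval h₁ (P := .var 22) (p := p) p₁]
        simp only [RealExpr.eval, NatExpr.eval, p₁, q₁, h.edge]) h1
  exact h2.mono fun r hr => by tauto

/-- The search finds an admissible radius. -/
theorem searchProg_spec (h : BallMem G s β M) (hx : ∀ p q, 0 ≤ β.x p q) (hb : β.b ≤ n)
    (hl : β.l ≤ n) (hn : β.W + β.σ < 16 ^ n * β.σ) (hex : ∃ r, Fit β r) :
    Fit β ((searchProg.den G s M).real 3 0 0) := by
  set M₀ := ((setN 18 (.const 0)).seq (.setR 4 (.ofNat (.const 0)))).den G s M with hM₀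
  have h₀ : BallMem G s β M₀ := h.congr
    (fun a ha => den_nat _ (by revert a; decide) _) fun a ha => den_real _ (by revert a; decide) _
  have inner : ∀ (M₁ : Memory) (p : Fin n) (P : ℝ → Prop), BallMem G s β M₁ →
      M₁.nat 22 0 0 = p → SearchInv β P M₁ →
      SearchInv β (fun t => P t ∨ ∃ q : Fin n, t = β.e p ∨ t = β.e p + β.y p + β.x p q)
        ((forN 23 tryProg).den G s M₁) := by
    intro M₁ p P h₁ hp hI
    have := forN_inv (G := G) (s := s) (n := n) (i := 23) (M := M₁) (p := tryProg)
      (fun j M' => SearchInv β (fun t => P t ∨ ∃ q : Fin n, (q : ℕ) < j ∧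
        (t = β.e p ∨ t = β.e p + β.y p + β.x p q)) M') ?_ ?_ ?_
    · exact this.mono fun t ht => ht.imp_right fun ⟨q, hq⟩ => ⟨q, q.2, hq⟩
    · intro j k M' h; exact h
    · exact hI.mono fun t ht => ht.resolve_right fun ⟨q, hq, _⟩ => by omega
    · intro j M' hj hi hN hR hI'
      have h' : BallMem G s β M' := h₁.congr (fun a ha => hN a (by revert a; decide))
        fun a ha => hR a (by revert a; decide)
      refine (tryProg_spec h' hx hb hl hn (p := p) (q := ⟨j, hj⟩)
        ((congrArg (fun f => f 0 0) (hN 22 (by decide))).trans hp) hi hI').mono ?_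
      rintro t (ht | ⟨q, hq, ht⟩)
      · exact Or.inl (Or.inl ht)
      · rcases Nat.lt_succ_iff_lt_or_eq.1 hq with hq | hq
        · exact Or.inl (Or.inr ⟨q, hq, ht⟩)
        · obtain rfl : q = ⟨j, hj⟩ := Fin.ext hq
          exact Or.inr ht
  have hout := forN_inv (G := G) (s := s) (n := n) (i := 22) (M := M₀) (p := forN 23 tryProg)
    (fun j M' => SearchInv β (fun t => ∃ p q : Fin n, (p : ℕ) < j ∧
        (t = β.e p ∨ t = β.e p + β.y p + β.x p q)) M') ?_ ?_ ?_
  · have h4 : (searchProg.den G s M).real 3 0 0 =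
        ((forN 22 (forN 23 tryProg)).den G s M₀).real 4 0 0 := by
      simp only [searchProg, den_seq, den_setReal]
      rfl
    rw [h4]
    rcases hout with hout | hout
    · exact hout.2
    · exfalso
      obtain ⟨r, hr⟩ := hex
      refine hout.2 r ?_ hr
      rcases hr.1 with ⟨p, hp⟩ | ⟨p, q, hp⟩
      · exact ⟨p, p, p.2, Or.inl hp⟩
      · exact ⟨p, q, p.2, Or.inr hp⟩
  · intro j k M' h; exact h
  · right
    exact ⟨by simp [hM₀], fun r ⟨p, q, hp, _⟩ => by omega⟩
  · intro j M' hj hi hN hR hI'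
    have h' : BallMem G s β M' := h₀.congr (fun a ha => hN a (by revert a; decide))
      fun a ha => hR a (by revert a; decide)
    refine (inner M' ⟨j, hj⟩ _ h' hi hI').mono ?_
    rintro t ⟨p, q, hp, ht⟩
    rcases Nat.lt_succ_iff_lt_or_eq.1 hp with hp | hp
    · exact Or.inl ⟨p, q, hp, ht⟩
    · obtain rfl : p = ⟨j, hj⟩ := Fin.ext hp
      exact Or.inr ⟨q, ht⟩

end SProg
end OracleRAM

/-! ### Steps of the algorithm on the memory -/

namespace OracleRAM

open Conf

variable {n : ℕ} {G : SimpleGraph (Fin n)} {s : LPSolution n} {w : ℕ}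

/-- The configuration stored in the memory. -/
def Memory.conf (n : ℕ) (M : Memory) : Conf n where
  cut p q := M.nat 2 p q ≠ 0
  rem := M.rowSet n 3 0
  lab z := M.nat 4 0 z
  top := M.nat 7 0 0

theorem conf_congr {M M' : Memory} (h : ∀ a ∈ [2, 3, 4, 7], M'.nat a = M.nat a) :
    M'.conf n = M.conf n := by
  have h3 : M'.rowSet n 3 0 = M.rowSet n 3 0 := rowSet_congr (h 3 (by decide)) 0
  simp only [Memory.conf, h3, h 2 (by decide), h 4 (by decide), h 7 (by decide)]

namespace SProg

/-- A loop whose `j`-th round sets the `j`-th entry of a family. -/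
theorem forN_update {α : Type*} {i : ℕ} {p : SProg} {M : Memory} (val : Memory → Fin n → α)
    (f : Fin n → α) (hval : ∀ (k : ℕ) (M' : Memory), val (M'.writeNat i 0 0 k) = val M')
    (hs : ∀ (j : Fin n) (M' : Memory), M'.nat i 0 0 = (j : ℕ) →
      (∀ a, a ∉ i :: p.natWrites → M'.nat a = M.nat a) →
      (∀ a, a ∉ p.realWrites → M'.real a = M.real a) → val M' j = val M j →
      val (p.den G s M') = Function.update (val M') j (f j)) :
    val ((forN i p).den G s M) = f := by
  have := forN_inv (G := G) (s := s) (n := n) (i := i) (M := M) (p := p)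
    (fun j M' => ∀ z : Fin n, val M' z = if (z : ℕ) < j then f z else val M z) ?_ ?_ ?_
  · funext z; rw [this, if_pos z.2]
  · intro j k M' h; rw [hval]; exact h
  · simp
  · intro j M' hj hi hN hR h z
    rw [hs ⟨j, hj⟩ M' hi hN hR (by rw [h]; simp), Function.update_apply]
    by_cases hz : z = ⟨j, hj⟩
    · subst hz; simp
    · have : (z : ℕ) ≠ j := fun h' => hz (Fin.ext h')
      rw [if_neg hz, h]
      exact if_congr (by omega) rfl rfl

variable {M : Memory}

/-- The test of `boundaryProg`. -/
abbrev boundaryTest : Test :=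
  .and (.nonzero (.vec 3 (.var 22))) <| .and (.zero (.vec 3 (.var 23))) <|
    .and (.and (.natLE (.vec 4 (.var 23)) (.var 15)) (.natLE (.var 15) (.vec 4 (.var 23)))) <|
    .and (.nonzero (.get 0 (.var 23) (.var 22))) (.zero (.get 2 (.var 23) (.var 22)))

theorem boundaryTest_holds (hadj : ∀ p q, M.nat 0 p q ≠ 0 ↔ AdjN G p q) {p q : Fin n}
    (hp : M.nat 22 0 0 = p) (hq : M.nat 23 0 0 = q) : boundaryTest.Holds G s M ↔
      p ∈ (M.conf n).rem ∧ q ∈ (M.conf n).cls (M.nat 15 0 0) ∧ (M.conf n).Alive G q p := by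
  simp only [Test.Holds, NatExpr.eval, hp, hq, mem_cls, Alive, Memory.conf,
    mem_rowSet, ← adjN_fin (G := G), ← hadj, Nat.le_zero, not_not]
  rw [← le_antisymm_iff]
  tauto

theorem boundaryProg_spec (hadj : ∀ p q, M.nat 0 p q ≠ 0 ↔ AdjN G p q) :
    (boundaryProg.den G s M).rowSet n 5 0 = (M.conf n).nbr G (M.nat 15 0 0) := by
  classical
  set B := (M.conf n).nbr G (M.nat 15 0 0) with hB
  have inner : ∀ (M₁ : Memory) (p : Fin n), (∀ a, a ∉ [22, 23, 5] → M₁.nat a = M.nat a) →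
      M₁.nat 22 0 0 = p → ∀ z : Fin n,
      ((forN 23 (when boundaryTest (.setNat 5 (.const 0) (.var 22) (.const 1)))).den G s M₁).nat
        5 0 z = if z = p ∧ p ∈ B then 1 else M₁.nat 5 0 z := by
    intro M₁ p h₁ hp
    have := forN_inv (G := G) (s := s) (n := n) (i := 23) (M := M₁)
      (p := when boundaryTest (.setNat 5 (.const 0) (.var 22) (.const 1)))
      (fun j M' => ∀ z : Fin n, M'.nat 5 0 z = if z = p ∧ p ∈ (M.conf n).rem ∧ ∃ q : Fin n,
        (q : ℕ) < j ∧ q ∈ (M.conf n).cls (M.nat 15 0 0) ∧ (M.conf n).Alive G q p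
        then 1 else M₁.nat 5 0 z) ?_ ?_ ?_
    · intro z
      rw [this]
      refine if_congr (and_congr_right fun _ => ?_) rfl rfl
      rw [hB, mem_nbr]
      exact and_congr_right fun _ => exists_congr fun q => ⟨fun h => h.2, fun h => ⟨q.2, h⟩⟩
    · intro j k M' h z; rw [writeNat_nat_of_ne (by decide)]; exact h z
    · simp
    · intro j M' hj hi hN hR h z
      have hN' : ∀ a, a ∉ [22, 23, 5] → M'.nat a = M.nat a := fun a ha => by
        rw [hN a (by revert ha; simp [natWrites]), h₁ a ha]
      have hp' : M'.nat 22 0 0 = p := by rw [hN 22 (by decide), hp]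
      have ht := boundaryTest_holds (G := G) (s := s) (M := M') (p := p) (q := ⟨j, hj⟩)
        (by rw [hN' 0 (by decide)]; exact hadj) hp' hi
      have hc : M'.conf n = M.conf n := conf_congr fun a ha => hN' a (by revert a; decide)
      rw [hc, hN' 15 (by decide)] at ht
      rw [den_ite]
      by_cases hT : boundaryTest.Holds G s M'
      · rw [if_pos hT]
        obtain ⟨h1, h2, h3⟩ := ht.1 hT
        simp only [den_setNat, writeNat_nat, NatExpr.eval, hp', true_and, ← Fin.ext_iff]
        by_cases hz : z = p
        · rw [if_pos hz, if_pos ⟨hz, h1, _, Nat.lt_succ_self j, h2, h3⟩]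
        · rw [if_neg hz, h, if_neg (by tauto), if_neg (by tauto)]
      · rw [if_neg hT, den_skip, h]
        refine if_congr (and_congr_right fun _ => and_congr_right fun h1 => exists_congr fun q => ?_) rfl rfl
        refine ⟨fun h => ⟨h.1.trans (Nat.lt_succ_self j), h.2⟩, fun h => ⟨?_, h.2⟩⟩
        refine (Nat.lt_succ_iff_lt_or_eq.1 h.1).resolve_right fun hq => hT (ht.2 ⟨h1, ?_⟩)
        obtain rfl : q = ⟨j, hj⟩ := Fin.ext hq
        exact h.2
  have := forN_update (G := G) (s := s) (n := n) (i := 22) (M := M)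
    (p := .seq (.setNat 5 (.const 0) (.var 22) (.const 0))
      (forN 23 (when boundaryTest (.setNat 5 (.const 0) (.var 22) (.const 1)))))
    (fun M' (z : Fin n) => M'.nat 5 0 z) (fun z => if z ∈ B then 1 else 0) ?_ ?_
  · ext z
    rw [mem_rowSet]
    have := congrFun this z
    rw [boundaryProg, this]
    simp
  · intro k M'; funext z; rw [writeNat_nat_of_ne (by decide)]
  · intro j M' hj hN hR _
    funext z
    rw [den_seq, inner _ j _ (by simpa using hj)]
    · simp only [den_setNat, writeNat_nat, NatExpr.eval, hj, true_and, ← Fin.ext_iff,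
        Function.update_apply]
      by_cases hz : z = j
      · by_cases hjB : j ∈ B <;> simp [hz, hjB]
      · simp [hz]
    · intro a ha
      rw [den_setNat, writeNat_nat_of_ne (by rintro rfl; simp at ha)]
      exact hN a (by revert ha; simp [natWrites]; tauto)

theorem countProg_spec : (countProg.den G s M).nat 14 0 0 = (M.rowSet n 5 0).card := by
  set M₀ := (setN 14 (.const 0)).den G s M with hM₀
  have := forN_sum (G := G) (s := s) (n := n) (i := 22) (M := M₀)
    (p := when (.nonzero (.vec 5 (.var 22))) (.addN 14 (.const 1))) (fun M' => M'.nat 14 0 0)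
    (fun z => if z ∈ M.rowSet n 5 0 then 1 else 0) (fun k M' => rfl) ?_
  · rw [countProg, den_seq]
    refine this.trans ?_
    rw [Finset.sum_boole, Finset.filter_mem_eq_inter, Finset.univ_inter]
    simp [hM₀]
  · intro j M' hj hN hR
    have h5 : M'.nat 5 = M.nat 5 := by
      rw [hN 5 (by decide), hM₀, den_nat _ (by decide)]
    rw [den_ite]
    have ht : (Test.nonzero (.vec 5 (.var 22))).Holds G s M' ↔ j ∈ M.rowSet n 5 0 := by
      simp only [Test.Holds, NatExpr.eval, hj, h5, mem_rowSet, Nat.le_zero]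
    by_cases hc : j ∈ M.rowSet n 5 0
    · rw [if_pos (ht.2 hc), if_pos hc]; simp
    · rw [if_neg fun h => hc (ht.1 h), if_neg hc]; rfl

theorem activeProg_spec : (activeProg.den G s M).rowSet n 6 0 =
    M.rowSet n 5 0 ∪ (M.conf n).cls (M.nat 15 0 0) := by
  set A := M.rowSet n 5 0 ∪ (M.conf n).cls (M.nat 15 0 0) with hA
  have := forN_update (G := G) (s := s) (n := n) (i := 22) (M := M)
    (p := .ite
      (.not (.and (.zero (.vec 5 (.var 22))) (.not (.and (.zero (.vec 3 (.var 22)))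
        (.and (.natLE (.vec 4 (.var 22)) (.var 15)) (.natLE (.var 15) (.vec 4 (.var 22))))))))
      (.setNat 6 (.const 0) (.var 22) (.const 1)) (.setNat 6 (.const 0) (.var 22) (.const 0)))
    (fun M' (z : Fin n) => M'.nat 6 0 z) (fun z => if z ∈ A then 1 else 0) ?_ ?_
  · ext z
    rw [mem_rowSet, activeProg]
    have := congrFun this z
    rw [this]
    simp
  · intro k M'; funext z; rw [writeNat_nat_of_ne (by decide)]
  · intro j M' hj hN hR _
    have ht : (Test.not (.and (.zero (.vec 5 (.var 22))) (.not (.and (.zero (.vec 3 (.var 22)))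
        (.and (.natLE (.vec 4 (.var 22)) (.var 15)) (.natLE (.var 15) (.vec 4 (.var 22)))))))).Holds
        G s M' ↔ j ∈ A := by
      simp only [Test.Holds, NatExpr.eval, hj, hN 5 (by decide), hN 3 (by decide),
        hN 4 (by decide), hN 15 (by decide), hA, Finset.mem_union, mem_rowSet, mem_cls, Memory.conf,
        Nat.le_zero]
      rw [← le_antisymm_iff]
      tauto
    rw [den_ite]
    funext z
    by_cases hc : j ∈ A
    · rw [if_pos (ht.2 hc), if_pos hc]
      simp [hj, Function.update_apply, Fin.ext_iff]
    · rw [if_neg fun h => hc (ht.1 h), if_neg hc]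
      simp [hj, Function.update_apply, Fin.ext_iff]

end SProg
end OracleRAM

/-! ### Cutting out a ball in the memory -/

namespace OracleRAM

open Conf

variable {n : ℕ} {G : SimpleGraph (Fin n)} {s : LPSolution n} {w : ℕ}

namespace SProg

variable {β : BallData n} {M : Memory}

/-- The test of `cutProg`. -/
abbrev cutTest : Test := .and (touchTest (.var 22) (.var 23))
  (.and (.not (outsideTest (.var 22) (.var 23))) (.not (insideTest (.var 22) (.var 23))))

/-- Cutting depends only on whether the pair has been cut before. -/
theorem cutTest_holds (h : BallMem G s β M) {M' : Memory} (hN : ∀ a ∈ [0, 5, 6, 9, 11, 13],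
      M'.nat a = M.nat a) (hR : ∀ a ∈ [0, 1, 2, 3], M'.real a = M.real a) {p q : Fin n}
    (hp : M'.nat 22 0 0 = p) (hq : M'.nat 23 0 0 = q) (h2 : M'.nat 2 p q = M.nat 2 p q) :
    cutTest.Holds G s M' ↔ (p, q) ∈ β.cutPairs (M.real 3 0 0) := by
  classical
  -- While pairs are being cut, the stored set of cut pairs no longer matches `β.T`. The memory
  -- represents data that differ only in `T`, and membership of the pair in question is unaffected.
  set T' : Finset (Fin n × Fin n) := Finset.univ.filter fun pq =>
    M'.nat 0 pq.1 pq.2 ≠ 0 ∧ M'.nat 2 pq.1 pq.2 = 0 ∧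
    ((M'.nat 6 0 pq.1 ≠ 0 ∧ M'.nat 5 0 pq.1 = 0) ∨ (M'.nat 6 0 pq.2 ≠ 0 ∧ M'.nat 5 0 pq.2 = 0))
    with hT'
  set β' : BallData n := { β with T := T' } with hβ'
  have e0 := hN 0 (by decide)
  have e5 := hN 5 (by decide)
  have e6 := hN 6 (by decide)
  have h' : BallMem G s β' M' := by
    refine ⟨fun p q => by simp [hβ', hT'], ?_, ?_, ?_, h.edge, ?_, ?_, ?_, ?_, ?_⟩
    · rw [e6]; exact h.active
    · rw [hR 1 (by decide)]; exact h.entry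
    · rw [rowSet_congr e5]; exact h.vert
    · rw [hR 0 (by decide)]; exact h.len
    · rw [hN 13 (by decide)]; exact h.cube
    · rw [hN 9 (by decide)]; exact h.bits
    · rw [hN 11 (by decide)]; exact h.loglog
    · rw [hR 2 (by decide)]; exact h.total
  have hP : (NatExpr.var 22).eval M' = p := hp
  have hQ : (NatExpr.var 23).eval M' = q := hq
  have hT : (p, q) ∈ β'.T ↔ (p, q) ∈ β.T := by rw [h'.pairs, h.pairs, e0, e5, e6, h2]
  have t1 := touchTest_holds h' hP hQ
  have t2 := outsideTest_holds h' hP hQ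
  have t3 := insideTest_holds h' hP hQ
  rw [hT] at t1
  rw [hR 3 (by decide)] at t2 t3
  rw [BallData.cutPairs, Finset.mem_filter]
  exact and_congr t1 (and_congr (not_congr t2) (not_congr t3))

/-- Although the loop alters the array that its test reads, each test looks only at the entry of its
own pair, which has not been touched before. -/
theorem cutProg_spec (h : BallMem G s β M) (p q : Fin n) :
    (cutProg.den G s M).nat 2 p q ≠ 0 ↔
      M.nat 2 p q ≠ 0 ∨ (p, q) ∈ β.cutPairs (M.real 3 0 0) := by
  classical
  set Q := β.cutPairs (M.real 3 0 0) with hQ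
  have inner : ∀ (M₁ : Memory) (p : Fin n), (∀ a, a ∉ [22, 23, 2] → M₁.nat a = M.nat a) →
      M₁.real = M.real → M₁.nat 22 0 0 = p → (∀ q : Fin n, M₁.nat 2 p q = M.nat 2 p q) →
      ∀ p' q' : Fin n,
      ((forN 23 (when cutTest (.setNat 2 (.var 22) (.var 23) (.const 1)))).den G s M₁).nat 2 p' q' =
        if p' = p ∧ (p, q') ∈ Q then 1 else M₁.nat 2 p' q' := by
    intro M₁ p h₁ hR₁ hp h2
    have := forN_inv (G := G) (s := s) (n := n) (i := 23) (M := M₁)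
      (p := when cutTest (.setNat 2 (.var 22) (.var 23) (.const 1)))
      (fun j M' => ∀ p' q' : Fin n, M'.nat 2 p' q' =
        if p' = p ∧ (p, q') ∈ Q ∧ (q' : ℕ) < j then 1 else M₁.nat 2 p' q') ?_ ?_ ?_
    · intro p' q'
      rw [this]; simp
    · intro j k M' h p' q'; rw [writeNat_nat_of_ne (by decide)]; exact h p' q'
    · simp
    · intro j M' hj hi hN hR hI p' q'
      have hp' : M'.nat 22 0 0 = p := by rw [hN 22 (by decide), hp]
      have ht := cutTest_holds (M' := M') h (p := p) (q := ⟨j, hj⟩)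
        (fun a ha => by
          have h1 : a ∉ [22, 23, 2] := by revert a; decide
          rw [hN a (by revert h1; simp [natWrites]), h₁ a h1])
        (fun a ha => by rw [hR a (by simp [realWrites]), hR₁]) hp' hi
        (by rw [hI, if_neg (by simp), h2])
      rw [← hQ] at ht
      rw [den_ite]
      by_cases hT : (p, (⟨j, hj⟩ : Fin n)) ∈ Q
      · rw [if_pos (ht.2 hT)]
        simp only [den_setNat, writeNat_nat, NatExpr.eval, hp', hi, true_and, ← Fin.ext_iff]
        by_cases hz : p' = p ∧ (q' : ℕ) = j
        · obtain ⟨rfl, hz⟩ := hz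
          obtain rfl : q' = ⟨j, hj⟩ := Fin.ext hz
          simp [hT]
        · rw [if_neg hz, hI]
          refine if_congr (and_congr_right fun h1 => and_congr_right fun _ => ?_) rfl rfl
          have : (q' : ℕ) ≠ j := fun h' => hz ⟨h1, h'⟩
          omega
      · rw [if_neg fun h' => hT (ht.1 h'), den_skip, hI]
        refine if_congr (and_congr_right fun h1 => and_congr_right fun h3 => ?_) rfl rfl
        have : (q' : ℕ) ≠ j := fun h' => hT (by
          obtain rfl : q' = ⟨j, hj⟩ := Fin.ext h'
          exact h3)
        omega
  have := forN_update (G := G) (s := s) (n := n) (i := 22) (M := M)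
    (p := forN 23 (when cutTest (.setNat 2 (.var 22) (.var 23) (.const 1))))
    (fun M' (p q : Fin n) => M'.nat 2 p q) (fun p q => if (p, q) ∈ Q then 1 else M.nat 2 p q) ?_ ?_
  · have := congrFun (congrFun this p) q
    rw [cutProg, this]
    by_cases hc : (p, q) ∈ Q <;> simp [hc]
  · intro k M'; funext z; rw [writeNat_nat_of_ne (by decide)]
  · intro j M' hj hN hR hI
    have hI' : ∀ q : Fin n, M'.nat 2 j q = M.nat 2 j q := fun q => congrFun hI q
    funext p' q'
    rw [inner M' j (fun a ha => hN a (by revert ha; simp [natWrites]))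
      (funext fun a => hR a (by simp [realWrites])) hj hI', Function.update_apply]
    by_cases hz : p' = j
    · subst hz
      rw [if_pos rfl]
      refine if_congr (by simp) rfl ?_
      exact hI' q'
    · simp [hz]

/-- The round for a vertex reads and writes only that vertex's entries, so the outcome can be
described vertex by vertex. A boundary vertex merely becomes inactive, because it is removed
already. -/
theorem relabelProg_spec (hA : ∀ z : Fin n, z ∈ β.A ↔ M.nat 6 0 z ≠ 0)
    (he : ∀ z : Fin n, M.real 1 0 z = β.e z)
    (hv : ∀ z : Fin n, answerY s (M.rowSet n 5 0) z = β.y z) {r : ℝ} (h3 : M.real 3 0 0 = r) :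
    (relabelProg.den G s M).nat 7 0 0 = M.nat 7 0 0 + 1 ∧ ∀ z : Fin n,
      ((relabelProg.den G s M).nat 6 0 z ≠ 0 ↔ z ∈ β.A ∧ r < β.e z) ∧
      ((relabelProg.den G s M).nat 4 0 z = if z ∈ β.A ∧ β.e z ≤ r ∧ z ∉ M.rowSet n 5 0 ∧
        β.e z + β.y z ≤ r then M.nat 7 0 0 + 1 else M.nat 4 0 z) ∧
      ((relabelProg.den G s M).nat 3 0 z ≠ 0 ↔ M.nat 3 0 z ≠ 0 ∨
        (z ∈ β.A ∧ β.e z ≤ r ∧ z ∉ M.rowSet n 5 0 ∧ r < β.e z + β.y z)) := by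
  classical
  set M₀ := (addN 7 (.const 1)).den G s M with hM₀
  have h7 : M₀.nat 7 0 0 = M.nat 7 0 0 + 1 := by simp [hM₀]
  have hN₀ : ∀ a, a ≠ 7 → M₀.nat a = M.nat a := fun a ha =>
    den_nat _ (by simpa [natWrites] using ha) _
  have key := forN_update (G := G) (s := s) (n := n) (i := 22) (M := M₀)
    (p := when (.and (.nonzero (.vec 6 (.var 22))) (.realLE (.vec 1 (.var 22)) (.var 3))) <|
      .seq (.setNat 6 (.const 0) (.var 22) (.const 0)) <|
      when (.zero (.vec 5 (.var 22))) <|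
      .ite (.realLE (exitDist (.var 22)) (.var 3)) (.setNat 4 (.const 0) (.var 22) (.var 7))
        (.setNat 3 (.const 0) (.var 22) (.const 1)))
    (fun M' (z : Fin n) => (M'.nat 6 0 z, M'.nat 4 0 z, M'.nat 3 0 z))
    (fun z => if z ∈ β.A ∧ β.e z ≤ r then
      if z ∈ M.rowSet n 5 0 then (0, M.nat 4 0 z, M.nat 3 0 z) else
        if β.e z + β.y z ≤ r then (0, M.nat 7 0 0 + 1, M.nat 3 0 z) else (0, M.nat 4 0 z, 1)
      else (M.nat 6 0 z, M.nat 4 0 z, M.nat 3 0 z)) ?_ ?_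
  · refine ⟨?_, fun z => ?_⟩
    · rw [relabelProg, den_seq, den_nat _ (by decide), ← hM₀, h7]
    · have k := congrFun key z
      have kk : ((relabelProg.den G s M).nat 6 0 z, (relabelProg.den G s M).nat 4 0 z,
        (relabelProg.den G s M).nat 3 0 z) = _ := k
      by_cases c1 : z ∈ β.A ∧ β.e z ≤ r
      · by_cases c2 : z ∈ M.rowSet n 5 0
        · rw [if_pos c1, if_pos c2, Prod.mk.injEq, Prod.mk.injEq] at kk
          simp [kk.1, kk.2.1, kk.2.2, c1, c2]
        · by_cases c3 : β.e z + β.y z ≤ r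
          · rw [if_pos c1, if_neg c2, if_pos c3, Prod.mk.injEq, Prod.mk.injEq] at kk
            simp [kk.1, kk.2.1, kk.2.2, c1, c2, c3]
          · rw [if_pos c1, if_neg c2, if_neg c3, Prod.mk.injEq, Prod.mk.injEq] at kk
            simp [kk.1, kk.2.1, kk.2.2, c1, c2, c3, not_le.1 c3]
      · rw [if_neg c1, Prod.mk.injEq, Prod.mk.injEq] at kk
        rw [kk.1, kk.2.1, kk.2.2, ← hA]
        refine ⟨⟨fun h => ⟨h, not_le.1 fun h' => c1 ⟨h, h'⟩⟩, fun h => h.1⟩, ?_, ?_⟩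
        · rw [if_neg (by tauto)]
        · tauto
  · intro k M'; funext z; simp
  · intro j M' hj hN hR hI
    rw [Prod.mk.injEq, Prod.mk.injEq] at hI
    obtain ⟨i6, i4, i3⟩ := hI
    rw [hN₀ 6 (by decide)] at i6
    rw [hN₀ 4 (by decide)] at i4
    rw [hN₀ 3 (by decide)] at i3
    have e5 : M'.nat 5 = M.nat 5 := by rw [hN 5 (by decide), hN₀ 5 (by decide)]
    have er : M'.real = M.real := funext fun a => hR a (by simp [realWrites])
    have hv' : answerY s (M'.rowSet n 5 0) j = β.y j := by rw [rowSet_congr e5, hv]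
    have e7 : M'.nat 7 0 0 = M.nat 7 0 0 + 1 := by rw [hN 7 (by decide), h7]
    have t1 : (Test.and (.nonzero (.vec 6 (.var 22))) (.realLE (.vec 1 (.var 22)) (.var 3))).Holds
        G s M' ↔ j ∈ β.A ∧ β.e j ≤ r := by
      simp only [Test.Holds, NatExpr.eval, RealExpr.eval, hj, i6, hA, er, he, h3, Nat.le_zero]
    rw [den_ite]
    by_cases c1 : j ∈ β.A ∧ β.e j ≤ r
    · rw [if_pos (t1.2 c1), if_pos c1, den_seq]
      set M₁ := (SProg.setNat 6 (.const 0) (.var 22) (.const 0)).den G s M' with hM₁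
      have n₁ : ∀ a, a ≠ 6 → M₁.nat a = M'.nat a := fun a ha =>
        den_nat _ (by simpa [natWrites] using ha) _
      have j₁ : M₁.nat 22 0 0 = j := by rw [n₁ 22 (by decide), hj]
      have r₁ : M₁.real = M.real := er
      have n6 : ∀ z : Fin n, M₁.nat 6 0 z = if z = j then 0 else M'.nat 6 0 z := by
        intro z; simp [hM₁, hj, Fin.ext_iff]
      have t2 : (Test.zero (.vec 5 (.var 22))).Holds G s M₁ ↔ ¬ j ∈ M.rowSet n 5 0 := by
        simp only [Test.Holds, NatExpr.eval, j₁, n₁ 5 (by decide), e5, mem_rowSet, Nat.le_zero,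
          not_not]
      have t3 : (Test.realLE (exitDist (.var 22)) (.var 3)).Holds G s M₁ ↔ β.e j + β.y j ≤ r := by
        simp only [Test.Holds, NatExpr.eval, RealExpr.eval, j₁, r₁, he, h3,
          rowSet_congr (n₁ 5 (by decide)), hv']
      rw [den_ite]
      by_cases c2 : j ∈ M.rowSet n 5 0
      · rw [if_neg fun h => t2.1 h c2, if_pos c2, den_skip]
        funext z
        rw [Function.update_apply, n6, n₁ 4 (by decide), n₁ 3 (by decide)]
        by_cases hz : z = j
        · subst hz; simp [i4, i3]
        · simp [hz]
      · rw [if_pos (t2.2 c2), if_neg c2, den_ite]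
        by_cases c3 : β.e j + β.y j ≤ r
        · rw [if_pos (t3.2 c3), if_pos c3]
          funext z
          simp only [den_setNat, writeNat_nat, NatExpr.eval, j₁, true_and, ← Fin.ext_iff,
            n6, n₁ 4 (by decide), n₁ 3 (by decide), n₁ 7 (by decide), e7, Function.update_apply]
          by_cases hz : z = j
          · subst hz; simp [i3]
          · simp [hz]
        · rw [if_neg fun h => c3 (t3.1 h), if_neg c3]
          funext z
          simp only [den_setNat, writeNat_nat, NatExpr.eval, j₁, true_and, ← Fin.ext_iff,
            n6, n₁ 4 (by decide), n₁ 3 (by decide), Function.update_apply]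
          by_cases hz : z = j
          · subst hz; simp [i4]
          · simp [hz]
    · rw [if_neg fun h => c1 (t1.1 h), if_neg c1, den_skip]
      funext z
      rw [Function.update_apply]
      by_cases hz : z = j
      · subst hz; simp [i6, i4, i3]
      · simp [hz]

end SProg
end OracleRAM

/-! ### The invariants of the algorithm -/

namespace OracleRAM

open Conf

variable {n : ℕ} {G : SimpleGraph (Fin n)} {s : LPSolution n} {w : ℕ}

/-- Numerical properties of the parameters. -/
structure Bounds (G : SimpleGraph (Fin n)) (s : LPSolution n) (w b l Λ : ℕ) (σ : ℝ) : Prop where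
  pos : 0 < σ
  sum_le : ∑ p : Fin n, ∑ q : Fin n, answerX G s p q ≤ σ
  bits_pos : 1 ≤ b
  bits_le : b ≤ n
  loglog_pos : 1 ≤ l
  loglog_le : l ≤ n
  scales_le : Λ ≤ n
  lt_pow : (n ^ 3 + 1 : ℝ) < 16 ^ Λ
  log_log : Real.log (1 + Real.log (n ^ 3 + 1)) ≤ 3 * l
  log_bits : Real.log (1024 * b * w + 1) ≤ 14 * b

section

variable {b l Λ : ℕ} {σ : ℝ}

theorem Bounds.volume_le (hs : s.Feasible G w) (h : Bounds G s w b l Λ σ) (c : Conf n)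
    (B A : Finset (Fin n)) (e : Fin n → ℝ) :
    (c.ballData G s B A e (n ^ 3) b l σ).W + σ ≤ (n ^ 3 + 1) * σ := by
  have h1 : (c.ballData G s B A e (n ^ 3) b l σ).W ≤
      ∑ p : Fin n, ∑ q : Fin n, (n ^ 3 : ℕ) * answerX G s p q := by
    rw [← Fintype.sum_prod_type' (f := fun p q : Fin n => ((n ^ 3 : ℕ) : ℝ) * answerX G s p q)]
    exact Finset.sum_le_sum_of_subset_of_nonneg (Finset.subset_univ _) fun pq _ _ =>
      mul_nonneg (Nat.cast_nonneg _) (answerX_nonneg hs _ _)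
  simp only [← Finset.mul_sum] at h1
  have h2 := mul_le_mul_of_nonneg_left h.sum_le (Nat.cast_nonneg (α := ℝ) (n ^ 3))
  push_cast at h1 h2
  linarith

theorem Bounds.volume_nonneg (hs : s.Feasible G w) (c : Conf n)
    (B A : Finset (Fin n)) (e : Fin n → ℝ) : 0 ≤ (c.ballData G s B A e (n ^ 3) b l σ).W :=
  Finset.sum_nonneg fun _ _ => mul_nonneg (Nat.cast_nonneg _) (answerX_nonneg hs _ _)

/-- The smaller side is at least `σ` and the volume plus seed at most `(n³ + 1) σ`, so at most `Λ`
factors of `16` lie between them. -/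
theorem Bounds.scales_le_of (hs : s.Feasible G w) (h : Bounds G s w b l Λ σ) (c : Conf n)
    (B A : Finset (Fin n)) (e : Fin n → ℝ) (r : ℝ) :
    (c.ballData G s B A e (n ^ 3) b l σ).scales r ≤ Λ := by
  set β := c.ballData G s B A e (n ^ 3) b l σ with hβ
  have hx : ∀ p q, 0 ≤ β.x p q := fun p q => answerX_nonneg hs _ _
  obtain ⟨-, h1, h2⟩ := BallData.scales_spec (β := β) hx h.pos r
  have h3 : β.σ ≤ β.small r := SProg.small_ge hx r
  have h4 := h.volume_le hs c B A e
  have hσ := h.pos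
  have h5 : (16 : ℝ) ^ (β.scales r - 1) * σ < 16 ^ Λ * σ :=
    calc (16 : ℝ) ^ (β.scales r - 1) * σ ≤ 16 ^ (β.scales r - 1) * β.small r :=
          mul_le_mul_of_nonneg_left h3 (by positivity)
      _ ≤ (n ^ 3 + 1) * σ := h2.trans h4
      _ < 16 ^ Λ * σ := mul_lt_mul_of_pos_right h.lt_pow hσ
  have h6 := (pow_lt_pow_iff_right₀ (by norm_num : (1 : ℝ) < 16)).1 (lt_of_mul_lt_mul_right h5 hσ.le)
  omega

/-- The hypotheses of region growing hold because the ratio of volume to seed is at most `n³ + 1`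
and the vertex volume is within the LP budget `w`. -/
theorem Bounds.exists_fit (hs : s.Feasible G w) (h : Bounds G s w b l Λ σ) (c : Conf n)
    {B A : Finset (Fin n)} {u : Fin n} {e : Fin n → ℝ} (he : EntryDist G s B u e) :
    ∃ r, SProg.Fit (c.ballData G s B A e (n ^ 3) b l σ) r := by
  set β := c.ballData G s B A e (n ^ 3) b l σ with hβ
  have hn : 0 < n := u.pos
  have hW := h.volume_le hs c B A e
  have hW0 : 0 ≤ β.W := Bounds.volume_nonneg hs c B A e
  have hσ := h.pos
  have hdiv : (β.W + σ) / σ ≤ n ^ 3 + 1 := (div_le_iff₀ hσ).2 hW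
  have hdiv1 : 1 ≤ (β.W + σ) / σ := (one_le_div hσ).2 (by linarith)
  refine BallData.exists_good (β := β) (fun p q => answerX_nonneg hs _ _) (fun p => answerX_self _)
    (fun p q => answerX_symm _ _) he.nonneg (fun z => hs.y_nonneg B z) (pow_pos hn 3) h.pos
    h.bits_pos h.loglog_pos ⟨u, he.self⟩ ?_ ?_
  · refine le_trans (Real.log_le_log ?_ ?_) h.log_log
    · have := Real.log_nonneg hdiv1
      change 0 < 1 + Real.log ((β.W + σ) / σ)
      linarith
    · exact add_le_add le_rfl (Real.log_le_log (zero_lt_one.trans_le hdiv1) hdiv)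
  · refine le_trans (Real.log_le_log ?_ ?_) h.log_bits
    · have : 0 ≤ ∑ z ∈ β.A, β.y z := Finset.sum_nonneg fun z _ => hs.y_nonneg B z
      positivity
    · have : ∑ z ∈ β.A, β.y z ≤ w := (Finset.sum_le_sum_of_subset_of_nonneg
        (Finset.subset_univ _) fun z _ _ => hs.y_nonneg B z).trans (hs.budget B)
      have h0 : (0 : ℝ) ≤ 1024 * b := by positivity
      exact add_le_add (mul_le_mul_of_nonneg_left this h0) le_rfl

end

namespace SProg

variable {M : Memory} {b l Λ : ℕ} {σ : ℝ}

theorem Params.congr (h : Params G s w b l σ M) {M' : Memory}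
    (hN : ∀ a ∈ [0, 9, 11, 12, 13], M'.nat a = M.nat a) (hR : ∀ a ∈ [0, 2], M'.real a = M.real a) :
    Params G s w b l σ M' := by
  refine ⟨?_, ?_, ?_, ?_, ?_, ?_, ?_⟩
  · rw [hN 0 (by decide)]; exact h.adj
  · rw [hN 9 (by decide)]; exact h.bits
  · rw [hN 11 (by decide)]; exact h.loglog
  · rw [hN 12 (by decide)]; exact h.bound
  · rw [hN 13 (by decide)]; exact h.cube
  · rw [hR 0 (by decide)]; exact h.len
  · rw [hR 2 (by decide)]; exact h.total

theorem Params.den (h : Params G s w b l σ M) (p : SProg)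
    (hN : ∀ a ∈ [0, 9, 11, 12, 13], a ∉ p.natWrites) (hR : ∀ a ∈ [0, 2], a ∉ p.realWrites) :
    Params G s w b l σ (p.den G s M) :=
  h.congr (fun a ha => den_nat p (hN a ha) M) fun a ha => den_real p (hR a ha) M

/-- The bridge between memory and combinatorics: one run of the program acts on the stored
configuration exactly as `afterBall` does, for a radius that meets all requirements of
`PhaseInv.ball` and `CostInv.ball`. -/
theorem ballProg_spec (hs : s.Feasible G w) (hP : Params G s w b l σ M)
    (hB : Bounds G s w b l Λ σ) {u : Fin n} (hu : M.nat 21 0 0 = u) :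
    ∃ e r, EntryDist G s (M.rowSet n 5 0) u e ∧ 0 ≤ r ∧
      Fit ((M.conf n).ballData G s (M.rowSet n 5 0) (M.rowSet n 6 0) e (n ^ 3) b l σ) r ∧
      (ballProg.den G s M).conf n = (M.conf n).afterBall
        ((M.conf n).ballData G s (M.rowSet n 5 0) (M.rowSet n 6 0) e (n ^ 3) b l σ)
        (M.rowSet n 5 0) r ∧
      (ballProg.den G s M).rowSet n 6 0 = (M.rowSet n 6 0).filter fun z => r < e z := by
  classical
  set B := M.rowSet n 5 0 with hBdef
  set A := M.rowSet n 6 0 with hAdef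
  set M₁ := distProg.den G s M with hM₁
  set e : Fin n → ℝ := fun z => M₁.real 1 0 z with he
  have hdist : EntryDist G s B u e := distProg_spec hs hP.adj hu
  set β := (M.conf n).ballData G s B A e (n ^ 3) b l σ with hβ
  have n₁ : ∀ a, a ∉ [22, 23, 24] → M₁.nat a = M.nat a := fun a ha =>
    den_nat _ (by revert ha; simp [distProg, natWrites]) _
  have hP₁ : Params G s w b l σ M₁ := hP.den _ (by decide) (by decide)
  have h₁ : BallMem G s β M₁ := by
    refine ⟨fun p q => ?_, fun z => ?_, fun z => rfl, fun z => ?_, fun p q => rfl,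
      fun p q => hP₁.len p q, hP₁.cube, hP₁.bits, hP₁.loglog, hP₁.total⟩
    · rw [n₁ 0 (by decide), n₁ 2 (by decide), n₁ 6 (by decide), n₁ 5 (by decide)]
      refine mem_touch.trans ?_
      simp only [Finset.mem_sdiff, hAdef, hBdef, mem_rowSet, Alive, Memory.conf,
        ← adjN_fin (G := G), ← hP.adj, not_not]
      tauto
    · rw [n₁ 6 (by decide)]; exact mem_rowSet
    · rw [rowSet_congr (n₁ 5 (by decide))]; exact answerY_fin _ _
  have hx : ∀ p q, 0 ≤ β.x p q := fun p q => answerX_nonneg hs _ _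
  have hfit := searchProg_spec h₁ hx hB.bits_le hB.loglog_le (by
    have h1 := hB.volume_le hs (M.conf n) B A e
    have h2 : (16 : ℝ) ^ Λ ≤ 16 ^ n := pow_le_pow_right₀ (by norm_num) hB.scales_le
    have h3 := mul_lt_mul_of_pos_right (hB.lt_pow.trans_le h2) hB.pos
    exact h1.trans_lt h3) (hB.exists_fit hs (M.conf n) hdist)
  set M₂ := searchProg.den G s M₁ with hM₂
  set r := M₂.real 3 0 0 with hr
  have n₂ : ∀ a, a ∉ [16, 17, 18, 22, 23, 24, 25] → M₂.nat a = M₁.nat a := fun a ha =>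
    den_nat _ (by revert ha; simp [searchProg, testProg, pairSums, vertSums, multProg, scalesProg, natWrites]; tauto) _
  have h₂ : BallMem G s β M₂ := h₁.congr
    (fun a ha => den_nat _ (by revert a; decide) _) fun a ha => den_real _ (by revert a; decide) _
  set M₃ := cutProg.den G s M₂ with hM₃
  have hcut := cutProg_spec h₂
  rw [← hM₃, ← hr] at hcut
  have n₃ : ∀ a, a ∉ [2, 22, 23] → M₃.nat a = M₂.nat a := fun a ha =>
    den_nat _ (by revert ha; simp [cutProg, natWrites]; tauto) _
  have r₃ : M₃.real = M₂.real := funext fun a => den_real _ (by simp [cutProg, realWrites]) _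
  have hrow5 : M₃.rowSet n 5 0 = B := by
    rw [rowSet_congr (n₃ 5 (by decide)), rowSet_congr (n₂ 5 (by decide)),
      rowSet_congr (n₁ 5 (by decide))]
  obtain ⟨t7, tz⟩ := relabelProg_spec (s := s) (G := G) (β := β) (M := M₃) (r := r)
    (fun z => by rw [n₃ 6 (by decide)]; exact h₂.active z)
    (fun z => by rw [r₃]; exact h₂.entry z)
    (fun z => by rw [rowSet_congr (n₃ 5 (by decide))]; exact h₂.vert z) (by rw [r₃])
  have hM₄ : ballProg.den G s M = relabelProg.den G s M₃ := rfl
  have back : ∀ a ∈ [3, 4, 7], M₃.nat a = M.nat a := fun a ha => by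
    rw [n₃ a (by revert a; decide), n₂ a (by revert a; decide), n₁ a (by revert a; decide)]
  refine ⟨e, r, hdist, ?_, hfit, ?_, ?_⟩
  · rcases hfit.1 with ⟨p, hp⟩ | ⟨p, q, hp⟩
    · rw [hp]; exact hdist.nonneg p
    · rw [hp]
      exact add_nonneg (add_nonneg (hdist.nonneg p) (hs.y_nonneg B p)) (hx p q)
  · rw [hM₄]
    have c1 : (fun p q : Fin n => (relabelProg.den G s M₃).nat 2 p q ≠ 0) =
        fun p q => (M.conf n).cut p q ∨ (p, q) ∈ β.cutPairs r := by
      funext p q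
      rw [den_nat relabelProg (by decide), hcut, n₂ 2 (by decide), n₁ 2 (by decide)]
      rfl
    have c2 : (relabelProg.den G s M₃).rowSet n 3 0 = (M.conf n).rem ∪ (β.cutVerts r \ B) := by
      ext z
      rw [mem_rowSet, (tz z).2.2, hrow5, Finset.mem_union, Finset.mem_sdiff, BallData.cutVerts,
        Finset.mem_filter, back 3 (by decide)]
      refine or_congr mem_rowSet.symm ?_
      tauto
    have c3 : (fun z : Fin n => (relabelProg.den G s M₃).nat 4 0 z) = fun z =>
        if z ∈ β.A ∧ z ∉ B ∧ β.e z + β.y z ≤ r then (M.conf n).top + 1 else (M.conf n).lab z := by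
      funext z
      rw [(tz z).2.1, hrow5, back 4 (by decide), back 7 (by decide)]
      -- The program also requires the entry distance to be within `r`; this follows from the exit
      -- distance, since `y` is nonnegative.
      refine if_congr ⟨fun h => ⟨h.1, h.2.2⟩, fun h => ⟨h.1, ?_, h.2⟩⟩ rfl rfl
      have : 0 ≤ β.y z := hs.y_nonneg B z
      linarith [h.2.2]
    have c4 : (relabelProg.den G s M₃).nat 7 0 0 = (M.conf n).top + 1 := by
      rw [t7, back 7 (by decide)]; rfl
    change Conf.mk _ _ _ _ = Conf.mk _ _ _ _
    rw [Conf.mk.injEq]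
    exact ⟨c1, c2, funext fun z => (congrFun c3 z).trans (if_congr Iff.rfl rfl rfl), c4⟩
  · rw [hM₄]
    ext z
    rw [mem_rowSet, (tz z).1, Finset.mem_filter]
    rfl


/-- Invariant of the loop that cuts out balls. -/
def BallLoopInv (G : SimpleGraph (Fin n)) (s : LPSolution n) (b l Λ : ℕ) (σ Ψ : ℝ) (c₀ : Conf n)
    (ℓ : ℕ) (v : Fin n) (j : ℕ) (c : Conf n) (B A : Finset (Fin n)) : Prop :=
  (∃ Q I, PhaseInv G s b c₀ ℓ v B c A Q I) ∧ CostInv G s (n ^ 3) l σ Ψ Λ c ∧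
    c.top ≤ c₀.top + j ∧ ∀ z : Fin n, (z : ℕ) < j → z ∉ B ∩ A

/-- The loop visits every vertex once, and a vertex of `B` still active when visited becomes the
centre of a ball and turns inactive. Thus no active boundary vertex survives, and at most `n` balls
are cut out. -/
theorem phaseProg_spec (hs : s.Feasible G w) (hP : Params G s w b l σ M)
    (hB : Bounds G s w b l Λ σ) {Ψ : ℝ} {K : ℕ} {c₀ : Conf n} (h₀ : StepInv G K c₀)
    {v : Fin n} (hv : v ∉ c₀.rem) (hc : M.conf n = c₀.remove v) (h15 : M.nat 15 0 0 = c₀.lab v)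
    (h5 : M.rowSet n 5 0 = c₀.nbr G (c₀.lab v)) (hcost : CostInv G s (n ^ 3) l σ Ψ Λ c₀) :
    ∃ A, BallLoopInv G s b l Λ σ Ψ c₀ (c₀.lab v) v n ((phaseProg.den G s M).conf n)
      (c₀.nbr G (c₀.lab v)) A := by
  classical
  set B := c₀.nbr G (c₀.lab v) with hBdef
  set M₁ := activeProg.den G s M with hM₁
  have n₁ : ∀ a, a ∉ [22, 6] → M₁.nat a = M.nat a := fun a ha =>
    den_nat _ (by revert ha; simp [activeProg, natWrites]) _
  have hA : M₁.rowSet n 6 0 = B ∪ (c₀.remove v).cls (c₀.lab v) := by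
    rw [hM₁, activeProg_spec, h5, hc, h15]
  have hP₁ : Params G s w b l σ M₁ := hP.den _ (by decide) (by decide)
  have := forN_inv (G := G) (s := s) (n := n) (i := 21) (M := M₁)
    (p := when (.and (.nonzero (.vec 6 (.var 21))) (.nonzero (.vec 5 (.var 21)))) ballProg)
    (fun j M' => BallLoopInv G s b l Λ σ Ψ c₀ (c₀.lab v) v j (M'.conf n) B (M'.rowSet n 6 0))
    ?_ ?_ ?_
  · exact ⟨_, this⟩
  · intro j k M' h
    rw [conf_congr (M := M') fun a ha => writeNat_nat_of_ne (by rintro rfl; revert ha; decide) _ _ _ _,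
      rowSet_congr (M := M') (writeNat_nat_of_ne (by decide) _ _ _ _)]
    exact h
  · refine ⟨⟨∅, fun _ => ∅, ?_⟩, ?_, ?_, fun z hz => by omega⟩
    · rw [conf_congr (M := M) fun a ha => n₁ a (by revert a; decide), hc, hA]
      exact PhaseInv.init hs h₀ hv
    · rw [conf_congr (M := M) fun a ha => n₁ a (by revert a; decide), hc]
      exact hcost.remove hs hB.pos v
    · rw [conf_congr (M := M) fun a ha => n₁ a (by revert a; decide), hc]
      exact le_rfl
  · rintro j M' hj hi hN hR ⟨⟨Q, I, hI⟩, hcost', htop, hout⟩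
    have e5 : M'.rowSet n 5 0 = B := by
      rw [rowSet_congr (hN 5 (by decide)), rowSet_congr (n₁ 5 (by decide)), h5]
    have hP' : Params G s w b l σ M' := hP₁.congr (fun a ha => hN a (by revert a; decide))
      fun a ha => hR a (by revert a; decide)
    have ht : (Test.and (.nonzero (.vec 6 (.var 21))) (.nonzero (.vec 5 (.var 21)))).Holds G s M' ↔
        (⟨j, hj⟩ : Fin n) ∈ B ∩ M'.rowSet n 6 0 := by
      rw [Finset.mem_inter, ← e5, mem_rowSet, mem_rowSet]
      simp only [Test.Holds, NatExpr.eval, hi, Nat.le_zero]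
      tauto
    have hlast : ∀ z : Fin n, (z : ℕ) < j + 1 → (z : ℕ) < j ∨ z = ⟨j, hj⟩ := fun z hz =>
      (Nat.lt_succ_iff_lt_or_eq.1 hz).imp_right Fin.ext
    rw [den_ite]
    by_cases hu : (⟨j, hj⟩ : Fin n) ∈ B ∩ M'.rowSet n 6 0
    · rw [if_pos (ht.2 hu)]
      obtain ⟨e, r, hdist, hr0, hfit, hconf, hrow⟩ := ballProg_spec hs hP' hB (u := ⟨j, hj⟩) hi
      rw [e5] at hdist hfit hconf
      rw [hconf, hrow]
      obtain ⟨huB, huA⟩ := Finset.mem_inter.1 hu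
      refine ⟨hI.ball hs huA huB hdist hr0 hfit.2.1 hfit.2.2, ?_, ?_, ?_⟩
      · exact hcost'.ball hs hB.pos hI.active_eq (hI.ell_le.trans hI.top_le) hI.lab_le hdist
          hfit.2.2 (hB.scales_le_of hs _ _ _ _ _)
      · change (M'.conf n).top + 1 ≤ _
        omega
      · intro z hz hmem
        obtain ⟨h1, h2⟩ := Finset.mem_inter.1 hmem
        obtain ⟨h2, h3⟩ := Finset.mem_filter.1 h2
        rcases hlast z hz with hz | rfl
        · exact hout z hz (Finset.mem_inter.2 ⟨h1, h2⟩)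
        · rw [hdist.self] at h3; linarith
    · rw [if_neg fun h => hu (ht.1 h), den_skip]
      refine ⟨⟨Q, I, hI⟩, hcost', by omega, fun z hz => ?_⟩
      rcases hlast z hz with hz | rfl
      · exact hout z hz
      · exact hu

/-- The number of vertices that are cut in a phase. -/
theorem card_cut_le (hs : s.Feasible G w) {c₀ c : Conf n} {ℓ : ℕ} {v : Fin n}
    {B A Q : Finset (Fin n)} {I : ℕ → Finset (Fin n)} (h : PhaseInv G s b c₀ ℓ v B c A Q I)
    (hB : B.card ≤ 1024 * (b * w)) : 9 * Q.card ≤ 2 * (1024 * (b * w)) := by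
  have h1 := h.cost
  have h2 : ∑ z ∈ Finset.univ \ A, s.y B z ≤ w := (Finset.sum_le_sum_of_subset_of_nonneg
    (Finset.subset_univ _) fun z _ _ => hs.y_nonneg B z).trans (hs.budget B)
  have h3 : ((B \ A).card : ℝ) ≤ (1024 * (b * w) : ℕ) := by
    exact_mod_cast (Finset.card_le_card Finset.sdiff_subset).trans hB
  have h4 := mul_le_mul_of_nonneg_left h2 (Nat.cast_nonneg (α := ℝ) b)
  push_cast at h3
  have : (9 * Q.card : ℝ) ≤ 2 * (1024 * (b * w)) := by linarith
  exact_mod_cast this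

/-- Invariant of the main loop. -/
structure MainInv (G : SimpleGraph (Fin n)) (s : LPSolution n) (w b l Λ : ℕ) (σ Ψ : ℝ) (j : ℕ)
    (M : Memory) : Prop where
  params : Params G s w b l σ M
  step : StepInv G (1024 * (b * w)) (M.conf n)
  cost : CostInv G s (n ^ 3) l σ Ψ Λ (M.conf n)
  top_le : (M.conf n).top ≤ j * n
  mem_rem : ∀ z : Fin n, (z : ℕ) < j → z ∈ (M.conf n).rem

/-- The boundary never exceeds `K`, so the phase runs only when it has exactly `K` elements.
Otherwise the empty phase, with `Q = ∅`, already yields the invariant because there is room for `v`.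
-/
theorem stepProg_spec (hs : s.Feasible G w) (hw : 0 < w) (hB : Bounds G s w b l Λ σ) {Ψ : ℝ} {j : ℕ}
    (hj : j < n) (h : MainInv G s w b l Λ σ Ψ j M) (h20 : M.nat 20 0 0 = j)
    (hrem : (⟨j, hj⟩ : Fin n) ∉ (M.conf n).rem) :
    MainInv G s w b l Λ σ Ψ (j + 1) (stepProg.den G s M) := by
  classical
  set v : Fin n := ⟨j, hj⟩ with hv
  set c₀ := M.conf n with hc₀
  set K := 1024 * (b * w) with hK
  have hK9 : 9 ≤ K := by
    have : 1 ≤ b * w := Nat.mul_pos hB.bits_pos hw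
    omega
  set M₁ := (setN 15 (.vec 4 (.var 20))).den G s M with hM₁
  set M₂ := boundaryProg.den G s M₁ with hM₂
  set M₃ := countProg.den G s M₂ with hM₃
  set M₄ := (SProg.setNat 3 (.const 0) (.var 20) (.const 1)).den G s M₃ with hM₄
  have n₁ : ∀ a, a ∉ [15] → M₁.nat a = M.nat a := fun a ha =>
    den_nat _ (by revert ha; simp [natWrites]) _
  have n₂ : ∀ a, a ∉ [5, 22, 23] → M₂.nat a = M₁.nat a := fun a ha =>
    den_nat _ (by revert ha; simp [boundaryProg, natWrites]; tauto) _
  have n₃ : ∀ a, a ∉ [14, 22] → M₃.nat a = M₂.nat a := fun a ha =>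
    den_nat _ (by revert ha; simp [countProg, natWrites]; tauto) _
  have n₄ : ∀ a, a ∉ [3] → M₄.nat a = M₃.nat a := fun a ha =>
    den_nat _ (by revert ha; simp [natWrites]) _
  have hP₁ : Params G s w b l σ M₁ := h.params.den _ (by decide) (by decide)
  have hP₂ : Params G s w b l σ M₂ := hP₁.den _ (by decide) (by decide)
  have hP₃ : Params G s w b l σ M₃ := hP₂.den _ (by decide) (by decide)
  have hP₄ : Params G s w b l σ M₄ := hP₃.den _ (by decide) (by decide)
  have h15 : M₁.nat 15 0 0 = c₀.lab v := by simp [hM₁, h20, hc₀, Memory.conf, hv]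
  have h5 : M₂.rowSet n 5 0 = c₀.nbr G (c₀.lab v) := by
    rw [hM₂, boundaryProg_spec hP₁.adj, h15,
      conf_congr (M := M) fun a ha => n₁ a (by revert a; decide)]
  have h14 : M₃.nat 14 0 0 = (c₀.nbr G (c₀.lab v)).card := by rw [hM₃, countProg_spec, h5]
  have hconf₃ : M₃.conf n = c₀ := by
    rw [conf_congr (M := M₂) fun a ha => n₃ a (by revert a; decide),
      conf_congr (M := M₁) fun a ha => n₂ a (by revert a; decide),
      conf_congr (M := M) fun a ha => n₁ a (by revert a; decide)]
  have h20' : M₃.nat 20 0 0 = j := by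
    rw [n₃ 20 (by decide), n₂ 20 (by decide), n₁ 20 (by decide), h20]
  have hconf₄ : M₄.conf n = c₀.remove v := by
    rw [← hconf₃]
    change Conf.mk _ _ _ _ = Conf.mk _ _ _ _
    rw [Conf.mk.injEq]
    refine ⟨rfl, ?_, rfl, rfl⟩
    ext z
    change z ∈ M₄.rowSet n 3 0 ↔ z ∈ insert v (M₃.rowSet n 3 0)
    rw [Finset.mem_insert, mem_rowSet, mem_rowSet]
    simp only [hM₄, den_setNat, writeNat_nat, NatExpr.eval, h20', true_and, hv, Fin.ext_iff]
    split_ifs with hz <;> simp [hz]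
  have h5₄ : M₄.rowSet n 5 0 = c₀.nbr G (c₀.lab v) := by
    rw [rowSet_congr (n₄ 5 (by decide)), rowSet_congr (n₃ 5 (by decide)), h5]
  have h15₄ : M₄.nat 15 0 0 = c₀.lab v := by
    rw [n₄ 15 (by decide), n₃ 15 (by decide), n₂ 15 (by decide), h15]
  have hcard := h.step.card_nbr (c₀.lab v)
  have ht : (Test.natLE (.var 12) (.var 14)).Holds G s M₄ ↔
      K ≤ (c₀.nbr G (c₀.lab v)).card := by
    simp only [Test.Holds, NatExpr.eval, hP₄.bound, n₄ 14 (by decide), h14, hK]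
  have hfin : stepProg.den G s M = (when (.natLE (.var 12) (.var 14)) phaseProg).den G s M₄ := rfl
  have hremove : ∀ {c : Conf n} {A Q : Finset (Fin n)} {I : ℕ → Finset (Fin n)},
      PhaseInv G s b c₀ (c₀.lab v) v (c₀.nbr G (c₀.lab v)) c A Q I →
      ∀ z : Fin n, (z : ℕ) < j + 1 → z ∈ c.rem := by
    intro c A Q I hI z hz
    rw [hI.rem_eq]
    refine Finset.mem_union_left _ ?_
    rcases Nat.lt_succ_iff_lt_or_eq.1 hz with hz | hz
    · exact Finset.mem_insert_of_mem (h.mem_rem z hz)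
    · obtain rfl : z = v := Fin.ext hz
      exact Finset.mem_insert_self _ _
  rw [hfin, den_ite]
  by_cases hc : K ≤ (c₀.nbr G (c₀.lab v)).card
  · rw [if_pos (ht.2 hc)]
    obtain ⟨A, ⟨Q, I, hI⟩, hcost, htop, hout⟩ := phaseProg_spec hs hP₄ hB h.step hrem hconf₄ h15₄
      h5₄ h.cost
    refine ⟨hP₄.den _ (by decide) (by decide), ?_, hcost, ?_, hremove hI⟩
    · refine hI.finish hK9 h.step (card_cut_le hs hI hcard) (Or.inl ?_)
      exact Finset.eq_empty_of_forall_notMem fun z => hout z z.2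
    · rw [add_mul, one_mul]
      exact htop.trans (Nat.add_le_add_right h.top_le n)
  · rw [if_neg fun h' => hc (ht.1 h'), den_skip]
    have hI := PhaseInv.init (b := b) hs h.step hrem
    refine ⟨hP₄, ?_, ?_, ?_, ?_⟩
    · rw [hconf₄]
      exact hI.finish hK9 h.step (by simp) (Or.inr ⟨rfl, not_le.1 hc⟩)
    · rw [hconf₄]; exact h.cost.remove hs hB.pos v
    · rw [hconf₄]
      exact h.top_le.trans (Nat.mul_le_mul_right n (Nat.le_succ j))
    · rw [hconf₄]; exact hremove hI

/-- The main loop establishes the invariant for all vertices. -/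
theorem mainLoop_spec (hs : s.Feasible G w) (hw : 0 < w) (hB : Bounds G s w b l Λ σ) {Ψ : ℝ}
    (h : MainInv G s w b l Λ σ Ψ 0 M) :
    MainInv G s w b l Λ σ Ψ n
      ((forN 20 (when (.zero (.vec 3 (.var 20))) stepProg)).den G s M) := by
  refine forN_inv (G := G) (s := s) (n := n) (i := 20) (M := M)
    (p := when (.zero (.vec 3 (.var 20))) stepProg) (MainInv G s w b l Λ σ Ψ) ?_ h ?_
  · intro j k M' h
    have hc : (M'.writeNat 20 0 0 k).conf n = M'.conf n := conf_congr fun a ha =>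
      writeNat_nat_of_ne (by rintro rfl; revert ha; decide) _ _ _ _
    refine ⟨h.params.congr (fun a ha => writeNat_nat_of_ne (by rintro rfl; revert ha; decide) _ _ _ _)
      fun a _ => rfl, ?_, ?_, ?_, ?_⟩
    · rw [hc]; exact h.step
    · rw [hc]; exact h.cost
    · rw [hc]; exact h.top_le
    · rw [hc]; exact h.mem_rem
  · intro j M' hj hi hN hR h
    have ht : (Test.zero (.vec 3 (.var 20))).Holds G s M' ↔
        (⟨j, hj⟩ : Fin n) ∉ (M'.conf n).rem := by
      simp only [Test.Holds, NatExpr.eval, hi, Memory.conf, mem_rowSet, Nat.le_zero, not_not]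
    rw [den_ite]
    by_cases hc : (⟨j, hj⟩ : Fin n) ∈ (M'.conf n).rem
    · rw [if_neg fun h' => ht.1 h' hc, den_skip]
      refine ⟨h.params, h.step, h.cost, ?_, fun z hz => ?_⟩
      · have := h.top_le
        rw [add_mul]; omega
      · rcases Nat.lt_succ_iff_lt_or_eq.1 hz with hz | hz
        · exact h.mem_rem z hz
        · obtain rfl : z = ⟨j, hj⟩ := Fin.ext hz
          exact hc
    · rw [if_pos (ht.2 hc)]
      exact stepProg_spec hs hw hB hj h hi hc

end SProg
end OracleRAM

/-! ### Numerical estimates -/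

namespace OracleRAM

open Conf

variable {n : ℕ} {G : SimpleGraph (Fin n)} {s : LPSolution n} {w : ℕ}

/-- `d` is the number of binary digits of `N`. -/
def IsSize (d N : ℕ) : Prop := N < 2 ^ d ∧ (d = 0 ∨ 2 ^ (d - 1) ≤ N)

/-- A number with `d` digits is at least `2 ^ (d - 1)`, and `1 / log 2 ≤ 3/2`. -/
theorem IsSize.le_log {d N : ℕ} (h : IsSize d N) :
    (d : ℝ) ≤ 1 + 3 / 2 * Real.log N := by
  have hlog := Real.log_two_gt_d9
  have h0 : 0 ≤ Real.log N := Real.log_natCast_nonneg N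
  rcases h.2 with h | h
  · rw [h]; push_cast; linarith
  · rcases Nat.eq_zero_or_pos d with rfl | hd
    · push_cast; linarith
    have h1 : ((2 : ℝ) ^ (d - 1)) ≤ N := by exact_mod_cast h
    have h2 := Real.log_le_log (by positivity) h1
    rw [Real.log_pow, Nat.cast_sub hd, Nat.cast_one] at h2
    have hd' : (1 : ℝ) ≤ d := by exact_mod_cast hd
    nlinarith

theorem log_cube_le {l₁ : ℕ} (h : n < 2 ^ l₁) : Real.log ((n : ℝ) ^ 3 + 1) ≤ 3 * l₁ := by
  have h1 : ((n : ℝ) ^ 3 + 1) ≤ 2 ^ (3 * l₁) := by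
    have h2 : (n : ℝ) + 1 ≤ 2 ^ l₁ := by exact_mod_cast h
    have hn : (0 : ℝ) ≤ n := Nat.cast_nonneg _
    calc (n : ℝ) ^ 3 + 1 ≤ (n + 1) ^ 3 := by nlinarith [sq_nonneg (n : ℝ)]
      _ ≤ (2 ^ l₁) ^ 3 := by gcongr
      _ = 2 ^ (3 * l₁) := by rw [← pow_mul, mul_comm]
  have h3 := Real.log_le_log (by positivity) h1
  rw [Real.log_pow] at h3
  push_cast at h3
  have := Real.log_two_lt_d9
  have : (0 : ℝ) ≤ l₁ := Nat.cast_nonneg _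
  nlinarith

/-- The digit counts replace the logarithms: `b` for `log w`, `l₁` for `log n` and `l` for `log log
n`. Here `l₁` serves as the bound `Λ` on the number of scales, since `n³ + 1 < (n + 1)⁴ ≤ 16 ^ l₁`.
-/
theorem Bounds.of_sizes (hw : 0 < w) (hwn : w < n) {b l₁ l : ℕ} (hbn : b ≤ n)
    (hln : l ≤ n) (hb : IsSize b w) (hl₁ : IsSize l₁ n) (hl : IsSize l l₁) :
    Bounds G s w b l l₁ (if ∑ p : Fin n, ∑ q : Fin n, answerX G s p q ≤ 0 then 1
        else ∑ p : Fin n, ∑ q : Fin n, answerX G s p q) := by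
  have hb1 : 1 ≤ b := by
    rw [Nat.one_le_iff_ne_zero]; rintro rfl
    have := hb.1; simp at this; omega
  have hl₁1 : 1 ≤ l₁ := by
    rw [Nat.one_le_iff_ne_zero]; rintro rfl
    have := hl₁.1; simp at this; omega
  have hl1 : 1 ≤ l := by
    rw [Nat.one_le_iff_ne_zero]; rintro rfl
    have := hl.1; simp at this; omega
  have hlog := Real.log_two_lt_d9
  have hb1' : (1 : ℝ) ≤ b := by exact_mod_cast hb1
  have hl1' : (1 : ℝ) ≤ l := by exact_mod_cast hl1
  refine ⟨?_, ?_, hb1, hbn, hl1, hln, ?_, ?_, ?_, ?_⟩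
  · split_ifs with h
    · exact one_pos
    · exact not_le.1 h
  · split_ifs with h
    · linarith
    · exact le_rfl
  · rcases hl₁.2 with h | h
    · omega
    · have := (Nat.lt_two_pow_self (n := l₁ - 1)).trans_le h
      omega
  · have h2 : (n : ℝ) + 1 ≤ 2 ^ l₁ := by exact_mod_cast hl₁.1
    have hn : (0 : ℝ) < n := by exact_mod_cast (Nat.zero_lt_of_lt hwn)
    calc (n : ℝ) ^ 3 + 1 < (n + 1) ^ 4 := by nlinarith [pow_pos hn 2, pow_pos hn 3, pow_pos hn 4]
      _ ≤ (2 ^ l₁) ^ 4 := by gcongr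
      _ = 16 ^ l₁ := by rw [← pow_mul, mul_comm, pow_mul]; norm_num
  · have h1 := log_cube_le hl₁.1
    have h2 : (l₁ : ℝ) + 1 ≤ 2 ^ l := by exact_mod_cast hl.1
    have h0 : 0 ≤ Real.log ((n : ℝ) ^ 3 + 1) := Real.log_nonneg (by
      have : (0 : ℝ) ≤ (n : ℝ) ^ 3 := by positivity
      linarith)
    -- The left side is at most `1 + 3 l₁`, hence at most four times `2 ^ l`. Then `(l + 2) log 2 ≤
    -- 3 l` because `l ≥ 1`.
    have h3 : 1 + Real.log ((n : ℝ) ^ 3 + 1) ≤ 2 ^ (l + 2) := by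
      rw [pow_add]; linarith
    have h4 := Real.log_le_log (by linarith) h3
    rw [Real.log_pow] at h4
    push_cast at h4
    nlinarith
  · have h1 : (w : ℝ) ≤ 2 ^ b := by exact_mod_cast hb.1.le
    have h2 : (b : ℝ) ≤ 2 ^ b := by exact_mod_cast (Nat.lt_two_pow_self (n := b)).le
    have h3 : (b : ℝ) * w ≤ 2 ^ b * 2 ^ b := mul_le_mul h2 h1 (Nat.cast_nonneg _) (by positivity)
    have h4 : (1 : ℝ) ≤ 2 ^ b * 2 ^ b := one_le_mul_of_one_le_of_one_le
      (one_le_pow₀ (by norm_num)) (one_le_pow₀ (by norm_num))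
    have h5 : 1024 * (b : ℝ) * w + 1 ≤ 2 ^ (b + b + 11) := by
      rw [pow_add, pow_add]; linarith
    have h6 := Real.log_le_log (by positivity) h5
    rw [Real.log_pow] at h6
    push_cast at h6
    nlinarith

/-- The sum over ordered pairs counts every edge at most twice. -/
theorem sum_answerX_le [DecidableRel G.Adj] (hs : s.Feasible G w) :
    ∑ p : Fin n, ∑ q : Fin n, answerX G s p q ≤ 2 * ∑ e ∈ G.edgeFinset, s.x e := by
  classical
  rw [← Fintype.sum_prod_type' (f := fun p q : Fin n => answerX G s p q)]
  set T : Finset (Fin n × Fin n) := Finset.univ.filter fun pq => G.Adj pq.1 pq.2 with hT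
  have h1 : ∑ pq : Fin n × Fin n, answerX G s pq.1 pq.2 = ∑ pq ∈ T, s.x s(pq.1, pq.2) := by
    rw [hT, Finset.sum_filter]
    refine Finset.sum_congr rfl fun pq _ => ?_
    split_ifs with h
    · exact answerX_of_adj h
    · rw [answerX, dif_pos ⟨pq.1.2, pq.2.2⟩]; exact if_neg h
  have hmap : ∀ pq ∈ T, s(pq.1, pq.2) ∈ G.edgeFinset := fun pq hpq => by
    rw [SimpleGraph.mem_edgeFinset]; exact (Finset.mem_filter.1 hpq).2
  rw [h1, ← Finset.sum_fiberwise_of_maps_to hmap, Finset.mul_sum]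
  refine Finset.sum_le_sum fun e he => ?_
  have hx : 0 ≤ s.x e := hs.x_nonneg e (SimpleGraph.mem_edgeFinset.1 he)
  have hcard : (T.filter fun pq => s(pq.1, pq.2) = e).card ≤ 2 := by
    induction e using Sym2.inductionOn with
    | hf a b =>
      refine (Finset.card_le_card (t := {(a, b), (b, a)}) fun pq hpq => ?_).trans Finset.card_le_two
      have := (Finset.mem_filter.1 hpq).2
      rw [Sym2.eq_iff] at this
      rw [Finset.mem_insert, Finset.mem_singleton]
      exact this.imp (fun h => Prod.ext h.1 h.2) fun h => Prod.ext h.1 h.2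
  calc ∑ pq ∈ T with s(pq.1, pq.2) = e, s.x s(pq.1, pq.2)
      = ∑ pq ∈ T with s(pq.1, pq.2) = e, s.x e :=
        Finset.sum_congr rfl fun pq hpq => by rw [(Finset.mem_filter.1 hpq).2]
    _ = (T.filter fun pq => s(pq.1, pq.2) = e).card * s.x e := by
        rw [Finset.sum_const, nsmul_eq_mul]
    _ ≤ 2 * s.x e := by
        refine mul_le_mul_of_nonneg_right ?_ hx
        exact_mod_cast hcard

/-- The number of cut pairs in terms of the sizes of the parameters. -/
theorem CostInv.card_le (hs : s.Feasible G w) (hn : 0 < n) {l l₁ : ℕ} {c : Conf n}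
    (hl₁ : n < 2 ^ l₁) {X σ : ℝ} (hX : X = ∑ p : Fin n, ∑ q : Fin n, answerX G s p q)
    (hσ : σ = if X ≤ 0 then 1 else X)
    (h : CostInv G s (n ^ 3) l σ (entropyPot σ (∑ p : Fin n, ∑ q : Fin n,
      (n ^ 3 : ℕ) * answerX G s p q)) l₁ c) (htop : c.top ≤ n * n) :
    (c.cutSet.card : ℝ) ≤ 5120 * (l * l₁) * X := by
  classical
  have hx0 : ∀ p q : Fin n, 0 ≤ answerX G s p q := fun p q => answerX_nonneg hs _ _
  by_cases hX0 : X ≤ 0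
  -- If all lengths vanish, nothing may be cut. This is ensured because only pairs of positive
  -- length are ever cut.
  · have hX1 : X = 0 := le_antisymm hX0 (by
      rw [hX]; exact Finset.sum_nonneg fun p _ => Finset.sum_nonneg fun q _ => hx0 p q)
    have hempty : c.cutSet = ∅ := by
      refine Finset.eq_empty_of_forall_notMem fun pq hpq => ?_
      have h1 := (h.pos pq.1 pq.2 (Finset.mem_filter.1 hpq).2).2
      have h2 : answerX G s pq.1 pq.2 ≤ X := by
        rw [hX]
        refine (Finset.single_le_sum (f := fun q : Fin n => answerX G s pq.1 q)
          (fun q _ => hx0 _ q) (Finset.mem_univ pq.2)).trans ?_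
        exact Finset.single_le_sum (f := fun p : Fin n => ∑ q : Fin n, answerX G s p q)
          (fun p _ => Finset.sum_nonneg fun q _ => hx0 p q) (Finset.mem_univ pq.1)
      linarith
    rw [hempty, hX1]; simp
  · rw [if_neg hX0] at hσ
    rw [hσ] at h
    have hpos : 0 < X := not_le.1 hX0
    set D : ℝ := (n : ℝ) ^ 3 with hD
    have hn' : (1 : ℝ) ≤ n := by exact_mod_cast hn
    have hDpos : 0 < D := by positivity
    have hsum : (∑ p : Fin n, ∑ q : Fin n, ((n ^ 3 : ℕ) : ℝ) * answerX G s p q) = D * X := by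
      rw [hX, hD, Finset.mul_sum]
      refine Finset.sum_congr rfl fun p _ => ?_
      rw [Finset.mul_sum]; push_cast; rfl
    have hpot : 0 ≤ c.pot G s (n ^ 3) X := Finset.sum_nonneg fun ℓ _ =>
      entropyPot_nonneg hpos (vol_nonneg hs _ _ _)
    have hcost := h.cost
    rw [hsum] at hcost
    have hΨ : entropyPot X (D * X) = D * X * Real.log (D + 1) := by
      rw [entropyPot]
      congr 2
      field_simp
    have hlog : Real.log (D + 1) ≤ 3 * l₁ := log_cube_le hl₁
    have htop' : (c.top : ℝ) ≤ D := by
      have : (c.top : ℝ) ≤ n * n := by exact_mod_cast htop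
      rw [hD]; nlinarith
    have hl : (0 : ℝ) ≤ l := Nat.cast_nonneg _
    have hl₁' : (0 : ℝ) ≤ l₁ := Nat.cast_nonneg _
    -- The constant `20` is `4 · 3 + 8`: the initial potential is at most `3 l₁ D X`, and the at
    -- most `n² ≤ D` balls contribute `8 X l₁` each. Multiplied by `256` it becomes `5120`.
    have h1 : 4 * (entropyPot X (D * X) - c.pot G s (n ^ 3) X) + 8 * X * l₁ * c.top ≤
        D * (20 * l₁ * X) := by
      rw [hΨ]
      have h2 : D * X * Real.log (D + 1) ≤ D * X * (3 * l₁) :=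
        mul_le_mul_of_nonneg_left hlog (by positivity)
      have h3 : 8 * X * l₁ * c.top ≤ 8 * X * l₁ * D :=
        mul_le_mul_of_nonneg_left htop' (by positivity)
      linarith
    have h2 : D * c.cutSet.card ≤ D * (5120 * (l * l₁) * X) := by
      push_cast at hcost
      refine hcost.trans ((mul_le_mul_of_nonneg_left h1 (by positivity)).trans (le_of_eq ?_))
      ring
    exact le_of_mul_le_mul_left h2 hDpos

/-- For `n ≥ 2` both `log (n + 2) ≥ 1.386` and `log log (n + 2) ≥ 0.27` are bounded away from zero,
so the additive constants of the digit counts are absorbed into the factors `3` and `12`. -/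
theorem sizes_le {l l₁ : ℕ} (hn : 2 ≤ n) (hl₁ : IsSize l₁ n) (hl : IsSize l l₁) :
    (l * l₁ : ℝ) ≤ 36 * (Real.log (n + 2) * Real.log (Real.log (n + 2))) := by
  have hn' : (2 : ℝ) ≤ n := by exact_mod_cast hn
  set L := Real.log ((n : ℝ) + 2) with hL
  have hlog2 := Real.log_two_gt_d9
  have h4 : 1.386 ≤ L := by
    have h1 : Real.log (2 ^ 2) ≤ L := Real.log_le_log (by norm_num) (by linarith)
    rw [Real.log_pow] at h1
    push_cast at h1
    linarith
  have hl₁0 : 0 < l₁ := by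
    rw [Nat.pos_iff_ne_zero]; rintro rfl
    have := hl₁.1; simp at this; omega
  have h1 : (l₁ : ℝ) ≤ 3 * L := by
    have h1 := hl₁.le_log
    have h2 : Real.log n ≤ L := Real.log_le_log (by linarith) (by linarith)
    linarith
  have hLL : 0.27 ≤ Real.log L := by
    have h1 := Real.one_sub_inv_le_log_of_pos (show 0 < L by linarith)
    have h2 : L⁻¹ ≤ 1.386⁻¹ := inv_anti₀ (by norm_num) h4
    have h3 : (1.386 : ℝ)⁻¹ ≤ 0.73 := by norm_num
    linarith
  have h2 : (l : ℝ) ≤ 12 * Real.log L := by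
    have h2 := hl.le_log
    have h3 : Real.log l₁ ≤ Real.log (3 * L) :=
      Real.log_le_log (by exact_mod_cast hl₁0) h1
    have h5 : Real.log 3 ≤ 1.1 := by
      have : (3 : ℝ) ≤ Real.exp 1.1 := by
        have h1 := Real.exp_one_gt_d9
        have h2 : Real.exp 1.1 = Real.exp 1 * Real.exp 0.1 := by rw [← Real.exp_add]; norm_num
        have h3 := Real.quadratic_le_exp_of_nonneg (show (0 : ℝ) ≤ 0.1 by norm_num)
        rw [h2]; nlinarith
      exact (Real.log_le_iff_le_exp (by norm_num)).2 this
    rw [Real.log_mul (by norm_num) (by linarith)] at h3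
    linarith
  have h0 : (0 : ℝ) ≤ l₁ := Nat.cast_nonneg _
  calc (l * l₁ : ℝ) ≤ 12 * Real.log L * (3 * L) := mul_le_mul h2 h1 h0 (by linarith)
    _ = 36 * (L * Real.log L) := by ring

theorem IsSize.le_log_succ {b : ℕ} (hw : 0 < w) (hb : IsSize b w) :
    (b : ℝ) ≤ 3 * Real.log (w + 1) := by
  have hw' : (1 : ℝ) ≤ w := by exact_mod_cast hw
  have h1 := hb.le_log
  have h2 : Real.log w ≤ Real.log (w + 1) := Real.log_le_log (by linarith) (by linarith)
  have h3 : Real.log 2 ≤ Real.log (w + 1) := Real.log_le_log (by norm_num) (by linarith)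
  have := Real.log_two_gt_d9
  linarith

end OracleRAM

/-! ### The main theorem -/

theorem treewidth_le_card {n : ℕ} (G : SimpleGraph (Fin n)) : treewidth G ≤ n := by
  have : BagTree G.Adj Finset.univ n 1 (fun _ => 0) (fun _ => Finset.univ) := by
    refine ⟨by omega, fun t ht h0 => by omega, by simp, fun z _ => ⟨0, by omega, by simp⟩,
      fun u _ v _ _ => ⟨0, by omega, by simp⟩, fun t ht h0 => by omega, by simp⟩
  exact treewidth_le_of_bagTree this

namespace OracleRAM

open Conf SProg

variable {n : ℕ} {G : SimpleGraph (Fin n)} {s : LPSolution n} {w : ℕ}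

/-- The set of cut edges. -/
noncomputable def Conf.cutEdges (G : SimpleGraph (Fin n)) [DecidableRel G.Adj] (c : Conf n) :
    Finset (Sym2 (Fin n)) :=
  open Classical in G.edgeFinset.filter fun e => ∃ u v, c.cut u v ∧ s(u, v) = e

theorem Conf.mem_cutEdges [DecidableRel G.Adj] {c : Conf n} (hsymm : ∀ p q, c.cut p q → c.cut q p)
    (hadj : ∀ p q, c.cut p q → G.Adj p q) (u v : Fin n) : s(u, v) ∈ c.cutEdges G ↔ c.cut u v := by
  classical
  rw [cutEdges, Finset.mem_filter]
  constructor
  · rintro ⟨-, p, q, hpq, he⟩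
    rcases Sym2.eq_iff.1 he with ⟨rfl, rfl⟩ | ⟨rfl, rfl⟩
    · exact hpq
    · exact hsymm _ _ hpq
  · exact fun h => ⟨SimpleGraph.mem_edgeFinset.2 (hadj u v h), u, v, h, rfl⟩

theorem Conf.card_cutEdges_le [DecidableRel G.Adj] (c : Conf n) :
    (c.cutEdges G).card ≤ c.cutSet.card := by
  classical
  have : c.cutEdges G ⊆ c.cutSet.image fun pq => s(pq.1, pq.2) := by
    intro e he
    obtain ⟨u, v, h, rfl⟩ := (Finset.mem_filter.1 he).2
    exact Finset.mem_image.2 ⟨(u, v), Finset.mem_filter.2 ⟨Finset.mem_univ _, h⟩, rfl⟩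
  exact (Finset.card_le_card this).trans Finset.card_image_le

/-- When every vertex is removed, the bags decompose the whole remaining graph, which is `G` without
the cut edges. -/
theorem Conf.StepInv.treewidth_le [DecidableRel G.Adj] {K : ℕ} {c : Conf n} (h : StepInv G K c)
    (hadj : ∀ p q, c.cut p q → G.Adj p q) (hrem : ∀ z, z ∈ c.rem) :
    treewidth (G.deleteEdges (c.cutEdges G : Set (Sym2 (Fin n)))) ≤ 2 * K := by
  obtain ⟨m, par, bag, hT, -⟩ := h.tree
  rw [Finset.eq_univ_of_forall hrem] at hT
  refine treewidth_le_of_bagTree (hT.mono fun u v huv => ?_)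
  rw [SimpleGraph.deleteEdges_adj] at huv
  exact ⟨huv.1, fun hc => huv.2 (Finset.mem_coe.2 ((mem_cutEdges h.symm hadj u v).2 hc))⟩

theorem log_mul_log_log_nonneg (hn : 0 < n) :
    0 ≤ Real.log ((n : ℝ) + 2) * Real.log (Real.log ((n : ℝ) + 2)) := by
  have hn' : (1 : ℝ) ≤ n := by exact_mod_cast hn
  have h1 : 1 ≤ Real.log ((n : ℝ) + 2) := by
    rw [Real.le_log_iff_exp_le (by linarith)]
    linarith [Real.exp_one_lt_d9]
  exact mul_nonneg (by linarith) (Real.log_nonneg h1)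

/-- The memory after running the program, when there are more than `w` vertices. -/
theorem mainProg_spec (hs : s.Feasible G w) (hw : 0 < w) (hwn : w < n) : ∃ b l₁ l : ℕ,
    IsSize b w ∧ IsSize l₁ n ∧ IsSize l l₁ ∧
      MainInv G s w b l l₁ (if ∑ p : Fin n, ∑ q : Fin n, answerX G s p q ≤ 0 then 1
        else ∑ p : Fin n, ∑ q : Fin n, answerX G s p q) (entropyPot
        (if ∑ p : Fin n, ∑ q : Fin n, answerX G s p q ≤ 0 then 1
          else ∑ p : Fin n, ∑ q : Fin n, answerX G s p q)
        (∑ p : Fin n, ∑ q : Fin n, (n ^ 3 : ℕ) * answerX G s p q)) n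
        (mainProg.den G s (input G w)) := by
  obtain ⟨b, l₁, l, hP, ⟨hbn, hb⟩, hl₁, hln, hl⟩ := setupProg_spec (s := s) (G := G) hwn
  refine ⟨b, l₁, l, hb, hl₁, hl, ?_⟩
  have hB := Bounds.of_sizes (s := s) (G := G) hw hwn hbn hln hb hl₁ hl
  set M := setupProg.den G s (input G w) with hM
  have hconf : M.conf n = ⟨fun _ _ => False, ∅, fun _ => 0, 0⟩ := by
    rw [conf_congr (M := input G w) fun a ha => den_nat setupProg (by revert a; decide) _]
    change Conf.mk _ _ _ _ = Conf.mk _ _ _ _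
    rw [Conf.mk.injEq]
    refine ⟨?_, ?_, ?_, ?_⟩
    · funext p q; simp [input]
    · ext z; simp [mem_rowSet, input]
    · funext z; simp [input]
    · simp [input]
  have hmain : mainProg.den G s (input G w) =
      (forN 20 (when (.zero (.vec 3 (.var 20))) stepProg)).den G s M := by
    rw [mainProg, den_ite, if_pos, den_seq]
    simp only [Test.Holds, NatExpr.eval, input]
    simpa using hwn
  rw [hmain]
  refine mainLoop_spec hs hw hB ⟨hP, ?_, ?_, ?_, fun z hz => by omega⟩
  · rw [hconf]; exact StepInv.init
  · rw [hconf]; exact CostInv.init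
  · rw [hconf]; exact Nat.zero_le _

/-- For `n ≤ w` loops of length `n` could not count up to `w`. Nothing needs to be done, as the
treewidth is at most `n` anyway. -/
theorem mainProg_den_of_le (hwn : n ≤ w) : mainProg.den G s (input G w) = input G w := by
  rw [mainProg, den_ite, if_neg, den_skip]
  simp only [Test.Holds, NatExpr.eval, input]
  simpa using hwn

/-- The quality of the output, when there are more than `w` vertices. -/
theorem mainProg_output [DecidableRel G.Adj] (hs : s.Feasible G w) (hw : 0 < w) (hwn : w < n) :
    ∃ F : Finset (Sym2 (Fin n)), Outputs (mainProg.den G s (input G w)) F ∧ F ⊆ G.edgeFinset ∧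
      (treewidth (G.deleteEdges (F : Set (Sym2 (Fin n)))) : ℝ) ≤
        368640 * ((w : ℝ) * Real.log ((w : ℝ) + 1)) ∧
      (F.card : ℝ) ≤ 368640 * (Real.log ((n : ℝ) + 2) * Real.log (Real.log ((n : ℝ) + 2))) *
        ∑ e ∈ G.edgeFinset, s.x e := by
  obtain ⟨b, l₁, l, hb, hl₁, hl, h⟩ := mainProg_spec hs hw hwn
  generalize mainProg.den G s (input G w) = M at h ⊢
  have hadj : ∀ p q, (M.conf n).cut p q → G.Adj p q := fun p q hpq => (h.cost.pos p q hpq).1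
  have hx : 0 ≤ ∑ e ∈ G.edgeFinset, s.x e := Finset.sum_nonneg fun e he =>
    hs.x_nonneg e (SimpleGraph.mem_edgeFinset.1 he)
  refine ⟨(M.conf n).cutEdges G, mem_cutEdges h.step.symm hadj, ?_, ?_, ?_⟩
  · classical exact Finset.filter_subset _ _
  · have h1 : (treewidth (G.deleteEdges ((M.conf n).cutEdges G : Set (Sym2 (Fin n)))) : ℝ) ≤
        (2 * (1024 * (b * w)) : ℕ) := by
      exact_mod_cast h.step.treewidth_le hadj fun z => h.mem_rem z z.2
    have hw' : (0 : ℝ) < w := by exact_mod_cast hw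
    have h2 := mul_le_mul_of_nonneg_right (hb.le_log_succ hw) hw'.le
    have h3 : 0 ≤ (w : ℝ) * Real.log ((w : ℝ) + 1) :=
      mul_nonneg hw'.le (Real.log_nonneg (by linarith))
    push_cast at h1
    linarith
  · have h1 : (((M.conf n).cutEdges G).card : ℝ) ≤ (M.conf n).cutSet.card := by
      exact_mod_cast card_cutEdges_le _
    have h2 := CostInv.card_le hs (by omega) hl₁.1 rfl rfl h.cost h.top_le
    have h0 : (0 : ℝ) ≤ l * l₁ := by positivity
    have h3 := mul_le_mul_of_nonneg_left (sum_answerX_le hs) h0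
    have h4 := mul_le_mul_of_nonneg_right (sizes_le (by omega) hl₁ hl) hx
    linarith

/-- The quality of the output, when there are at most `w` vertices. -/
theorem input_output [DecidableRel G.Adj] (hs : s.Feasible G w) (hw : 0 < w) (hwn : n ≤ w) :
    Outputs (input G w) (∅ : Finset (Sym2 (Fin n))) ∧
      (treewidth (G.deleteEdges ((∅ : Finset (Sym2 (Fin n))) : Set (Sym2 (Fin n)))) : ℝ) ≤
        368640 * ((w : ℝ) * Real.log ((w : ℝ) + 1)) ∧
      0 ≤ 368640 * (Real.log ((n : ℝ) + 2) * Real.log (Real.log ((n : ℝ) + 2))) *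
        ∑ e ∈ G.edgeFinset, s.x e := by
  refine ⟨fun u v => by simp [input], ?_, ?_⟩
  · have h1 : (treewidth (G.deleteEdges ((∅ : Finset (Sym2 (Fin n))) : Set (Sym2 (Fin n)))) : ℝ) ≤
        w := by exact_mod_cast (treewidth_le_card _).trans hwn
    have hw' : (1 : ℝ) ≤ w := by exact_mod_cast hw
    have h2 : Real.log 2 ≤ Real.log ((w : ℝ) + 1) := Real.log_le_log (by norm_num) (by linarith)
    have h3 := Real.log_two_gt_d9
    nlinarith
  · rcases Nat.eq_zero_or_pos n with rfl | hn
    -- For `n = 0` the factor `log log 2` is negative, but there are no edges to sum over.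
    · rw [Finset.sum_eq_zero fun e _ => e.inductionOn fun u => u.elim0, mul_zero]
    · exact mul_nonneg (mul_nonneg (by norm_num) (log_mul_log_log_nonneg hn))
        (Finset.sum_nonneg fun e he => hs.x_nonneg e (SimpleGraph.mem_edgeFinset.1 he))

end OracleRAM

theorem mainTheorem6 :
    ∃ (prog : OracleRAM.Prog) (C : ℝ) (c k : ℕ),
      ∀ (n w : ℕ) (G : SimpleGraph (Fin n)) [DecidableRel G.Adj] (s : LPSolution n),
        0 < w → s.Feasible G w →
        ∃ (M : OracleRAM.Memory) (t : ℕ) (F : Finset (Sym2 (Fin n))),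
          OracleRAM.Runs G s prog (OracleRAM.input G w) M t ∧
          t ≤ c * (n + 1) ^ k ∧
          OracleRAM.Outputs M F ∧
          F ⊆ G.edgeFinset ∧
          (treewidth (G.deleteEdges (F : Set (Sym2 (Fin n)))) : ℝ) ≤
            C * ((w : ℝ) * Real.log ((w : ℝ) + 1)) ∧
          (F.card : ℝ) ≤
            C * (Real.log ((n : ℝ) + 2) * Real.log (Real.log ((n : ℝ) + 2))) *
              ∑ e ∈ G.edgeFinset, s.x e := by
  -- The constant comes from the edge bound, `5120 · 2 · 36`: the charging argument, the two
  -- orientations of an edge and the digit counts. The treewidth bound would need only `2 · 1024 ·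
  -- 3`.
  refine ⟨OracleRAM.SProg.mainProg.compile, 368640, OracleRAM.SProg.mainProg.coeff, OracleRAM.SProg.mainProg.depth, ?_⟩
  intro n w G _ s hw hs
  obtain ⟨t, hrun, ht⟩ := OracleRAM.SProg.runs_compile (G := G) (s := s) OracleRAM.SProg.mainProg
    OracleRAM.SProg.mainProg_wf.1 OracleRAM.SProg.mainProg_wf.2 (OracleRAM.input G w)
    (by simp [OracleRAM.input])
  rcases le_or_gt n w with hwn | hwn
  · obtain ⟨hout, htw, hcard⟩ := OracleRAM.input_output hs hw hwn
    rw [OracleRAM.mainProg_den_of_le hwn] at hrun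
    refine ⟨_, t, ∅, hrun, ht, hout, Finset.empty_subset _, htw, ?_⟩
    rw [Finset.card_empty, Nat.cast_zero]
    exact hcard
  · obtain ⟨F, hout, hF, htw, hcard⟩ := OracleRAM.mainProg_output hs hw hwn
    exact ⟨_, t, F, hrun, ht, hout, hF, htw, hcard⟩
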